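/- Let $d\ge 1$ and let $\mathcal O\subset\mathbb R^d$ be a bounded polyhedral domain, i.e. a nonempty connected open set which is the interior of the underlying space of a finite simplicial complex in $\mathbb R^d$. Let $\lambda\ge 0$ and $g\in L^2(\mathcal O)$. A function $u\in L^1(\mathcal O)$ belongs to $BV(\mathcal O)$ if its distributional gradient $\nabla u$ is a finite $\mathbb R^d$-valued measure on $\mathcal O$; $\|\nabla u\|_{TV(\mathcal O)}$ denotes the total variation of this measure. The trace of $u$ at $x\in\partial\mathcal O$ is the number $u(x)$ with $\lim_{r\downarrow 0} r^{-d}\int_{\mathcal O\cap B_r(x)}|u(y)-u(x)|\,dy=0$, and $dS$ is the $(d-1)$-dimensional Hausdorff (surface) measure on $\partial\mathcal O$. Define, for $u\in L^1(\mathcal O)$, $$I(u)=\sup\Big\{\int_{\mathcal O}u\,\operatorname{div}\varphi\,dx:\ \varphi\in C^\infty(\mathbb R^d;\mathbb R^d),\ |\varphi|\le 1\text{ on }\mathbb R^d\Big\}\in[0,\infty],$$ and, for $u\in L^2(\mathcal O)$, $$J(u)=\|\nabla u\|_{TV(\mathcal O)}+\int_{\partial\mathcal O}|u|\,dS+\frac{\lambda}{2}\int_{\mathcal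 O}|u-g|^2\,dx\quad\text{if }u\in BV(\mathcal O),\qquad J(u)=\infty\quad\text{otherwise.}$$ Then: 1. Every $u\in BV(\mathcal O)$ has a trace at $S$-almost every point of $\partial\mathcal O$, the trace is integrable on $\partial\mathcal O$, and $$I(u)=\|\nabla u\|_{TV(\mathcal O)}+\int_{\partial\mathcal O}|u|\,dS .$$ 2. $I(u)=\infty$ for every $u\in L^1(\mathcal O)\setminus BV(\mathcal O)$. 3. $I$ is lower semicontinuous on $L^1(\mathcal O)$ with the weak topology, and it is convex, both as a $[0,\infty]$-valued functional on $L^1(\mathcal O)$ and on the convex set $BV(\mathcal O)$. 4. $J$ is lower semicontinuous on $L^2(\mathcal O)$ with the weak topology, and it is convex, both as a $[0,\infty]$-valued functional on $L^2(\mathcal O)$ and on the convex set $L^2(\mathcal O)\cap BV(\mathcal O)$. -/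

import Mathlib

open MeasureTheory Filter Topology Set
open scoped ENNReal NNReal ContDiff

namespace TVFlow

/-- Euclidean space `ℝ^d`. -/
abbrev Euc (d : ℕ) := EuclideanSpace ℝ (Fin d)

/-- A bounded polyhedral domain in `ℝ^d`: a nonempty connected open set which is the interior of
the underlying space of a finite simplicial complex. (It is open and bounded by construction.) -/
structure IsPolyhedralDomain {d : ℕ} (O : Set (Euc d)) : Prop where
  isConnected : IsConnected O
  exists_complex : ∃ K : Geometry.SimplicialComplex ℝ (Euc d),
    K.faces.Finite ∧ O = interior K.space

/-- The divergence of a vector field, `∑ i, ∂_i φ_i`. -/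
noncomputable def divergence {d : ℕ} (φ : Euc d → Euc d) (x : Euc d) : ℝ :=
  ∑ i : Fin d, (fderiv ℝ φ x (EuclideanSpace.single i 1)) i

/-- The functional `I(u) = sup {∫_O u div φ : φ ∈ C^∞(ℝ^d; ℝ^d), |φ| ≤ 1}`. As `φ = 0` is
admissible, the supremum is nonnegative, and it is taken in `[0, ∞]` (truncating negative values
of the integral does not change it). -/
noncomputable def functionalI {d : ℕ} (O : Set (Euc d)) (u : Euc d → ℝ) : ℝ≥0∞ :=
  ⨆ (φ : Euc d → Euc d) (_ : ContDiff ℝ ∞ φ) (_ : ∀ x, ‖φ x‖ ≤ 1),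
    ENNReal.ofReal (∫ x in O, u x * divergence φ x)

/-- `μ` is the distributional gradient of `u` on `O`: a finite `ℝ^d`-valued measure on `O`
(that is, on `ℝ^d` and carried by `O`) with `∫_O u ∇ψ dx = - ∫ ψ dμ` for all `ψ ∈ C_c^∞(O)`. -/
structure IsGradientMeasure {d : ℕ} (O : Set (Euc d)) (u : Euc d → ℝ)
    (μ : VectorMeasure (Euc d) (Euc d)) : Prop where
  finite : μ.variation univ < ⊤
  carried : μ.variation Oᶜ = 0
  integral_eq : ∀ ψ : Euc d → ℝ, ContDiff ℝ ∞ ψ → HasCompactSupport ψ → tsupport ψ ⊆ O →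
    ∫ x in O, u x • gradient ψ x = - ∫ᵛ x, ψ x ∂•μ

/-- `u ∈ BV(O)`: `u ∈ L¹(O)` and its distributional gradient is a finite vector measure on `O`. -/
def MemBV {d : ℕ} (O : Set (Euc d)) (u : Euc d → ℝ) : Prop :=
  IntegrableOn u O ∧ ∃ μ, IsGradientMeasure O u μ

open Classical in
/-- The gradient measure `∇u` of `u ∈ BV(O)`; it is determined by `u` (and set to `0` if the
distributional gradient of `u` is not a finite measure). -/
noncomputable def gradientMeasure {d : ℕ} (O : Set (Euc d)) (u : Euc d → ℝ) :
    VectorMeasure (Euc d) (Euc d) :=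
  if h : ∃ μ, IsGradientMeasure O u μ then h.choose else 0

/-- `‖∇u‖_{TV(O)}`, the total variation over `O` of the vector measure `∇u`, for `u ∈ BV(O)`. -/
noncomputable def gradientTV {d : ℕ} (O : Set (Euc d)) (u : Euc d → ℝ) : ℝ≥0∞ :=
  (gradientMeasure O u).variation O

/-- `z` is the trace of `u` at the boundary point `x`:
`r^{-d} ∫_{O ∩ B_r(x)} |u(y) - z| dy → 0` as `r ↓ 0`. -/
def HasTraceAt {d : ℕ} (O : Set (Euc d)) (u : Euc d → ℝ) (x : Euc d) (z : ℝ) : Prop :=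
  Tendsto (fun r : ℝ => (r ^ d)⁻¹ * ∫ y in O ∩ Metric.ball x r, |u y - z|) (𝓝[>] 0) (𝓝 0)

open Classical in
/-- The boundary trace of `u`, with the value `0` at points where there is no trace. -/
noncomputable def trace {d : ℕ} (O : Set (Euc d)) (u : Euc d → ℝ) (x : Euc d) : ℝ :=
  if h : ∃ z, HasTraceAt O u x z then h.choose else 0

/-- The surface measure on `∂O`: the `(d-1)`-dimensional Hausdorff measure (normalized so that it
is Lebesgue measure on hyperplanes) restricted to the topological boundary. -/
noncomputable def surfaceMeasure {d : ℕ} (O : Set (Euc d)) : Measure (Euc d) :=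
  (Measure.euclideanHausdorffMeasure (d - 1)).restrict (frontier O)

/-- `∫_{∂O} |u| dS`, with the boundary values of `u` in the sense of traces. -/
noncomputable def boundaryIntegral {d : ℕ} (O : Set (Euc d)) (u : Euc d → ℝ) : ℝ≥0∞ :=
  ∫⁻ x, ENNReal.ofReal |trace O u x| ∂(surfaceMeasure O)

open Classical in
/-- The energy `J(u) = ‖∇u‖_{TV(O)} + ∫_{∂O} |u| dS + (lam / 2) ∫_O |u - g|² dx` if `u ∈ BV(O)`,
and `J(u) = ∞` otherwise; for `u, g ∈ L²(O)`. -/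
noncomputable def energyJ {d : ℕ} (O : Set (Euc d)) (lam : ℝ) (g u : Euc d → ℝ) : ℝ≥0∞ :=
  if MemBV O u then
    gradientTV O u + boundaryIntegral O u + ENNReal.ofReal (lam / 2 * ∫ x in O, |u x - g x| ^ 2)
  else ⊤

end TVFlow

/-!
The extension of `u` by zero carries the whole argument. If the functional `I(u)` is finite, then
`I` bounds the distributional derivatives of this extension on all of `ℝ^d`, and by the Riesz
representation theorem they form a finite vector measure, written as `h ν` with a finite positive
measure `ν` and an integrable density `h` (`HasExtGradient`, `exists_hasExtGradient`). By `L¹`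
duality `I(u)` is the total mass `∫ ‖h‖ dν` (`HasExtGradient.functionalI_eq`), and the restriction
of `h ν` to `O` is the gradient measure of `u`. So the formula for `I` says that the mass of
`‖h‖ ν` on `∂O` is the boundary integral of the trace.

*The functional is finite on `BV`.* The polyhedral domain is, up to a null set, a finite disjoint
union of open simplices. On an open polytope with interior point `p`, testing the gradient with
dilations of a field about `p` shows that the mass of `|u|` in the boundary layer of width `s` is
`O(s)` (`exists_layer_bound`); hence cutting off a test field near the boundary of the polytope
costs only a bounded amount (`exists_bound_of_polytope`).

*The gradient on hyperplanes.* The component of `h ν` in a direction `e` does not charge null sets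
that are invariant under translation in the direction `e` (`HasExtGradient.ae_inner_eq_zero`).
Therefore `h` is normal to each hyperplane, `h ν` vanishes on the intersection of two transversal
hyperplanes, and the restriction of `h ν` to a hyperplane has a density `T` with respect to the
surface measure (`HasExtGradient.exists_isJumpDensity`).

*Traces.* A boundary point is flat if near it `O` is a half space bounded by a facet hyperplane.
There the difference between `u` and `T` is an integral of the normal derivative over the interior
of `O`, so it is controlled by the mass of `‖h‖ ν` inside `O`. That mass is singular to the surface
measure, and differentiation of measures shows that `T` is the trace almost everywhere
(`HasExtGradient.integral_norm_sub_le`, `HasExtGradient.ae_hasTraceAt`). All boundary points that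
are not flat lie on two transversal facet hyperplanes (`IsCellUnion.frontier_cases`), a null set
both for the surface measure and for `‖h‖ ν`.

*Semicontinuity and convexity.* `I` and the squared `L²` distance are suprema of continuous affine
functionals, and the energy is `I(u) + (lam / 2) ‖u - g‖²` on all of `L²`.
-/

/-! ### Density of test functions and `L¹` duality -/

namespace TVFlow

set_option linter.unusedSectionVars false

section Density

variable {E : Type*} [NormedAddCommGroup E] [NormedSpace ℝ E] [FiniteDimensional ℝ E]
  [MeasurableSpace E] [BorelSpace E]
  {F : Type*} [NormedAddCommGroup F] [InnerProductSpace ℝ F]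

/-- `φ` is a test function on `U`: smooth on the whole space, with compact support inside `U`. -/
structure IsTest (U : Set E) (φ : E → F) : Prop where
  contDiff : ContDiff ℝ ∞ φ
  compact : HasCompactSupport φ
  subset : tsupport φ ⊆ U

lemma IsTest.mono {U V : Set E} {φ : E → F} (h : IsTest U φ) (hUV : U ⊆ V) : IsTest V φ :=
  ⟨h.contDiff, h.compact, h.subset.trans hUV⟩

lemma IsTest.continuous {U : Set E} {φ : E → F} (h : IsTest U φ) : Continuous φ :=
  h.contDiff.continuous

/-- Radial truncation to the unit ball. -/
noncomputable def truncate (x : F) : F := (max 1 ‖x‖)⁻¹ • x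

lemma continuous_truncate : Continuous (truncate (F := F)) := by
  unfold truncate
  refine Continuous.smul (Continuous.inv₀ (by fun_prop) fun x => ?_) continuous_id
  exact (lt_of_lt_of_le one_pos (le_max_left _ _)).ne'

lemma norm_truncate_le (x : F) : ‖truncate x‖ ≤ 1 := by
  have h0 : (0 : ℝ) < max 1 ‖x‖ := lt_of_lt_of_le one_pos (le_max_left _ _)
  rw [truncate, norm_smul, norm_inv, Real.norm_of_nonneg h0.le, inv_mul_le_iff₀ h0, mul_one]
  exact le_max_right _ _

/-- Truncating an approximation `x` of a point `y` of the unit ball at most doubles the error. -/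
lemma norm_sub_truncate_le {x y : F} (hy : ‖y‖ ≤ 1) : ‖y - truncate x‖ ≤ 2 * ‖y - x‖ := by
  have h0 : (0 : ℝ) < max 1 ‖x‖ := lt_of_lt_of_le one_pos (le_max_left _ _)
  have h1 : ‖x - truncate x‖ ≤ ‖y - x‖ := by
    rcases le_total ‖x‖ 1 with h | h
    · simp [truncate, max_eq_left h]
    · have hx : (0 : ℝ) < ‖x‖ := one_pos.trans_le h
      have : x - truncate x = (1 - ‖x‖⁻¹) • x := by
        rw [truncate, max_eq_right h, sub_smul, one_smul]
      rw [this, norm_smul, Real.norm_of_nonneg (by simpa using inv_le_one_of_one_le₀ h), sub_mul,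
        inv_mul_cancel₀ hx.ne']
      have := norm_sub_norm_le x y
      rw [norm_sub_rev] at this
      linarith
  calc ‖y - truncate x‖ = ‖(y - x) + (x - truncate x)‖ := by congr 1; abel
    _ ≤ _ := (norm_add_le _ _).trans (by linarith)

/-- Test functions on an open set `U` with values in the unit ball are dense, for the `L¹` norm of
a finite measure, in the measurable functions with values in the unit ball that vanish off `U`. -/
lemma exists_isTest_approx (ν : Measure E) [IsFiniteMeasure ν] {U : Set E} (hU : IsOpen U)
    {f : E → F} (hf : AEStronglyMeasurable f ν) (hf1 : ∀ x, ‖f x‖ ≤ 1) (hfU : ∀ x ∉ U, f x = 0)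
    {ε : ℝ} (hε : 0 < ε) :
    ∃ φ : E → F, IsTest U φ ∧ (∀ x, ‖φ x‖ ≤ 1) ∧ ∫ x, ‖f x - φ x‖ ∂ν ≤ ε := by
  have hfi : Integrable f ν := Integrable.of_bound hf 1 (ae_of_all _ hf1)
  obtain ⟨g, -, hfg, hg, hgi⟩ := hfi.exists_hasCompactSupport_integral_sub_le
    (show (0 : ℝ) < ε / 6 by positivity)
  obtain ⟨K, hKU, hK, hKν⟩ := hU.measurableSet.exists_isCompact_sdiff_lt (measure_ne_top ν U)
    (ε := ENNReal.ofReal (ε / 6)) (by positivity)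
  -- a continuous cutoff with compact support inside `U`
  obtain ⟨K', hK'c, hK'cl, hKK', hK'U⟩ := exists_compact_closed_between hK hU hKU
  obtain ⟨χ, hχ1, hχ0, -, hχ⟩ := exists_continuous_one_zero_of_isCompact hK
    (isOpen_interior (s := K')).isClosed_compl (disjoint_compl_right_iff_subset.mpr hKK')
  have hχsupp : tsupport χ ⊆ K' := by
    refine closure_minimal (fun x hx => ?_) hK'cl
    by_contra h
    exact hx (hχ0 fun h' => h (interior_subset h'))
  set g' : E → F := fun x => χ x • truncate (g x) with hg'
  have hg'c : Continuous g' := χ.continuous.smul (continuous_truncate.comp hg)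
  have hg'1 : ∀ x, ‖g' x‖ ≤ 1 := fun x => by
    rw [hg', norm_smul, Real.norm_of_nonneg (hχ x).1]
    exact mul_le_one₀ (hχ x).2 (norm_nonneg _) (norm_truncate_le _)
  set V : ℝ := ν.real univ with hV
  have hV0 : 0 ≤ V := measureReal_nonneg
  set δ : ℝ := ε / (6 * (V + 1)) with hδ
  have hδ0 : 0 < δ := by positivity
  obtain ⟨ψ, hψ, hψg, hψs⟩ := hg'c.exists_contDiff_approx ⊤ (ε := fun _ => δ) continuous_const
    (fun _ => hδ0)
  have hts : tsupport ψ ⊆ tsupport χ := by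
    refine closure_mono (hψs.trans fun x hx => ?_)
    simp only [hg', Function.mem_support, ne_eq, smul_eq_zero, not_or] at hx
    exact hx.1
  have hψ1 : ∀ x, ‖ψ x‖ ≤ 1 + δ := fun x => by
    have h1 := (hψg x).le
    rw [dist_eq_norm] at h1
    have := norm_le_norm_add_norm_sub' (ψ x) (g' x)
    linarith [hg'1 x]
  have h1δ : (0 : ℝ) < 1 + δ := by positivity
  have hK's : ∀ x ∉ K', ψ x = 0 := fun x hx => by
    by_contra h
    exact hx (hχsupp (hts (subset_tsupport _ h)))
  have hsub : tsupport (fun x => (1 + δ)⁻¹ • ψ x) ⊆ K' := by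
    refine closure_minimal (fun x hx => ?_) hK'cl
    by_contra h
    exact hx (by simp [hK's x h])
  have hpt : ∀ x, ‖f x - (1 + δ)⁻¹ • ψ x‖ ≤
      2 * ‖f x - g x‖ + (U \ K).indicator (fun _ => (2 : ℝ)) x + 2 * δ := fun x => by
    have h1 : ‖f x - g' x‖ ≤ 2 * ‖f x - g x‖ + (U \ K).indicator (fun _ => (2 : ℝ)) x := by
      by_cases hxK : x ∈ K
      · have : χ x = 1 := hχ1 hxK
        have hx : x ∉ U \ K := fun h => h.2 hxK
        simp only [hg', this, one_smul, indicator_of_notMem hx, add_zero]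
        exact norm_sub_truncate_le (hf1 x)
      by_cases hxU : x ∈ U
      · rw [indicator_of_mem (show x ∈ U \ K from ⟨hxU, hxK⟩)]
        have := norm_sub_le (f x) (g' x)
        linarith [hf1 x, hg'1 x, norm_nonneg (f x - g x)]
      · have h0 : χ x = 0 := hχ0 fun h => hxU (hK'U (interior_subset h))
        have hx : x ∉ U \ K := fun h => hxU h.1
        simp only [hg', h0, hfU x hxU, zero_smul, sub_zero, norm_zero, indicator_of_notMem hx]
        positivity
    have h2 : ‖g' x - ψ x‖ ≤ δ := by
      have := (hψg x).le
      rwa [dist_comm, dist_eq_norm] at this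
    have h3 : ‖ψ x - (1 + δ)⁻¹ • ψ x‖ ≤ δ := by
      have : ψ x - (1 + δ)⁻¹ • ψ x = (δ / (1 + δ)) • ψ x := by
        have : δ / (1 + δ) = 1 - (1 + δ)⁻¹ := by
          field_simp
          ring
        rw [this, sub_smul, one_smul]
      rw [this, norm_smul, Real.norm_of_nonneg (by positivity), div_mul_eq_mul_div,
        div_le_iff₀ h1δ]
      exact mul_le_mul_of_nonneg_left (hψ1 x) hδ0.le
    calc ‖f x - (1 + δ)⁻¹ • ψ x‖
        = ‖(f x - g' x) + (g' x - ψ x) + (ψ x - (1 + δ)⁻¹ • ψ x)‖ := by congr 1; abel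
      _ ≤ _ := norm_add₃_le
      _ ≤ _ := by linarith
  refine ⟨fun x => (1 + δ)⁻¹ • ψ x, ⟨?_, ?_, ?_⟩, fun x => ?_, ?_⟩
  · exact (contDiff_const (c := (1 + δ)⁻¹)).smul hψ
  · exact hK'c.of_isClosed_subset (isClosed_tsupport _) hsub
  · exact hsub.trans hK'U
  · rw [norm_smul, norm_inv, Real.norm_of_nonneg h1δ.le, inv_mul_le_iff₀ h1δ, mul_one]
    exact hψ1 x
  · have hi1 : Integrable (fun x => ‖f x - g x‖) ν := (hfi.sub hgi).norm
    have hi2 : Integrable ((U \ K).indicator (fun _ => (2 : ℝ))) ν :=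
      (integrable_const _).indicator (hU.measurableSet.diff hK.measurableSet)
    calc ∫ x, ‖f x - (1 + δ)⁻¹ • ψ x‖ ∂ν
        ≤ ∫ x, (2 * ‖f x - g x‖ + (U \ K).indicator (fun _ => (2 : ℝ)) x + 2 * δ) ∂ν :=
          integral_mono_of_nonneg (ae_of_all _ fun _ => norm_nonneg _)
            (((hi1.const_mul 2).add hi2).add (integrable_const _)) (ae_of_all _ hpt)
      _ = 2 * ∫ x, ‖f x - g x‖ ∂ν + ν.real (U \ K) * 2 + V * (2 * δ) := by
          rw [integral_add (f := fun x => 2 * ‖f x - g x‖ + (U \ K).indicator (fun _ => (2 : ℝ)) x)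
            ((hi1.const_mul 2).add hi2) (integrable_const _),
            integral_add (hi1.const_mul 2) hi2, integral_const_mul,
            integral_indicator_const _ (hU.measurableSet.diff hK.measurableSet), integral_const]
          simp [hV]
      _ ≤ ε := by
          have h1 : ν.real (U \ K) ≤ ε / 6 :=
            ENNReal.toReal_le_of_le_ofReal (by positivity) hKν.le
          have h2 : V * (2 * δ) ≤ ε / 3 := by
            rw [hδ, ← mul_assoc, mul_div_assoc', div_le_div_iff₀ (by positivity) (by positivity)]
            nlinarith
          linarith

/-- `L¹`-duality: the integral of `‖h‖` over an open set `U` is the supremum of `∫ ⟪φ, h⟫` over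
test functions `φ` on `U` with values in the unit ball. -/
lemma setIntegral_norm_le_of_forall_isTest [SecondCountableTopology F] {ν : Measure E} {U : Set E}
    (hU : IsOpen U) {h : E → F} (hh : Integrable h ν) {C : ℝ}
    (hC : ∀ φ : E → F, IsTest U φ → (∀ x, ‖φ x‖ ≤ 1) → ∫ x, inner ℝ (φ x) (h x) ∂ν ≤ C) :
    ∫ x in U, ‖h x‖ ∂ν ≤ C := by
  refine le_of_forall_pos_le_add fun ε hε => ?_
  set ρ : Measure E := ν.withDensity fun x => ‖h x‖ₑ with hρ
  have : IsFiniteMeasure ρ := isFiniteMeasure_withDensity (by simpa using! hh.2.ne)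
  set f : E → F := U.indicator fun x => ‖h x‖⁻¹ • h x with hf
  have hfν : AEStronglyMeasurable f ν :=
    (hh.1.norm.inv₀.smul hh.1).indicator hU.measurableSet
  have hf1 : ∀ x, ‖f x‖ ≤ 1 := fun x => by
    rw [hf, norm_indicator_eq_indicator_norm]
    refine indicator_le' (fun x _ => ?_) (fun _ _ => zero_le_one) x
    rw [norm_smul, norm_inv, norm_norm]
    exact inv_mul_le_one
  obtain ⟨φ, hφ, hφ1, hφf⟩ := exists_isTest_approx ρ hU
    (hfν.mono_ac (withDensity_absolutelyContinuous _ _)) hf1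
    (fun x hx => indicator_of_notMem hx _) hε
  have hin : ∀ {w : E → F}, AEStronglyMeasurable w ν → (∀ x, ‖w x‖ ≤ 2) →
      Integrable (fun x => inner ℝ (w x) (h x)) ν := fun hw hw1 => by
    refine (hh.norm.const_mul 2).mono' (hw.inner hh.1) (ae_of_all _ fun x => ?_)
    exact (norm_inner_le_norm _ _).trans (mul_le_mul_of_nonneg_right (hw1 x) (norm_nonneg _))
  have hφm : AEStronglyMeasurable φ ν := hφ.continuous.aestronglyMeasurable
  have e1 : ∫ x in U, ‖h x‖ ∂ν = ∫ x, inner ℝ (f x) (h x) ∂ν := by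
    rw [← integral_indicator hU.measurableSet]
    refine integral_congr_ae (ae_of_all _ fun x => ?_)
    by_cases hx : x ∈ U
    · simp only [hf, indicator_of_mem hx, inner_smul_left, real_inner_self_eq_norm_sq]
      rcases eq_or_ne (h x) 0 with h0 | h0
      · simp [h0]
      · have : ‖h x‖ ≠ 0 := by simpa using h0
        simp only [conj_trivial]
        field_simp
    · simp [hf, indicator_of_notMem hx]
  have e2 : ∫ x, inner ℝ (f x - φ x) (h x) ∂ν ≤ ∫ x, ‖f x - φ x‖ ∂ρ := by
    rw [hρ, integral_withDensity_eq_integral_toReal_smul₀ hh.1.enorm (by simp)]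
    simp only [toReal_enorm, smul_eq_mul]
    have h2 : ∀ x, ‖f x - φ x‖ ≤ 2 := fun x => (norm_sub_le _ _).trans (by linarith [hf1 x, hφ1 x])
    refine integral_mono (hin (hfν.sub hφm) h2) ?_ fun x => ?_
    · refine (hh.norm.const_mul 2).mono' (hh.1.norm.mul (hfν.sub hφm).norm)
        (ae_of_all _ fun x => ?_)
      rw [Real.norm_of_nonneg (by positivity), mul_comm]
      exact mul_le_mul_of_nonneg_right (h2 x) (norm_nonneg _)
    · rw [mul_comm]
      exact real_inner_le_norm _ _
  calc ∫ x in U, ‖h x‖ ∂ν = ∫ x, (inner ℝ (φ x) (h x) + inner ℝ (f x - φ x) (h x)) ∂ν := by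
        rw [e1]
        refine integral_congr_ae (ae_of_all _ fun x => ?_)
        simp only [inner_sub_left]; ring
    _ = ∫ x, inner ℝ (φ x) (h x) ∂ν + ∫ x, inner ℝ (f x - φ x) (h x) ∂ν :=
        integral_add (hin hφm fun x => (hφ1 x).trans one_le_two)
          (hin (hfν.sub hφm) fun x => (norm_sub_le _ _).trans (by linarith [hf1 x, hφ1 x]))
    _ ≤ C + ε := add_le_add (hC φ hφ hφ1) (e2.trans hφf)

/-- A function orthogonal to all test functions on an open set vanishes there. -/
lemma ae_eq_zero_of_forall_isTest [SecondCountableTopology F] {ν : Measure E} {U : Set E}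
    (hU : IsOpen U) {h : E → F} (hh : Integrable h ν)
    (h0 : ∀ φ : E → F, IsTest U φ → ∫ x, inner ℝ (φ x) (h x) ∂ν = 0) :
    ∀ᵐ x ∂ν, x ∈ U → h x = 0 := by
  have h1 := setIntegral_norm_le_of_forall_isTest hU hh (C := 0) fun φ hφ _ => (h0 φ hφ).le
  have h2 : ∫ x in U, ‖h x‖ ∂ν = 0 := le_antisymm h1 (integral_nonneg fun _ => norm_nonneg _)
  rw [setIntegral_eq_zero_iff_of_nonneg_ae (ae_of_all _ fun _ => norm_nonneg _)
    hh.norm.integrableOn, EventuallyEq, ae_restrict_iff' hU.measurableSet] at h2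
  filter_upwards [h2] with x hx hxU using by simpa using hx hxU

end Density

end TVFlow

/-! ### Uniqueness of the gradient measure -/

namespace TVFlow

set_option linter.unusedSectionVars false

section VectorMeasure

variable {X F : Type*} {mX : MeasurableSpace X} [NormedAddCommGroup F] [NormedSpace ℝ F]
  [CompleteSpace F]

lemma ae_smul_eq_of_ae_withDensity_enorm {ν : Measure X} {h : X → F} (hh : Integrable h ν)
    {f g : X → ℝ} (hfg : f =ᵐ[ν.withDensity fun x => ‖h x‖ₑ] g) :
    (fun x => f x • h x) =ᵐ[ν] fun x => g x • h x := by
  rw [EventuallyEq, ae_withDensity_iff' hh.1.enorm] at hfg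
  filter_upwards [hfg] with x hx
  rcases eq_or_ne (h x) 0 with h0 | h0
  · simp [h0]
  · rw [hx (by simpa using h0)]

lemma integrable_smul_of_withDensity_enorm {ν : Measure X} {h : X → F} (hh : Integrable h ν)
    {f : X → ℝ} (hf : Integrable f (ν.withDensity fun x => ‖h x‖ₑ)) :
    Integrable (fun x => f x • h x) ν := by
  refine Integrable.congr ?_ (ae_smul_eq_of_ae_withDensity_enorm hh hf.1.ae_eq_mk).symm
  have h1 := hf.congr hf.1.ae_eq_mk
  rw [integrable_withDensity_iff_integrable_smul₀' hh.1.enorm (by simp)] at h1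
  refine h1.mono (hf.1.stronglyMeasurable_mk.aestronglyMeasurable.smul hh.1)
    (ae_of_all _ fun x => ?_)
  simp [norm_smul, mul_comm]

/-- Integration against a vector measure given by a density. -/
lemma vectorMeasure_integral_withDensityᵥ {ν : Measure X} {h : X → F} (hh : Integrable h ν)
    {f : X → ℝ} (hf : Integrable f (ν.withDensity fun x => ‖h x‖ₑ)) :
    ∫ᵛ x, f x ∂•(ν.withDensityᵥ h) = ∫ x, f x • h x ∂ν := by
  have hvar := Measure.variation_withDensityᵥ hh
  have : IsFiniteMeasure (ν.withDensity fun x => ‖h x‖ₑ) :=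
    isFiniteMeasure_withDensity (by simpa using! hh.2.ne)
  have : IsFiniteMeasure (ν.withDensityᵥ h).variation := by rw [hvar]; infer_instance
  refine Integrable.induction (μ := ν.withDensity fun x => ‖h x‖ₑ)
    (fun f : X → ℝ => ∫ᵛ x, f x ∂•(ν.withDensityᵥ h) = ∫ x, f x • h x ∂ν) ?_ ?_ ?_ ?_ hf
  · intro c s hs _
    have : IsFiniteMeasure ((ν.withDensityᵥ h).restrict s).variation := by
      rw [VectorMeasure.variation_restrict hs]; infer_instance
    rw [VectorMeasure.integral_indicator hs, VectorMeasure.integral_const,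
      VectorMeasure.restrict_apply _ hs MeasurableSet.univ, univ_inter, withDensityᵥ_apply hh hs,
      ContinuousLinearMap.lsmul_apply, ← integral_smul, ← integral_indicator hs]
    refine integral_congr_ae (ae_of_all _ fun x => ?_)
    by_cases hx : x ∈ s <;> simp [hx]
  · intro f g _ hf hg hf' hg'
    rw [VectorMeasure.integral_add (by rwa [VectorMeasure.Integrable, hvar])
      (by rwa [VectorMeasure.Integrable, hvar]), hf', hg', ← integral_add
      (integrable_smul_of_withDensity_enorm hh hf) (integrable_smul_of_withDensity_enorm hh hg)]
    simp [add_smul]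
  · refine isClosed_eq ?_ ?_
    · have := VectorMeasure.continuous_integral (μ := ν.withDensityᵥ h)
        (B := ContinuousLinearMap.lsmul ℝ ℝ)
      rwa [hvar] at this
    · refine LipschitzWith.continuous (K := 1) (LipschitzWith.of_dist_le_mul fun f g => ?_)
      have hf := L1.integrable_coeFn f
      have hg := L1.integrable_coeFn g
      rw [dist_eq_norm, ← integral_sub (integrable_smul_of_withDensity_enorm hh hf)
        (integrable_smul_of_withDensity_enorm hh hg), dist_eq_norm, L1.norm_eq_integral_norm,
        integral_congr_ae (g := fun x => ‖f x - g x‖)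
          ((Lp.coeFn_sub f g).mono fun x hx => by rw [hx, Pi.sub_apply]),
        integral_withDensity_eq_integral_toReal_smul₀ hh.1.enorm (by simp), NNReal.coe_one, one_mul]
      refine (norm_integral_le_integral_norm _).trans (le_of_eq ?_)
      refine integral_congr_ae (ae_of_all _ fun x => ?_)
      simp [← sub_smul, norm_smul, mul_comm]
  · intro f g hfg _ hf
    rw [← integral_congr_ae (ae_smul_eq_of_ae_withDensity_enorm hh hfg), ← hf]
    exact (VectorMeasure.integral_congr_ae (by rwa [hvar])).symm

end VectorMeasure

section Uniqueness

variable {d : ℕ} {O : Set (Euc d)} {u : Euc d → ℝ} {μ μ' : VectorMeasure (Euc d) (Euc d)}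

/-- A vector measure carried by `O` that annihilates the test functions on `O` vanishes, since
indicator functions are limits of test functions in `L¹` of the variation. -/
lemma vectorMeasure_eq_zero_of_forall_isTest (hO : IsOpen O) (hμ : μ.variation univ < ⊤)
    (hμO : μ.variation Oᶜ = 0)
    (h : ∀ ψ : Euc d → ℝ, IsTest O ψ → ∫ᵛ x, ψ x ∂•μ = 0) : μ = 0 := by
  have : IsFiniteMeasure μ.variation := ⟨hμ⟩
  ext1 s hs
  have hsO : μ s = μ (s ∩ O) := by
    rw [← μ.of_add_of_sdiff (hs.inter hO.measurableSet) hs inter_subset_left,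
      sdiff_self_inter]
    have : μ (s \ O) = 0 := by
      rw [← enorm_eq_zero]
      refine le_antisymm ((VectorMeasure.enorm_measure_le_variation _ _).trans ?_) bot_le
      exact (measure_mono fun x hx => hx.2).trans hμO.le
    rw [this, add_zero]
  choose φ hφ _ hφs using fun n : ℕ => exists_isTest_approx μ.variation hO
    (f := (s ∩ O).indicator fun _ => (1 : ℝ))
    ((aestronglyMeasurable_const).indicator (hs.inter hO.measurableSet))
    (fun x => (norm_indicator_le_norm_self _ _).trans (by simp))
    (fun x hx => indicator_of_notMem (fun h => hx h.2) _) (Nat.one_div_pos_of_nat (α := ℝ) (n := n))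
  have hφi : ∀ n, Integrable (φ n) μ.variation := fun n =>
    (hφ n).continuous.integrable_of_hasCompactSupport (hφ n).compact
  have h1i : Integrable ((s ∩ O).indicator fun _ => (1 : ℝ)) μ.variation :=
    (integrable_const _).indicator (hs.inter hO.measurableSet)
  have hlim : Tendsto (fun n => ∫⁻ x, ‖φ n x - (s ∩ O).indicator (fun _ => (1 : ℝ)) x‖ₑ
      ∂μ.variation) atTop (𝓝 0) := by
    have : ∀ n, ∫⁻ x, ‖φ n x - (s ∩ O).indicator (fun _ => (1 : ℝ)) x‖ₑ ∂μ.variation ≤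
        ENNReal.ofReal (1 / ((n : ℝ) + 1)) := fun n => by
      have := ofReal_integral_norm_eq_lintegral_enorm ((hφi n).sub h1i)
      simp only [Pi.sub_apply] at this
      rw [← this]
      refine ENNReal.ofReal_le_ofReal ?_
      simp_rw [norm_sub_rev (φ n _)]
      exact hφs n
    refine tendsto_of_tendsto_of_tendsto_of_le_of_le tendsto_const_nhds ?_ (fun _ => bot_le) this
    rw [← ENNReal.ofReal_zero]
    exact ENNReal.tendsto_ofReal tendsto_one_div_add_atTop_nhds_zero_nat
  have key := VectorMeasure.tendsto_integral_of_L1 (μ := μ) (B := ContinuousLinearMap.lsmul ℝ ℝ)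
    ((s ∩ O).indicator fun _ => (1 : ℝ)) h1i.1 (Eventually.of_forall hφi) hlim
  have h0 : ∀ n, ∫ᵛ x, φ n x ∂•μ = 0 := fun n => h _ (hφ n)
  simp only [h0] at key
  have : IsFiniteMeasure (μ.restrict (s ∩ O)).variation := by
    rw [VectorMeasure.variation_restrict (hs.inter hO.measurableSet)]; infer_instance
  rw [VectorMeasure.integral_indicator (hs.inter hO.measurableSet), VectorMeasure.integral_const,
    VectorMeasure.restrict_apply _ (hs.inter hO.measurableSet) MeasurableSet.univ,
    univ_inter] at key
  simpa [hsO] using tendsto_nhds_unique key tendsto_const_nhds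

lemma IsGradientMeasure.eq (hO : IsOpen O) (h : IsGradientMeasure O u μ)
    (h' : IsGradientMeasure O u μ') : μ = μ' := by
  rw [← sub_eq_zero]
  have h1 : IsFiniteMeasure μ.variation := ⟨h.finite⟩
  have h2 : IsFiniteMeasure μ'.variation := ⟨h'.finite⟩
  have hle := VectorMeasure.variation_sub_le (μ := μ) (ν := μ')
  refine vectorMeasure_eq_zero_of_forall_isTest hO ?_ ?_ fun ψ hψ => ?_
  · exact (hle univ).trans_lt (measure_lt_top _ _)
  · refine le_antisymm ((hle _).trans ?_) bot_le
    simp [h.carried, h'.carried]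
  · have hi : ∀ ρ : Measure (Euc d), [IsFiniteMeasure ρ] → Integrable ψ ρ := fun ρ _ =>
      hψ.continuous.integrable_of_hasCompactSupport hψ.compact
    rw [VectorMeasure.integral_sub_vectorMeasure (hi _) (hi _), sub_eq_zero, ← neg_inj,
      ← h.integral_eq ψ hψ.contDiff hψ.compact hψ.subset,
      ← h'.integral_eq ψ hψ.contDiff hψ.compact hψ.subset]

lemma gradientMeasure_eq (hO : IsOpen O) (h : IsGradientMeasure O u μ) :
    gradientMeasure O u = μ := by
  have hex : ∃ μ, IsGradientMeasure O u μ := ⟨μ, h⟩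
  rw [gradientMeasure, dif_pos hex]
  exact hex.choose_spec.eq hO h

end Uniqueness

end TVFlow

/-! ### The functional and the gradient of the extension by zero -/

namespace TVFlow

section Divergence

variable {d : ℕ}

lemma fderiv_euc_apply {φ : Euc d → Euc d} {x : Euc d} (hφ : DifferentiableAt ℝ φ x) (e : Euc d)
    (i : Fin d) : (fderiv ℝ φ x e) i = fderiv ℝ (fun y => φ y i) x e := by
  have := (EuclideanSpace.proj i : Euc d →L[ℝ] ℝ).hasFDerivAt.comp x hφ.hasFDerivAt
  have h2 := this.fderiv
  rw [show (fun y => φ y i) = (EuclideanSpace.proj i : Euc d →L[ℝ] ℝ) ∘ φ from rfl,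
    h2]
  rfl

lemma sum_smul_single (v : Euc d) : ∑ i, v i • (EuclideanSpace.single i (1 : ℝ) : Euc d) = v := by
  ext j
  simp [Finset.sum_apply, Pi.single_apply]

lemma divergence_smul {χ : Euc d → ℝ} {φ : Euc d → Euc d} {x : Euc d}
    (hχ : DifferentiableAt ℝ χ x) (hφ : DifferentiableAt ℝ φ x) :
    divergence (fun y => χ y • φ y) x = χ x * divergence φ x + fderiv ℝ χ x (φ x) := by
  have h : ∀ i, (fderiv ℝ (fun y => χ y • φ y) x (EuclideanSpace.single i 1)) i =
      χ x * (fderiv ℝ φ x (EuclideanSpace.single i 1)) i +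
        φ x i * fderiv ℝ χ x (EuclideanSpace.single i 1) := fun i => by
    rw [fderiv_fun_smul hχ hφ]
    simp [mul_comm]
  simp only [divergence, h, Finset.sum_add_distrib, Finset.mul_sum]
  congr 1
  conv_rhs => rw [← sum_smul_single (φ x)]
  simp

lemma divergence_smul_const {χ : Euc d → ℝ} {x : Euc d} (hχ : DifferentiableAt ℝ χ x)
    (v : Euc d) : divergence (fun y => χ y • v) x = fderiv ℝ χ x v := by
  rw [divergence_smul hχ (differentiableAt_const v)]
  simp [divergence]

lemma divergence_neg (φ : Euc d → Euc d) (x : Euc d) :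
    divergence (fun y => -φ y) x = -divergence φ x := by
  simp [divergence, fderiv_fun_neg]

lemma divergence_congr {φ φ' : Euc d → Euc d} {x : Euc d} (h : φ =ᶠ[𝓝 x] φ') :
    divergence φ x = divergence φ' x := by
  simp [divergence, h.fderiv_eq]

lemma continuous_divergence {φ : Euc d → Euc d} (hφ : ContDiff ℝ ∞ φ) :
    Continuous (divergence φ) := by
  have := hφ.continuous_fderiv (by simp)
  unfold divergence
  fun_prop

lemma hasCompactSupport_divergence {φ : Euc d → Euc d} (hφ : HasCompactSupport φ) :
    HasCompactSupport (divergence φ) := by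
  refine (hφ.fderiv ℝ).mono fun x hx => ?_
  contrapose! hx
  simp only [Function.mem_support, not_not] at hx ⊢
  simp [divergence, hx]

/-- On a bounded set the test fields of the definition of `functionalI` may be taken with compact
support. -/
lemma exists_isTest_eventuallyEq {O : Set (Euc d)} (hO : IsOpen O) (hb : Bornology.IsBounded O)
    {φ : Euc d → Euc d} (hφ : ContDiff ℝ ∞ φ) (hφ1 : ∀ x, ‖φ x‖ ≤ 1) :
    ∃ φ', IsTest univ φ' ∧ (∀ x, ‖φ' x‖ ≤ 1) ∧ ∀ x ∈ O, φ' =ᶠ[𝓝 x] φ := by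
  obtain ⟨R, hR0, hR⟩ := hb.subset_closedBall_lt 0 (0 : Euc d)
  let χ : ContDiffBump (0 : Euc d) := ⟨R, R + 1, hR0, by linarith⟩
  refine ⟨fun x => χ x • φ x, ⟨χ.contDiff.smul hφ, χ.hasCompactSupport.smul_right, subset_univ _⟩,
    fun x => ?_, fun x hx => ?_⟩
  · rw [norm_smul, Real.norm_of_nonneg χ.nonneg]
    exact mul_le_one₀ χ.le_one (norm_nonneg _) (hφ1 x)
  · filter_upwards [hO.mem_nhds hx] with y hy
    rw [χ.one_of_mem_closedBall (hR hy), one_smul]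

lemma functionalI_le {O : Set (Euc d)} (hO : IsOpen O) (hb : Bornology.IsBounded O)
    {u : Euc d → ℝ} {C : ℝ≥0∞}
    (h : ∀ φ : Euc d → Euc d, IsTest univ φ → (∀ x, ‖φ x‖ ≤ 1) →
      ENNReal.ofReal (∫ x in O, u x * divergence φ x) ≤ C) : functionalI O u ≤ C := by
  refine iSup_le fun φ => iSup_le fun hφ => iSup_le fun hφ1 => ?_
  obtain ⟨φ', hφ', hφ'1, he⟩ := exists_isTest_eventuallyEq hO hb hφ hφ1
  rw [setIntegral_congr_fun (g := fun x => u x * divergence φ' x) hO.measurableSet fun x hx => by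
    simp only [divergence_congr (he x hx)]]
  exact h φ' hφ' hφ'1

lemma le_functionalI (O : Set (Euc d)) (u : Euc d → ℝ) {φ : Euc d → Euc d} (hφ : ContDiff ℝ ∞ φ)
    (hφ1 : ∀ x, ‖φ x‖ ≤ 1) :
    ENNReal.ofReal (∫ x in O, u x * divergence φ x) ≤ functionalI O u :=
  le_iSup_of_le φ (le_iSup_of_le hφ (le_iSup_of_le hφ1 le_rfl))

lemma integral_le_functionalI {O : Set (Euc d)} {u : Euc d → ℝ} (hI : functionalI O u ≠ ⊤)
    {φ : Euc d → Euc d} (hφ : ContDiff ℝ ∞ φ) (hφ1 : ∀ x, ‖φ x‖ ≤ 1) :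
    ∫ x in O, u x * divergence φ x ≤ (functionalI O u).toReal :=
  (ENNReal.ofReal_le_iff_le_toReal hI).1 (le_functionalI O u hφ hφ1)

lemma IntegrableOn.mul_continuous {S : Set (Euc d)} {u g : Euc d → ℝ} (hu : IntegrableOn u S)
    (hg : Continuous g) (hgc : HasCompactSupport g) :
    IntegrableOn (fun x => u x * g x) S := by
  obtain ⟨C, hC⟩ := hgc.exists_bound_of_continuous hg
  exact hu.mul_bdd hg.aestronglyMeasurable (ae_of_all _ hC)

lemma IsTest.fderiv_apply {ψ : Euc d → ℝ} {U : Set (Euc d)} (hψ : IsTest U ψ) (e : Euc d) :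
    IsTest U fun x => fderiv ℝ ψ x e :=
  ⟨(hψ.contDiff.fderiv_right (m := ∞) le_rfl).clm_apply contDiff_const,
    hψ.compact.fderiv_apply ℝ e, (tsupport_fderiv_apply_subset ℝ e).trans hψ.subset⟩

lemma IsTest.comp_apply {φ : Euc d → Euc d} {U : Set (Euc d)} (hφ : IsTest U φ) (i : Fin d) :
    IsTest U fun x => φ x i := by
  have hs : tsupport (fun x => φ x i) ⊆ tsupport φ :=
    closure_mono fun x hx h => hx (by simp [h])
  refine ⟨?_, hφ.compact.of_isClosed_subset (isClosed_tsupport _) hs, hs.trans hφ.subset⟩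
  exact (EuclideanSpace.proj i : Euc d →L[ℝ] ℝ).contDiff.comp hφ.contDiff

/-- Integration of a divergence against `u`, one component at a time. -/
lemma integral_mul_divergence {S : Set (Euc d)} {u : Euc d → ℝ} (hu : IntegrableOn u S)
    {φ : Euc d → Euc d} (hφ : IsTest univ φ) :
    ∫ x in S, u x * divergence φ x =
      ∑ i, ∫ x in S, u x * fderiv ℝ (fun y => φ y i) x (EuclideanSpace.single i 1) := by
  rw [← integral_finsetSum]
  · refine integral_congr_ae (ae_of_all _ fun x => ?_)
    simp only [divergence, Finset.mul_sum]
    refine Finset.sum_congr rfl fun i _ => ?_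
    rw [fderiv_euc_apply (hφ.contDiff.differentiable (by simp) x)]
  · intro i _
    have := (hφ.comp_apply i).fderiv_apply (EuclideanSpace.single i 1)
    exact IntegrableOn.mul_continuous hu this.continuous this.compact

end Divergence

section PolarGradient

variable {d : ℕ}

/-- `h ν` is the distributional gradient, on the whole of `ℝ^d`, of the extension of `u` by zero
outside `O`. The gradient measure is encoded by a finite positive measure `ν` and an integrable
density `h`. -/
structure HasExtGradient (O : Set (Euc d)) (u : Euc d → ℝ) (ν : Measure (Euc d))
    (h : Euc d → Euc d) : Prop where
  finite : IsFiniteMeasure ν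
  integrable : Integrable h ν
  integral_eq : ∀ (ψ : Euc d → ℝ), IsTest univ ψ → ∀ e,
    ∫ x in O, u x * fderiv ℝ ψ x e = - ∫ x, ψ x * inner ℝ e (h x) ∂ν

variable {O : Set (Euc d)} {u : Euc d → ℝ} {ν : Measure (Euc d)} {h : Euc d → Euc d}

lemma integrable_mul_inner (hh : Integrable h ν) {ψ : Euc d → ℝ} (hψ : Continuous ψ)
    (hψc : HasCompactSupport ψ) (e : Euc d) : Integrable (fun x => ψ x * inner ℝ e (h x)) ν := by
  obtain ⟨C, hC⟩ := hψc.exists_bound_of_continuous hψ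
  exact (hh.const_inner e).bdd_mul hψ.aestronglyMeasurable (ae_of_all _ hC)

lemma HasExtGradient.integral_divergence (H : HasExtGradient O u ν h) (hu : IntegrableOn u O)
    {φ : Euc d → Euc d} (hφ : IsTest univ φ) :
    ∫ x in O, u x * divergence φ x = - ∫ x, inner ℝ (φ x) (h x) ∂ν := by
  rw [integral_mul_divergence hu hφ,
    Finset.sum_congr rfl fun i _ => H.integral_eq _ (hφ.comp_apply i) (EuclideanSpace.single i 1),
    Finset.sum_neg_distrib, ← integral_finsetSum]
  · congr 1
    refine integral_congr_ae (ae_of_all _ fun x => ?_)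
    simp [PiLp.inner_apply, mul_comm]
  · exact fun i _ => integrable_mul_inner H.integrable (hφ.comp_apply i).continuous
      (hφ.comp_apply i).compact _

/-- The functional is the total mass of the gradient of the extension by zero. -/
lemma HasExtGradient.functionalI_eq (H : HasExtGradient O u ν h) (hO : IsOpen O)
    (hb : Bornology.IsBounded O) (hu : IntegrableOn u O) :
    functionalI O u = ∫⁻ x, ‖h x‖ₑ ∂ν := by
  have hi := H.integrable
  refine le_antisymm (functionalI_le hO hb fun φ hφ hφ1 => ?_) ?_
  · rw [H.integral_divergence hu hφ, ← ofReal_integral_norm_eq_lintegral_enorm hi]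
    refine ENNReal.ofReal_le_ofReal ((neg_le_abs _).trans ?_)
    rw [← Real.norm_eq_abs]
    refine (norm_integral_le_integral_norm _).trans
      (integral_mono_of_nonneg (ae_of_all _ fun _ => norm_nonneg _) hi.norm
        (ae_of_all _ fun x => ?_))
    refine (norm_inner_le_norm _ _).trans ?_
    exact mul_le_of_le_one_left (norm_nonneg _) (hφ1 x)
  · by_cases hI : functionalI O u = ⊤
    · exact hI ▸ le_top
    rw [← ofReal_integral_norm_eq_lintegral_enorm hi, ENNReal.ofReal_le_iff_le_toReal hI,
      ← setIntegral_univ]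
    refine setIntegral_norm_le_of_forall_isTest isOpen_univ hi fun φ hφ hφ1 => ?_
    have := integral_le_functionalI hI hφ.contDiff.neg fun x => by simpa using hφ1 x
    refine le_trans (le_of_eq ?_) this
    simp only [divergence_neg, mul_neg, integral_neg, H.integral_divergence hu hφ, neg_neg]

lemma inner_integral_smul_gradient (hu : IntegrableOn u O) {U : Set (Euc d)} {ψ : Euc d → ℝ}
    (hψ : IsTest U ψ) (e : Euc d) :
    inner ℝ e (∫ x in O, u x • gradient ψ x) = ∫ x in O, u x * fderiv ℝ ψ x e := by
  have hg : Continuous (gradient ψ) :=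
    (InnerProductSpace.toDual ℝ (Euc d)).symm.continuous.comp
      (hψ.contDiff.continuous_fderiv (by simp))
  have hgc : HasCompactSupport (gradient ψ) := by
    refine (hψ.compact.fderiv ℝ).mono fun x hx h0 => hx ?_
    simp [gradient, h0]
  obtain ⟨C, hC⟩ := hgc.exists_bound_of_continuous hg
  have hi : Integrable (fun x => u x • gradient ψ x) (volume.restrict O) :=
    hu.smul_bdd C hg.aestronglyMeasurable (ae_of_all _ hC)
  rw [← integral_inner hi]
  refine integral_congr_ae (ae_of_all _ fun x => ?_)
  simp only [inner_smul_right]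
  rw [real_inner_comm, inner_gradient_left]

lemma HasExtGradient.isGradientMeasure (H : HasExtGradient O u ν h) (hO : IsOpen O)
    (hu : IntegrableOn u O) : IsGradientMeasure O u ((ν.restrict O).withDensityᵥ h) := by
  have hi : Integrable h (ν.restrict O) := H.integrable.restrict
  have hvar := Measure.variation_withDensityᵥ hi
  have hfin : IsFiniteMeasure ((ν.restrict O).withDensity fun x => ‖h x‖ₑ) :=
    isFiniteMeasure_withDensity (by simpa using! hi.2.ne)
  refine ⟨by rw [hvar]; exact measure_lt_top _ _, ?_, fun ψ hψ hψc hψO => ?_⟩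
  · rw [hvar]
    exact withDensity_absolutelyContinuous _ _ (by simp [hO.measurableSet])
  · have hψt : IsTest O ψ := ⟨hψ, hψc, hψO⟩
    have hψi : Integrable ψ ((ν.restrict O).withDensity fun x => ‖h x‖ₑ) :=
      hψ.continuous.integrable_of_hasCompactSupport hψc
    rw [vectorMeasure_integral_withDensityᵥ hi hψi]
    refine ext_inner_left ℝ fun e => ?_
    rw [inner_integral_smul_gradient hu hψt, inner_neg_right,
      ← integral_inner (integrable_smul_of_withDensity_enorm hi hψi)]
    simp only [inner_smul_right]
    rw [H.integral_eq ψ (hψt.mono (subset_univ _)) e,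
      setIntegral_eq_integral_of_forall_compl_eq_zero]
    intro x hx
    rw [image_eq_zero_of_notMem_tsupport fun h' => hx (hψO h'), zero_mul]

lemma HasExtGradient.memBV (H : HasExtGradient O u ν h) (hO : IsOpen O)
    (hu : IntegrableOn u O) : MemBV O u :=
  ⟨hu, _, H.isGradientMeasure hO hu⟩

lemma HasExtGradient.gradientTV_eq (H : HasExtGradient O u ν h) (hO : IsOpen O)
    (hu : IntegrableOn u O) : gradientTV O u = ∫⁻ x in O, ‖h x‖ₑ ∂ν := by
  rw [gradientTV, gradientMeasure_eq hO (H.isGradientMeasure hO hu),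
    Measure.variation_withDensityᵥ H.integrable.restrict, withDensity_apply _ hO.measurableSet,
    Measure.restrict_restrict hO.measurableSet, inter_self]

/-- The gradient of the extension by zero does not charge the exterior of `O`. -/
lemma HasExtGradient.ae_eq_zero (H : HasExtGradient O u ν h)
    (hu : IntegrableOn u O) : ∀ᵐ x ∂ν, x ∉ closure O → h x = 0 := by
  refine ae_eq_zero_of_forall_isTest isClosed_closure.isOpen_compl H.integrable fun φ hφ => ?_
  rw [← neg_eq_zero, ← H.integral_divergence hu (hφ.mono (subset_univ _))]
  refine setIntegral_eq_zero_of_forall_eq_zero fun x hx => ?_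
  rw [divergence_congr (φ' := fun _ => 0), divergence]
  · simp
  · refine notMem_tsupport_iff_eventuallyEq.1 fun h' => hφ.subset h' (subset_closure hx)

/-- Against test fields supported in `O`, the divergence of a function of bounded variation is
controlled by the supremum norm. -/
lemma IsGradientMeasure.exists_bound {μ : VectorMeasure (Euc d) (Euc d)}
    (H : IsGradientMeasure O u μ) (hu : IntegrableOn u O) :
    ∃ V : ℝ, 0 ≤ V ∧ ∀ φ : Euc d → Euc d, IsTest O φ → (∀ x, ‖φ x‖ ≤ 1) →
      ∫ x in O, u x * divergence φ x ≤ V := by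
  have hfin : IsFiniteMeasure μ.variation := ⟨H.finite⟩
  refine ⟨∑ _i : Fin d, 1 * ‖ContinuousLinearMap.lsmul (E := Euc d) ℝ ℝ‖ * μ.variation.real univ,
    by positivity, fun φ hφ hφ1 => ?_⟩
  rw [integral_mul_divergence hu (hφ.mono (subset_univ _))]
  refine Finset.sum_le_sum fun i _ => ?_
  have hψ := hφ.comp_apply i
  rw [← inner_integral_smul_gradient hu hψ, H.integral_eq _ hψ.contDiff hψ.compact hψ.subset,
    inner_neg_right]
  refine (neg_le_abs _).trans ((abs_real_inner_le_norm _ _).trans ?_)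
  rw [PiLp.norm_single, norm_one, one_mul]
  exact VectorMeasure.norm_integral_le_of_norm_le_const (μ := μ) (f := fun x => φ x i)
    (B := ContinuousLinearMap.lsmul ℝ ℝ) (C := 1)
    (ae_of_all _ fun x => (PiLp.norm_apply_le (φ x) i).trans (hφ1 x))

end PolarGradient

end TVFlow

/-! ### Existence of the gradient of the extension by zero -/

namespace TVFlow

section WeakLimit

open CompactlySupported

variable {X : Type*} [TopologicalSpace X] [T2Space X] [LocallyCompactSpace X]
  [SecondCountableTopology X] [MeasurableSpace X] [BorelSpace X]

/-- Weak compactness of densities that are bounded in `L¹`: along an ultrafilter, they converge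
to a finite measure. The measure is the Riesz measure of the limit functional. -/
lemma exists_weakLimit {m : Measure X} {g : ℕ → X → ℝ} (hg : ∀ n, Integrable (g n) m)
    (hg0 : ∀ n x, 0 ≤ g n x) {C : ℝ} (hC : ∀ n, ∫ x, g n x ∂m ≤ C) (𝒰 : Ultrafilter ℕ) :
    ∃ ν : Measure X, IsFiniteMeasure ν ∧ ∀ f : X → ℝ, Continuous f → HasCompactSupport f →
      Tendsto (fun n => ∫ x, f x * g n x ∂m) 𝒰 (𝓝 (∫ x, f x ∂ν)) := by
  have hint : ∀ (f : C_c(X, ℝ)) n, Integrable (fun x => f x * g n x) m := fun f n => by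
    obtain ⟨K, hK⟩ := f.hasCompactSupport.exists_bound_of_continuous f.continuous
    exact (hg n).bdd_mul f.continuous.aestronglyMeasurable (ae_of_all _ hK)
  have hbd : ∀ (f : X → ℝ) (K : ℝ), Continuous f → (∀ x, ‖f x‖ ≤ K) → 0 ≤ K → ∀ n,
      |∫ x, f x * g n x ∂m| ≤ K * C := fun f K hf hK hK0 n => by
    rw [← Real.norm_eq_abs]
    calc ‖∫ x, f x * g n x ∂m‖ ≤ ∫ x, ‖f x * g n x‖ ∂m := norm_integral_le_integral_norm _
      _ ≤ ∫ x, K * g n x ∂m := by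
          refine integral_mono_of_nonneg (ae_of_all _ fun _ => norm_nonneg _)
            ((hg n).const_mul _) (ae_of_all _ fun x => ?_)
          simp only [norm_mul, Real.norm_of_nonneg (hg0 n x)]
          exact mul_le_mul_of_nonneg_right (hK x) (hg0 n x)
      _ = K * ∫ x, g n x ∂m := integral_const_mul _ _
      _ ≤ K * C := mul_le_mul_of_nonneg_left (hC n) hK0
  have hex : ∀ f : C_c(X, ℝ), ∃ l, Tendsto (fun n => ∫ x, f x * g n x ∂m) 𝒰 (𝓝 l) := fun f => by
    obtain ⟨K, hK⟩ := f.hasCompactSupport.exists_bound_of_continuous f.continuous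
    have hb := hbd f (max K 0) f.continuous (fun x => (hK x).trans (le_max_left _ _))
      (le_max_right _ _)
    obtain ⟨l, -, hl⟩ := isCompact_iff_ultrafilter_le_nhds'.1
      (isCompact_Icc (a := -(max K 0 * C)) (b := max K 0 * C))
      (𝒰.map fun n => ∫ x, f x * g n x ∂m) (by
        rw [Ultrafilter.mem_map]
        exact univ_mem' fun n => abs_le.1 (hb n))
    exact ⟨l, hl⟩
  choose Λ hΛ using hex
  let L : C_c(X, ℝ) →ₗ[ℝ] ℝ :=
    { toFun := Λ
      map_add' := fun f f' => by
        refine tendsto_nhds_unique (hΛ (f + f')) (((hΛ f).add (hΛ f')).congr fun n => ?_)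
        rw [← integral_add (hint f n) (hint f' n)]
        simp [add_mul]
      map_smul' := fun c f => by
        refine tendsto_nhds_unique (hΛ (c • f)) (((hΛ f).const_mul c).congr fun n => ?_)
        rw [← integral_const_mul]
        simp [mul_assoc] }
  let P : C_c(X, ℝ) →ₚ[ℝ] ℝ := PositiveLinearMap.mk₀ L fun f hf =>
    ge_of_tendsto' (hΛ f) fun n => integral_nonneg fun x => mul_nonneg (hf x) (hg0 n x)
  refine ⟨RealRMK.rieszMeasure P, ⟨?_⟩, fun f hf hfc => ?_⟩
  · rw [MeasurableSet.univ.measure_eq_iSup_isCompact]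
    refine lt_of_le_of_lt (iSup₂_le fun K _ => iSup_le fun hK => ?_)
      (ENNReal.ofReal_lt_top (r := C))
    obtain ⟨f, hf1, -, hfc, hf⟩ := exists_continuous_one_zero_of_isCompact hK
      (isClosed_empty) (disjoint_empty K)
    refine (RealRMK.rieszMeasure_le_of_eq_one P (f := ⟨f, hfc⟩) (fun x => (hf x).1) hK
      fun x hx => hf1 hx).trans (ENNReal.ofReal_le_ofReal ?_)
    refine le_of_tendsto' (hΛ ⟨f, hfc⟩) fun n => (le_abs_self _).trans ?_
    have := hbd f 1 f.continuous (fun x => by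
      rw [Real.norm_of_nonneg (hf x).1]; exact (hf x).2) zero_le_one n
    simpa using this
  · have := RealRMK.integral_rieszMeasure P ⟨⟨f, hf⟩, hfc⟩
    have h2 := hΛ ⟨⟨f, hf⟩, hfc⟩
    change Tendsto _ _ (𝓝 (P ⟨⟨f, hf⟩, hfc⟩)) at h2
    rw [← this] at h2
    exact h2

end WeakLimit

section DifferenceQuotient

variable {d : ℕ}

lemma IsTest.comp_add_const {ψ : Euc d → ℝ} (hψ : IsTest univ ψ) (v : Euc d) :
    IsTest univ fun x => ψ (x + v) :=
  ⟨hψ.contDiff.comp (contDiff_id.add contDiff_const),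
    hψ.compact.comp_homeomorph (Homeomorph.addRight v), subset_univ _⟩

lemma IsTest.hasDerivAt_comp_add_smul {U : Set (Euc d)} {ψ : Euc d → ℝ} (hψ : IsTest U ψ)
    (x e : Euc d) (s : ℝ) :
    HasDerivAt (fun s : ℝ => ψ (x + s • e)) (fderiv ℝ ψ (x + s • e) e) s := by
  have h1 := (hψ.contDiff.differentiable (by simp) (x + s • e)).hasFDerivAt
  have h2 : HasDerivAt (fun s : ℝ => x + s • e) e s := by
    simpa using ((hasDerivAt_id s).smul_const e).const_add x
  exact h1.comp_hasDerivAt s h2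

/-- The derivative of `∫ w ψ(· + s e)` in `s`. -/
lemma hasDerivAt_integral_translate {w : Euc d → ℝ} (hw : Integrable w) {ψ : Euc d → ℝ}
    (hψ : IsTest univ ψ) (e : Euc d) (s : ℝ) :
    HasDerivAt (fun s : ℝ => ∫ x, w x * ψ (x + s • e))
      (∫ x, w x * fderiv ℝ ψ (x + s • e) e) s := by
  have hd := hψ.fderiv_apply e
  obtain ⟨C, hC⟩ := hd.compact.exists_bound_of_continuous hd.continuous
  obtain ⟨K, hK⟩ := hψ.compact.exists_bound_of_continuous hψ.continuous
  have hm : ∀ s : ℝ, AEStronglyMeasurable (fun x => ψ (x + s • e)) volume := fun s =>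
    (hψ.continuous.comp (by fun_prop)).aestronglyMeasurable
  refine (hasDerivAt_integral_of_dominated_loc_of_deriv_le (bound := fun x => ‖w x‖ * C)
    (F' := fun s x => w x * fderiv ℝ ψ (x + s • e) e) univ_mem
    (Eventually.of_forall fun s => hw.1.mul (hm s))
    (hw.mul_bdd (hm s) (ae_of_all _ fun x => hK _)) ?_ ?_ (hw.norm.mul_const C) ?_).2
  · exact hw.1.mul (hd.continuous.comp (by fun_prop)).aestronglyMeasurable
  · refine ae_of_all _ fun x s _ => ?_
    rw [norm_mul]
    exact mul_le_mul_of_nonneg_left (hC _) (norm_nonneg _)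
  · exact ae_of_all _ fun x s _ => (hψ.hasDerivAt_comp_add_smul x e s).const_mul (w x)

variable {w : Euc d → ℝ} {e : Euc d} {C : ℝ}

lemma abs_integral_translate_sub_le (hw : Integrable w)
    (hC : ∀ ψ : Euc d → ℝ, IsTest univ ψ → (∀ x, ‖ψ x‖ ≤ 1) → |∫ x, w x * fderiv ℝ ψ x e| ≤ C)
    {ψ : Euc d → ℝ} (hψ : IsTest univ ψ) (hψ1 : ∀ x, ‖ψ x‖ ≤ 1) {s : ℝ} (hs : 0 ≤ s) :
    |(∫ x, w x * ψ (x + s • e)) - ∫ x, w x * ψ x| ≤ C * s := by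
  have := Convex.norm_image_sub_le_of_norm_hasDerivWithin_le (s := univ) (C := C)
    (f := fun s : ℝ => ∫ x, w x * ψ (x + s • e))
    (fun s _ => (hasDerivAt_integral_translate hw hψ e s).hasDerivWithinAt)
    (fun s _ => by
      have h1 := hC _ (hψ.comp_add_const (s • e)) (fun x => hψ1 _)
      simp only [fderiv_comp_add_right] at h1
      exact h1) convex_univ (mem_univ 0) (mem_univ s)
  simpa [abs_of_nonneg hs] using this

/-- The difference quotients of `w` in direction `e`. -/
noncomputable def diffQuot (w : Euc d → ℝ) (e : Euc d) (s : ℝ) (x : Euc d) : ℝ :=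
  s⁻¹ * (w (x - s • e) - w x)

lemma integrable_diffQuot (hw : Integrable w) (s : ℝ) : Integrable (diffQuot w e s) :=
  ((hw.comp_sub_right _).sub hw).const_mul _

lemma integral_mul_diffQuot (hw : Integrable w) {ψ : Euc d → ℝ} (hψ : IsTest univ ψ) (s : ℝ) :
    ∫ x, ψ x * diffQuot w e s x =
      s⁻¹ * ((∫ x, w x * ψ (x + s • e)) - ∫ x, w x * ψ x) := by
  obtain ⟨K, hK⟩ := hψ.compact.exists_bound_of_continuous hψ.continuous
  have h1 : ∫ x, w x * ψ (x + s • e) = ∫ x, w (x - s • e) * ψ x := by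
    rw [← integral_sub_right_eq_self (fun x => w x * ψ (x + s • e)) (s • e)]
    simp
  rw [h1, ← integral_sub, ← integral_const_mul]
  · exact integral_congr_ae (ae_of_all _ fun x => by simp only [diffQuot]; ring)
  · exact (hw.comp_sub_right _).mul_bdd hψ.continuous.aestronglyMeasurable (ae_of_all _ hK)
  · exact hw.mul_bdd hψ.continuous.aestronglyMeasurable (ae_of_all _ hK)

/-- If the distributional derivative of `w` is bounded, then the difference quotients of `w` are
bounded in `L¹`. -/
lemma integral_norm_diffQuot_le (hw : Integrable w)
    (hC : ∀ ψ : Euc d → ℝ, IsTest univ ψ → (∀ x, ‖ψ x‖ ≤ 1) → |∫ x, w x * fderiv ℝ ψ x e| ≤ C)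
    {s : ℝ} (hs : 0 < s) : ∫ x, ‖diffQuot w e s x‖ ≤ C := by
  rw [← setIntegral_univ]
  refine setIntegral_norm_le_of_forall_isTest isOpen_univ (integrable_diffQuot hw s)
    fun ψ hψ hψ1 => ?_
  have hin : ∀ x, inner ℝ (ψ x) (diffQuot w e s x) = ψ x * diffQuot w e s x := fun x => by
    simp [mul_comm]
  simp only [hin]
  rw [integral_mul_diffQuot hw hψ, inv_mul_le_iff₀ hs, mul_comm]
  exact (le_abs_self _).trans (abs_integral_translate_sub_le hw hC hψ hψ1 hs.le)

/-- A function whose distributional derivative in direction `e` is bounded has a difference of two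
finite measures as derivative: the weak limits of the positive and negative parts of the difference
quotients. -/
lemma exists_measure_derivative (hw : Integrable w)
    (hC : ∀ ψ : Euc d → ℝ, IsTest univ ψ → (∀ x, ‖ψ x‖ ≤ 1) → |∫ x, w x * fderiv ℝ ψ x e| ≤ C) :
    ∃ ν₁ ν₂ : Measure (Euc d), IsFiniteMeasure ν₁ ∧ IsFiniteMeasure ν₂ ∧
      ∀ ψ : Euc d → ℝ, IsTest univ ψ →
        ∫ x, w x * fderiv ℝ ψ x e = (∫ x, ψ x ∂ν₁) - ∫ x, ψ x ∂ν₂ := by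
  let s : ℕ → ℝ := fun n => 1 / ((n : ℝ) + 1)
  have hs : ∀ n, 0 < s n := fun n => Nat.one_div_pos_of_nat
  have hi : ∀ n, Integrable (diffQuot w e (s n)) := fun n => integrable_diffQuot hw _
  have hle : ∀ n, ∫ x, ‖diffQuot w e (s n) x‖ ≤ C := fun n =>
    integral_norm_diffQuot_le hw hC (hs n)
  let 𝒰 := hyperfilter ℕ
  have h𝒰 : (𝒰 : Filter ℕ) ≤ atTop := Nat.hyperfilter_le_atTop
  obtain ⟨ν₁, h₁, hν₁⟩ := exists_weakLimit (m := volume) (C := C)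
    (g := fun n x => max (diffQuot w e (s n) x) 0) (fun n => (hi n).pos_part)
    (fun n x => le_max_right _ _) (fun n => (integral_mono (hi n).pos_part (hi n).norm
      fun x => max_le (le_abs_self _) (abs_nonneg _)).trans (hle n)) 𝒰
  obtain ⟨ν₂, h₂, hν₂⟩ := exists_weakLimit (m := volume) (C := C)
    (g := fun n x => max (-diffQuot w e (s n) x) 0) (fun n => (hi n).neg_part)
    (fun n x => le_max_right _ _) (fun n => (integral_mono (hi n).neg_part (hi n).norm
      fun x => max_le (neg_le_abs _) (abs_nonneg _)).trans (hle n)) 𝒰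
  refine ⟨ν₁, ν₂, h₁, h₂, fun ψ hψ => ?_⟩
  obtain ⟨K, hK⟩ := hψ.compact.exists_bound_of_continuous hψ.continuous
  have hψm : AEStronglyMeasurable ψ volume := hψ.continuous.aestronglyMeasurable
  have l1 := (hν₁ ψ hψ.continuous hψ.compact).sub (hν₂ ψ hψ.continuous hψ.compact)
  have l2 : Tendsto (fun n => ∫ x, ψ x * diffQuot w e (s n) x) atTop
      (𝓝 (∫ x, w x * fderiv ℝ ψ x e)) := by
    have h0 := (hasDerivAt_integral_translate hw hψ e 0).tendsto_slope_zero
    have hs0 : Tendsto s atTop (𝓝[≠] 0) :=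
      tendsto_nhdsWithin_iff.2 ⟨tendsto_one_div_add_atTop_nhds_zero_nat,
        Eventually.of_forall fun n => (hs n).ne'⟩
    have := h0.comp hs0
    simp only [zero_smul, add_zero, zero_add] at this
    refine this.congr fun n => ?_
    rw [integral_mul_diffQuot hw hψ]
    rfl
  refine tendsto_nhds_unique (l2.mono_left h𝒰) (l1.congr fun n => ?_)
  rw [← integral_sub ((hi n).pos_part.bdd_mul hψm (ae_of_all _ hK))
    ((hi n).neg_part.bdd_mul hψm (ae_of_all _ hK))]
  refine integral_congr_ae (ae_of_all _ fun x => ?_)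
  simp only [← mul_sub]
  congr 1
  exact max_zero_sub_max_neg_zero_eq_self _

end DifferenceQuotient

section Riesz

variable {d : ℕ} {O : Set (Euc d)} {u : Euc d → ℝ}

/-- If the functional is finite at `u`, then the extension of `u` by zero has a finite vector
measure as gradient. -/
lemma exists_hasExtGradient (hO : IsOpen O) (hu : IntegrableOn u O)
    (hI : functionalI O u ≠ ⊤) : ∃ ν h, HasExtGradient O u ν h := by
  set w : Euc d → ℝ := O.indicator u with hw
  have hwi : Integrable w := hu.integrable_indicator hO.measurableSet
  have hwO : ∀ f : Euc d → ℝ, ∫ x, w x * f x = ∫ x in O, u x * f x := fun f => by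
    rw [← integral_indicator hO.measurableSet]
    refine integral_congr_ae (ae_of_all _ fun x => ?_)
    by_cases hx : x ∈ O <;> simp [hw, hx]
  have hC : ∀ i : Fin d, ∀ ψ : Euc d → ℝ, IsTest univ ψ → (∀ x, ‖ψ x‖ ≤ 1) →
      |∫ x, w x * fderiv ℝ ψ x (EuclideanSpace.single i 1)| ≤ (functionalI O u).toReal := by
    intro i ψ hψ hψ1
    have hdiv : ∀ x, divergence (fun y => ψ y • (EuclideanSpace.single i 1 : Euc d)) x =
        fderiv ℝ ψ x (EuclideanSpace.single i 1) := fun x =>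
      divergence_smul_const (hψ.contDiff.differentiable (by simp) x) _
    have hc : ContDiff ℝ ∞ fun y => ψ y • (EuclideanSpace.single i 1 : Euc d) :=
      hψ.contDiff.smul contDiff_const
    have h1 : ∀ x, ‖ψ x • (EuclideanSpace.single i 1 : Euc d)‖ ≤ 1 := fun x => by
      rw [norm_smul, PiLp.norm_single, norm_one, mul_one]; exact hψ1 x
    rw [hwO, abs_le']
    constructor
    · have := integral_le_functionalI hI hc h1
      simpa only [hdiv] using this
    · have := integral_le_functionalI hI hc.neg fun x => by rw [norm_neg]; exact h1 x
      simpa only [divergence_neg, hdiv, mul_neg, integral_neg] using this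
  choose ν₁ ν₂ hf₁ hf₂ hν using fun i => exists_measure_derivative hwi (hC i)
  set ν : Measure (Euc d) := ∑ i, (ν₁ i + ν₂ i) with hνdef
  have hle : ∀ i, ν₁ i + ν₂ i ≤ ν := fun i =>
    Finset.single_le_sum (f := fun i => ν₁ i + ν₂ i) (fun _ _ => Measure.zero_le _)
      (Finset.mem_univ i)
  have hac₁ : ∀ i, ν₁ i ≪ ν := fun i =>
    (Measure.absolutelyContinuous_of_le ((Measure.le_add_right le_rfl).trans (hle i)))
  have hac₂ : ∀ i, ν₂ i ≪ ν := fun i =>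
    (Measure.absolutelyContinuous_of_le ((Measure.le_add_left le_rfl).trans (hle i)))
  have hfin : IsFiniteMeasure ν := by rw [hνdef]; infer_instance
  set k : Fin d → Euc d → ℝ := fun i x =>
    ((ν₂ i).rnDeriv ν x).toReal - ((ν₁ i).rnDeriv ν x).toReal with hk
  have hki : ∀ i, Integrable (k i) ν := fun i =>
    Measure.integrable_toReal_rnDeriv.sub Measure.integrable_toReal_rnDeriv
  set h : Euc d → Euc d := fun x => ∑ i, k i x • (EuclideanSpace.single i (1 : ℝ) : Euc d) with hh
  have hhi : Integrable h ν := integrable_finsetSum _ fun i _ => (hki i).smul_const _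
  refine ⟨ν, h, hfin, hhi, fun ψ hψ e => ?_⟩
  obtain ⟨K, hK⟩ := hψ.compact.exists_bound_of_continuous hψ.continuous
  have hψm : ∀ {m : Measure (Euc d)}, AEStronglyMeasurable ψ m :=
    hψ.continuous.aestronglyMeasurable
  have e1 : ∀ i, ∫ x in O, u x * fderiv ℝ ψ x (EuclideanSpace.single i 1) =
      -∫ x, ψ x * k i x ∂ν := fun i => by
    have := hf₁ i
    have := hf₂ i
    have : SigmaFinite ν := hfin.toSigmaFinite
    rw [← hwO, hν i ψ hψ, ← integral_toReal_rnDeriv_mul (hac₁ i),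
      ← integral_toReal_rnDeriv_mul (hac₂ i), ← neg_sub, ← integral_sub
        (Measure.integrable_toReal_rnDeriv.mul_bdd hψm (ae_of_all _ hK))
        (Measure.integrable_toReal_rnDeriv.mul_bdd hψm (ae_of_all _ hK))]
    congr 1
    exact integral_congr_ae (ae_of_all _ fun x => by simp only [hk]; ring)
  calc ∫ x in O, u x * fderiv ℝ ψ x e
      = ∑ i, e i * ∫ x in O, u x * fderiv ℝ ψ x (EuclideanSpace.single i 1) := by
        simp only [← integral_const_mul]
        rw [← integral_finsetSum]
        · refine integral_congr_ae (ae_of_all _ fun x => ?_)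
          simp only
          conv_lhs => rw [← sum_smul_single e]
          simp only [map_sum, map_smul, smul_eq_mul, Finset.mul_sum]
          exact Finset.sum_congr rfl fun i _ => by ring
        · intro i _
          have := hψ.fderiv_apply (EuclideanSpace.single i 1)
          exact (IntegrableOn.mul_continuous hu this.continuous this.compact).const_mul _
    _ = - ∑ i, ∫ x, e i * (ψ x * k i x) ∂ν := by
        simp only [e1, integral_const_mul, mul_neg, Finset.sum_neg_distrib]
    _ = - ∫ x, ψ x * inner ℝ e (h x) ∂ν := by
        rw [← integral_finsetSum]
        · congr 1
          refine integral_congr_ae (ae_of_all _ fun x => ?_)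
          simp only [hh, inner_sum, inner_smul_right, Finset.mul_sum]
          refine Finset.sum_congr rfl fun i _ => ?_
          rw [EuclideanSpace.inner_single_right]
          simp only [conj_trivial]
          ring
        · exact fun i _ => (((hki i).bdd_mul hψm (ae_of_all _ hK))).const_mul _

end Riesz

end TVFlow

/-! ### Boundary layers of polytopes -/

namespace TVFlow

set_option linter.unusedSectionVars false

section Polytope

variable {d : ℕ} {ι : Type*} [Fintype ι]

/-- The open polytope cut out by the inequalities `1 + ⟪a i, y - p⟫ > 0`. The affine functions are
normalized to take the value `1` at the interior point `p`. -/
def openPolytope (a : ι → Euc d) (p : Euc d) : Set (Euc d) :=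
  {y | ∀ i, 0 < 1 + inner ℝ (a i) (y - p)}

variable {a : ι → Euc d} {p : Euc d} {u : Euc d → ℝ} {V : ℝ}

lemma isOpen_openPolytope : IsOpen (openPolytope a p) := by
  simp only [openPolytope, ofPred_forall]
  exact isOpen_iInter_of_finite fun i => isOpen_lt continuous_const (by fun_prop)

/-- The dilation of ratio `t⁻¹` about `p` maps the polytope into itself. -/
lemma mem_openPolytope_of_dilate {t : ℝ} (ht : 1 ≤ t) {y : Euc d}
    (hy : p + t • (y - p) ∈ openPolytope a p) : y ∈ openPolytope a p := fun i => by
  have h := hy i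
  rw [add_sub_cancel_left, inner_smul_right] at h
  nlinarith

/-- The radial fields transporting `ψ` along the dilations about `p`. -/
noncomputable def radialField (ψ : Euc d → ℝ) (p : Euc d) (t : ℝ) (y : Euc d) : Euc d :=
  (t ^ d * ψ (p + t • (y - p))) • (y - p)

lemma isTest_radialField (hb : Bornology.IsBounded (openPolytope a p)) {ψ : Euc d → ℝ}
    (hψ : IsTest (openPolytope a p) ψ) {t : ℝ} (ht : 1 ≤ t) :
    IsTest (openPolytope a p) (radialField ψ p t) := by
  have hcont : Continuous fun y : Euc d => p + t • (y - p) := by fun_prop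
  have hsub : tsupport (radialField ψ p t) ⊆ (fun y : Euc d => p + t • (y - p)) ⁻¹' tsupport ψ := by
    refine closure_minimal (fun y hy => ?_) ((isClosed_tsupport ψ).preimage hcont)
    refine subset_tsupport ψ fun h => hy ?_
    simp [radialField, h]
  have hsub' : tsupport (radialField ψ p t) ⊆ openPolytope a p := fun y hy =>
    mem_openPolytope_of_dilate ht (hψ.subset (hsub hy))
  refine ⟨?_, ?_, hsub'⟩
  · unfold radialField
    have : ContDiff ℝ ∞ fun y : Euc d => ψ (p + t • (y - p)) :=
      hψ.contDiff.comp (by fun_prop)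
    exact (contDiff_const.mul this).smul (contDiff_id.sub contDiff_const)
  · exact Metric.isCompact_of_isClosed_isBounded (isClosed_tsupport _) (hb.subset hsub')

lemma divergence_sub_const (p y : Euc d) : divergence (fun y : Euc d => y - p) y = d := by
  simp [divergence, fderiv_sub_const]

lemma divergence_radialField {ψ : Euc d → ℝ} (hψ : Differentiable ℝ ψ) (t : ℝ) (y : Euc d) :
    divergence (radialField ψ p t) y =
      t ^ d * ψ (p + t • (y - p)) * d + t ^ (d + 1) * fderiv ℝ ψ (p + t • (y - p)) (y - p) := by
  have h1 : HasFDerivAt (fun y : Euc d => p + t • (y - p))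
      (t • ContinuousLinearMap.id ℝ (Euc d)) y :=
    (((hasFDerivAt_id y).sub_const p).const_smul t).const_add p
  have h2 : HasFDerivAt (fun y : Euc d => t ^ d * ψ (p + t • (y - p)))
      (t ^ d • (fderiv ℝ ψ (p + t • (y - p))).comp (t • ContinuousLinearMap.id ℝ (Euc d))) y :=
    ((hψ _).hasFDerivAt.comp y h1).const_mul _
  have : radialField ψ p t =
      fun y => (t ^ d * ψ (p + t • (y - p))) • (fun y : Euc d => y - p) y := rfl
  rw [this, divergence_smul h2.differentiableAt (by fun_prop), divergence_sub_const, h2.fderiv]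
  simp
  ring

/-- The dilated test function moves along a divergence, so its integral against `u` is controlled
by the gradient of `u`. -/
lemma hasDerivAt_radial {ψ : Euc d → ℝ} (hψ : Differentiable ℝ ψ) {t : ℝ} (ht : t ≠ 0)
    (y : Euc d) :
    HasDerivAt (fun t : ℝ => t ^ d * ψ (p + t • (y - p)))
      (t⁻¹ * divergence (radialField ψ p t) y) t := by
  have h1 : HasDerivAt (fun t : ℝ => p + t • (y - p)) (y - p) t := by
    simpa using ((hasDerivAt_id t).smul_const (y - p)).const_add p
  have h2 := (hasDerivAt_pow d t).mul ((hψ (p + t • (y - p))).hasFDerivAt.comp_hasDerivAt t h1)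
  refine h2.congr_deriv ?_
  rw [divergence_radialField hψ]
  rcases Nat.eq_zero_or_pos d with rfl | hd
  · simp [ht]
  · obtain ⟨k, rfl⟩ : ∃ k, d = k + 1 := ⟨d - 1, by omega⟩
    simp only [Nat.add_sub_cancel, Function.comp]
    field_simp
    ring

/-- A one-sided bound over test fields in the unit ball gives, by scaling and reflection, a
two-sided bound for larger fields. -/
lemma abs_integral_divergence_le {U : Set (Euc d)}
    (hV : ∀ φ : Euc d → Euc d, IsTest U φ → (∀ x, ‖φ x‖ ≤ 1) →
      ∫ x in U, u x * divergence φ x ≤ V) {φ : Euc d → Euc d} (hφ : IsTest U φ) {K : ℝ}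
    (hK : 0 < K) (hφK : ∀ x, ‖φ x‖ ≤ K) : |∫ x in U, u x * divergence φ x| ≤ K * V := by
  have key : ∀ c : ℝ, |c| = K⁻¹ → c * ∫ x in U, u x * divergence φ x ≤ V := fun c hc => by
    have ht : IsTest U fun x => c • φ x := by
      have hs : tsupport (fun x => c • φ x) ⊆ tsupport φ :=
        closure_mono fun x hx h => hx (by simp [h])
      exact ⟨hφ.contDiff.const_smul c, hφ.compact.of_isClosed_subset (isClosed_tsupport _) hs,
        hs.trans hφ.subset⟩
    have := hV _ ht fun x => by
      rw [norm_smul, Real.norm_eq_abs, hc, inv_mul_le_iff₀ hK, mul_one]; exact hφK x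
    rw [← integral_const_mul]
    refine le_trans (le_of_eq (integral_congr_ae (ae_of_all _ fun x => ?_))) this
    have hd : divergence (fun x => c • φ x) x = c * divergence φ x := by
      rw [divergence_smul (χ := fun _ => c) (differentiableAt_const c)
        (hφ.contDiff.differentiable (by simp) x)]
      simp
    simp only [hd]; ring
  have h1 := key K⁻¹ (abs_of_pos (inv_pos.2 hK))
  have h2 := key (-K⁻¹) (by rw [abs_neg, abs_of_pos (inv_pos.2 hK)])
  rw [inv_mul_le_iff₀ hK] at h1
  rw [neg_mul, ← mul_neg, inv_mul_le_iff₀ hK] at h2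
  exact abs_le'.2 ⟨h1, h2⟩

/-- Transporting a test function along the dilations changes its integral against `u` at a bounded
rate. -/
lemma abs_integral_radial_sub_le (hb : Bornology.IsBounded (openPolytope a p))
    (hu : IntegrableOn u (openPolytope a p))
    (hV : ∀ φ : Euc d → Euc d, IsTest (openPolytope a p) φ → (∀ x, ‖φ x‖ ≤ 1) →
      ∫ x in openPolytope a p, u x * divergence φ x ≤ V)
    {R : ℝ} (hR : 0 < R) (hRC : ∀ y ∈ openPolytope a p, ‖y - p‖ ≤ R) {ψ : Euc d → ℝ}
    (hψ : IsTest (openPolytope a p) ψ) (hψ1 : ∀ x, ‖ψ x‖ ≤ 1) {t : ℝ} (ht : t ∈ Icc (1 : ℝ) 2) :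
    |(∫ y in openPolytope a p, u y * (t ^ d * ψ (p + t • (y - p)))) -
      ∫ y in openPolytope a p, u y * ψ y| ≤ 2 ^ d * R * V * (t - 1) := by
  have hdψ : Differentiable ℝ ψ := hψ.contDiff.differentiable (by simp)
  have hcont : ∀ t : ℝ, Continuous fun y : Euc d => p + t • (y - p) := fun t => by fun_prop
  have hcf := hψ.contDiff.continuous_fderiv (by simp)
  obtain ⟨K, hK⟩ := (hψ.compact.fderiv ℝ).exists_bound_of_continuous hcf
  have hK0 : 0 ≤ K := (norm_nonneg _).trans (hK 0)
  have hmeas : ∀ t : ℝ, AEStronglyMeasurable (fun y => t ^ d * ψ (p + t • (y - p)))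
      (volume.restrict (openPolytope a p)) := fun t =>
    (continuous_const.mul (hψ.continuous.comp (hcont t))).aestronglyMeasurable
  have hdiv : ∀ t : ℝ, AEStronglyMeasurable (divergence (radialField ψ p t))
      (volume.restrict (openPolytope a p)) := fun t => by
    have : divergence (radialField ψ p t) = fun y => t ^ d * ψ (p + t • (y - p)) * d +
        t ^ (d + 1) * fderiv ℝ ψ (p + t • (y - p)) (y - p) :=
      funext fun y => divergence_radialField hdψ t y
    rw [this]
    have h1 := hψ.continuous.comp (hcont t)
    have h2 : Continuous fun y => fderiv ℝ ψ (p + t • (y - p)) (y - p) :=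
      (hcf.comp (hcont t)).clm_apply (by fun_prop)
    exact (((continuous_const.mul h1).mul continuous_const).add
      (continuous_const.mul h2)).aestronglyMeasurable
  have hder : ∀ t ∈ Icc (1 : ℝ) 2, HasDerivAt
      (fun t : ℝ => ∫ y in openPolytope a p, u y * (t ^ d * ψ (p + t • (y - p))))
      (∫ y in openPolytope a p, u y * (t⁻¹ * divergence (radialField ψ p t) y)) t := by
    intro t ht
    have hs : Ioo (1 / 2 : ℝ) 3 ∈ 𝓝 t := Ioo_mem_nhds (by linarith [ht.1]) (by linarith [ht.2])
    refine (hasDerivAt_integral_of_dominated_loc_of_deriv_le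
      (bound := fun y => ‖u y‖ * (2 * (3 ^ d * 1 * d + 3 ^ (d + 1) * (K * R))))
      (F' := fun t y => u y * (t⁻¹ * divergence (radialField ψ p t) y)) hs
      (Eventually.of_forall fun t => hu.1.mul (hmeas t))
      (hu.mul_bdd (c := |t| ^ d) (hmeas t) (ae_of_all _ fun y => ?_)) ?_ ?_
      (hu.norm.mul_const _) ?_).2
    · rw [norm_mul, norm_pow, Real.norm_eq_abs]
      exact mul_le_of_le_one_right (by positivity) (hψ1 _)
    · exact hu.1.mul ((hdiv t).const_mul _)
    · filter_upwards [ae_restrict_mem isOpen_openPolytope.measurableSet] with y hy s hs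
      have hs0 : (0 : ℝ) < s := by linarith [hs.1]
      rw [norm_mul]
      refine mul_le_mul_of_nonneg_left ?_ (norm_nonneg _)
      rw [norm_mul, norm_inv, Real.norm_of_nonneg hs0.le, divergence_radialField hdψ]
      have h3 : s⁻¹ ≤ 2 := by rw [inv_le_comm₀ hs0 two_pos]; linarith [hs.1]
      refine mul_le_mul h3 ((norm_add_le _ _).trans (add_le_add ?_ ?_)) (norm_nonneg _) two_pos.le
      · rw [norm_mul, norm_mul, norm_pow, Real.norm_of_nonneg hs0.le, Real.norm_natCast]
        refine mul_le_mul_of_nonneg_right (mul_le_mul ?_ (hψ1 _) (norm_nonneg _) (by positivity))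
          (Nat.cast_nonneg _)
        exact pow_le_pow_left₀ hs0.le hs.2.le _
      · rw [norm_mul, norm_pow, Real.norm_of_nonneg hs0.le]
        refine mul_le_mul (pow_le_pow_left₀ hs0.le hs.2.le _) ?_ (norm_nonneg _) (by positivity)
        exact (ContinuousLinearMap.le_opNorm _ _).trans
          (mul_le_mul (hK _) (hRC y hy) (norm_nonneg _) hK0)
    · refine ae_of_all _ fun y s hs => ?_
      have hs0 : (0 : ℝ) < s := by linarith [hs.1]
      exact (hasDerivAt_radial hdψ hs0.ne' y).const_mul (u y)
  have hbound : ∀ t ∈ Icc (1 : ℝ) 2,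
      ‖∫ y in openPolytope a p, u y * (t⁻¹ * divergence (radialField ψ p t) y)‖ ≤
        2 ^ d * R * V := by
    intro t ht
    have ht0 : 0 < t := by linarith [ht.1]
    have hfield : ∀ y, ‖radialField ψ p t y‖ ≤ 2 ^ d * R := fun y => by
      by_cases hy : y ∈ openPolytope a p
      · rw [radialField, norm_smul, norm_mul, norm_pow, Real.norm_of_nonneg ht0.le]
        refine mul_le_mul ?_ (hRC y hy) (norm_nonneg _) (by positivity)
        exact (mul_le_of_le_one_right (by positivity) (hψ1 _)).trans
          (pow_le_pow_left₀ ht0.le ht.2 _)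
      · rw [image_eq_zero_of_notMem_tsupport fun h => hy ((isTest_radialField hb hψ ht.1).subset h),
          norm_zero]
        positivity
    have h1 := abs_integral_divergence_le hV (isTest_radialField hb hψ ht.1)
      (K := 2 ^ d * R) (by positivity) hfield
    have h2 : ∫ y in openPolytope a p, u y * (t⁻¹ * divergence (radialField ψ p t) y) =
        t⁻¹ * ∫ y in openPolytope a p, u y * divergence (radialField ψ p t) y := by
      rw [← integral_const_mul]
      exact integral_congr_ae (ae_of_all _ fun y => by simp only; ring)
    rw [h2, norm_mul, norm_inv, Real.norm_of_nonneg ht0.le, Real.norm_eq_abs]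
    exact (mul_le_of_le_one_left (abs_nonneg _) (inv_le_one_of_one_le₀ ht.1)).trans h1
  have := Convex.norm_image_sub_le_of_norm_hasDerivWithin_le
    (fun t ht => (hder t ht).hasDerivWithinAt) hbound (convex_Icc (1 : ℝ) 2)
    (left_mem_Icc.2 one_le_two) ht
  simpa [Real.norm_eq_abs, abs_of_nonneg (sub_nonneg.2 ht.1)] using this

lemma pow_sub_one_le {t : ℝ} (ht : t ∈ Icc (1 : ℝ) 2) (n : ℕ) :
    t ^ n - 1 ≤ (t - 1) * (n * 2 ^ n) := by
  have h0 : 0 ≤ t := by linarith [ht.1]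
  rw [← geom_sum_mul t n, mul_comm]
  refine mul_le_mul_of_nonneg_left ?_ (by linarith [ht.1])
  calc ∑ i ∈ Finset.range n, t ^ i ≤ ∑ i ∈ Finset.range n, (2 : ℝ) ^ n :=
        Finset.sum_le_sum fun i hi => (pow_le_pow_left₀ h0 ht.2 i).trans
          (pow_le_pow_right₀ one_le_two (Finset.mem_range.1 hi).le)
    _ = n * 2 ^ n := by simp

/-- The `L¹` norm of `u` in a boundary layer of the polytope is at most proportional to the width
of the layer. -/
lemma exists_layer_bound (hb : Bornology.IsBounded (openPolytope a p))
    (hu : IntegrableOn u (openPolytope a p)) (hV0 : 0 ≤ V)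
    (hV : ∀ φ : Euc d → Euc d, IsTest (openPolytope a p) φ → (∀ x, ‖φ x‖ ≤ 1) →
      ∫ x in openPolytope a p, u x * divergence φ x ≤ V) :
    ∃ M : ℝ, 0 ≤ M ∧ ∀ s ∈ Ioc (0 : ℝ) (1 / 2),
      ∫ y in openPolytope a p \ {y | ∀ i, s < 1 + inner ℝ (a i) (y - p)}, |u y| ≤ M * s := by
  obtain ⟨R, hR0, hR⟩ : ∃ R : ℝ, 0 < R ∧ ∀ y ∈ openPolytope a p, ‖y - p‖ ≤ R := by
    obtain ⟨R, hR0, hR⟩ := hb.subset_closedBall_lt 0 p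
    exact ⟨R, hR0, fun y hy => by simpa [dist_eq_norm] using hR hy⟩
  set C := openPolytope a p with hC
  set A := ∫ y in C, |u y| with hA
  have hA0 : 0 ≤ A := integral_nonneg fun _ => abs_nonneg _
  refine ⟨2 * (d * 2 ^ d * A + 2 ^ d * R * V), by positivity, fun s hs => ?_⟩
  have hs1 : (0 : ℝ) < 1 - s := by linarith [hs.2]
  -- the dilation of ratio `t` about `p` maps the inner polytope `D` below onto the polytope
  set t : ℝ := (1 - s)⁻¹ with ht
  have ht0 : 0 < t := inv_pos.2 hs1
  have hts : t * (1 - s) = 1 := inv_mul_cancel₀ hs1.ne'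
  have ht12 : t ∈ Icc (1 : ℝ) 2 :=
    ⟨by rw [ht]; exact (one_le_inv₀ hs1).2 (by linarith [hs.1]), by
      rw [ht, inv_le_comm₀ hs1 two_pos]; linarith [hs.2]⟩
  set D : Set (Euc d) := {y | ∀ i, s < 1 + inner ℝ (a i) (y - p)} with hD
  have hDo : IsOpen D := by
    simp only [hD, ofPred_forall]
    exact isOpen_iInter_of_finite fun i => isOpen_lt continuous_const (by fun_prop)
  have hDC : D ⊆ C := fun y hy i => hs.1.trans (hy i)
  -- the dilated test functions live in the inner polytope `D`
  have hmem : ∀ y, p + t • (y - p) ∈ C → y ∈ D := fun y hy i => by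
    have h := hy i
    rw [add_sub_cancel_left, inner_smul_right] at h
    have : 0 < t * ((1 - s) + inner ℝ (a i) (y - p)) := by rw [mul_add, hts]; exact h
    have := (mul_pos_iff_of_pos_left ht0).1 this
    linarith
  have hua : IntegrableOn (fun y => |u y|) C := hu.abs
  have huD : IntegrableOn (fun y => |u y|) D := hua.mono_set hDC
  have hDA : ∫ y in D, |u y| ≤ A :=
    setIntegral_mono_set hua (ae_of_all _ fun _ => abs_nonneg _) (LE.le.eventuallyLE hDC)
  have main : A ≤ t ^ d * (∫ y in D, |u y|) + 2 ^ d * R * V * (t - 1) := by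
    have h0 : ∫ y in C, ‖u y‖ ∂(volume.restrict C) ≤
        t ^ d * (∫ y in D, |u y|) + 2 ^ d * R * V * (t - 1) := by
      refine setIntegral_norm_le_of_forall_isTest isOpen_openPolytope hu fun ψ hψ hψ1 => ?_
      have h1 := abs_integral_radial_sub_le hb hu hV hR0 hR hψ hψ1 ht12
      have h2 : ∫ y in C, u y * (t ^ d * ψ (p + t • (y - p))) ≤ t ^ d * ∫ y in D, |u y| := by
        rw [← integral_const_mul, ← integral_indicator hDo.measurableSet]
        have hi : IntegrableOn (D.indicator fun y => t ^ d * |u y|) C :=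
          ((hua.const_mul _).indicator hDo.measurableSet)
        have : ∫ y, D.indicator (fun y => t ^ d * |u y|) y =
            ∫ y in C, D.indicator (fun y => t ^ d * |u y|) y := by
          rw [setIntegral_eq_integral_of_forall_compl_eq_zero]
          exact fun y hy => indicator_of_notMem (fun h => hy (hDC h)) _
        rw [this]
        refine (le_abs_self _).trans ?_
        rw [← Real.norm_eq_abs]
        refine (norm_integral_le_integral_norm _).trans (integral_mono_of_nonneg
          (ae_of_all _ fun _ => norm_nonneg _) hi (ae_of_all _ fun y => ?_))
        by_cases hy : y ∈ D
        · simp only [indicator_of_mem hy, norm_mul, norm_pow, Real.norm_of_nonneg ht0.le]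
          rw [mul_comm, mul_assoc]
          refine mul_le_mul_of_nonneg_left ?_ (by positivity)
          exact mul_le_of_le_one_left (norm_nonneg _) (hψ1 _)
        · have : ψ (p + t • (y - p)) = 0 :=
            image_eq_zero_of_notMem_tsupport fun h => hy (hmem y (hψ.subset h))
          simp [indicator_of_notMem hy, this]
      have h3 : ∀ y, inner ℝ (ψ y) (u y) = u y * ψ y := fun y => by simp
      simp only [h3]
      have := (abs_le.1 h1).1
      linarith
    rwa [Measure.restrict_restrict isOpen_openPolytope.measurableSet, inter_self] at h0
  have hdiff : ∫ y in C \ D, |u y| = A - ∫ y in D, |u y| := by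
    rw [hA, ← setIntegral_sdiff hDo.measurableSet hua hDC]
  have hpow := pow_sub_one_le ht12 d
  have htm : t - 1 ≤ 2 * s := by
    have : t - 1 = t * s := by linear_combination hts
    rw [this]
    exact mul_le_mul_of_nonneg_right ht12.2 hs.1.le
  rw [hdiff]
  have hD0 : 0 ≤ ∫ y in D, |u y| := integral_nonneg fun _ => abs_nonneg _
  calc A - ∫ y in D, |u y| ≤ (t ^ d - 1) * (∫ y in D, |u y|) + 2 ^ d * R * V * (t - 1) := by
        linarith
    _ ≤ (t - 1) * (d * 2 ^ d) * A + 2 ^ d * R * V * (t - 1) := by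
        refine add_le_add (mul_le_mul hpow hDA hD0 ?_) le_rfl
        exact mul_nonneg (by linarith [ht12.1]) (by positivity)
    _ = (d * 2 ^ d * A + 2 ^ d * R * V) * (t - 1) := by ring
    _ ≤ (d * 2 ^ d * A + 2 ^ d * R * V) * (2 * s) :=
        mul_le_mul_of_nonneg_left htm (by positivity)
    _ = _ := by ring

/-- A smooth function equal to `1` where all the normalized affine functions exceed `s` and
vanishing where one of them is below `s / 2`. -/
noncomputable def polytopeCutoff (a : ι → Euc d) (p : Euc d) (s : ℝ) (y : Euc d) : ℝ :=
  ∏ i, Real.smoothTransition (2 / s * (1 + inner ℝ (a i) (y - p)) - 1)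

lemma contDiff_polytopeCutoff (s : ℝ) : ContDiff ℝ ∞ (polytopeCutoff a p s) := by
  unfold polytopeCutoff
  refine contDiff_prod fun i _ => Real.smoothTransition.contDiff.comp ?_
  exact (contDiff_const.mul (contDiff_const.add
    (contDiff_const.inner ℝ (contDiff_id.sub contDiff_const)))).sub contDiff_const

lemma polytopeCutoff_mem_Icc (s : ℝ) (y : Euc d) : polytopeCutoff a p s y ∈ Icc (0 : ℝ) 1 :=
  ⟨Finset.prod_nonneg fun _ _ => Real.smoothTransition.nonneg _,
    Finset.prod_le_one (fun _ _ => Real.smoothTransition.nonneg _)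
      fun _ _ => Real.smoothTransition.le_one _⟩

lemma polytopeCutoff_eq_one {s : ℝ} (hs : 0 < s) {y : Euc d}
    (hy : ∀ i, s < 1 + inner ℝ (a i) (y - p)) : polytopeCutoff a p s y = 1 :=
  Finset.prod_eq_one fun i _ => Real.smoothTransition.one_of_one_le (by
    rw [le_sub_iff_add_le, div_mul_eq_mul_div, le_div_iff₀ hs]
    linarith [hy i])

lemma tsupport_polytopeCutoff_subset {s : ℝ} (hs : 0 < s) :
    tsupport (polytopeCutoff a p s) ⊆ openPolytope a p := by
  have hcl : IsClosed {y : Euc d | ∀ i, s / 2 ≤ 1 + inner ℝ (a i) (y - p)} := by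
    simp only [ofPred_forall]
    exact isClosed_iInter fun i => isClosed_le continuous_const (by fun_prop)
  refine (closure_minimal (fun y hy i => ?_) hcl).trans fun y hy i => (half_pos hs).trans_le (hy i)
  by_contra h
  push Not at h
  refine hy (Finset.prod_eq_zero (Finset.mem_univ i) (Real.smoothTransition.zero_of_nonpos ?_))
  rw [sub_nonpos, div_mul_eq_mul_div, div_le_one hs]
  linarith

lemma exists_bound_deriv_smoothTransition :
    ∃ K : ℝ, ∀ x, |deriv Real.smoothTransition x| ≤ K := by
  have hc : Continuous (deriv Real.smoothTransition) :=
    Real.smoothTransition.contDiff.continuous_deriv (n := 1) le_rfl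
  obtain ⟨K, hK⟩ := (isCompact_Icc (a := (0 : ℝ)) (b := 1)).exists_bound_of_continuousOn
    hc.continuousOn
  refine ⟨max K 0, fun x => ?_⟩
  by_cases hx : x ∈ Icc (0 : ℝ) 1
  · exact (hK x hx).trans (le_max_left _ _)
  · have h0 : deriv Real.smoothTransition x = 0 := by
      rw [mem_Icc, not_and_or, not_le, not_le] at hx
      rcases hx with hx | hx
      · have : Real.smoothTransition =ᶠ[𝓝 x] fun _ => 0 := by
          filter_upwards [Iio_mem_nhds hx] with y hy
          exact Real.smoothTransition.zero_of_nonpos (le_of_lt hy)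
        rw [this.deriv_eq, deriv_const]
      · have : Real.smoothTransition =ᶠ[𝓝 x] fun _ => 1 := by
          filter_upwards [Ioi_mem_nhds hx] with y hy
          exact Real.smoothTransition.one_of_one_le (le_of_lt hy)
        rw [this.deriv_eq, deriv_const]
    rw [h0, abs_zero]
    exact le_max_right _ _

lemma exists_bound_fderiv_polytopeCutoff (a : ι → Euc d) (p : Euc d) :
    ∃ K : ℝ, 0 ≤ K ∧ ∀ s, 0 < s → ∀ y v, ‖v‖ ≤ 1 →
      |fderiv ℝ (polytopeCutoff a p s) y v| ≤ K / s := by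
  classical
  obtain ⟨K, hK⟩ := exists_bound_deriv_smoothTransition
  have hK0 : 0 ≤ K := (abs_nonneg _).trans (hK 0)
  refine ⟨∑ i, K * 2 * ‖a i‖, by positivity, fun s hs y v hv => ?_⟩
  have h1 : ∀ i, HasFDerivAt
      (fun y => Real.smoothTransition (2 / s * (1 + inner ℝ (a i) (y - p)) - 1))
      (deriv Real.smoothTransition (2 / s * (1 + inner ℝ (a i) (y - p)) - 1) •
        ((2 / s) • innerSL ℝ (a i))) y := fun i => by
    have h2 : HasFDerivAt (fun y : Euc d => 2 / s * (1 + inner ℝ (a i) (y - p)) - 1)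
        ((2 / s) • innerSL ℝ (a i)) y := by
      have h3 : HasFDerivAt (fun y : Euc d => inner ℝ (a i) (y - p)) (innerSL ℝ (a i)) y := by
        have := (innerSL ℝ (a i)).hasFDerivAt.comp y ((hasFDerivAt_id (𝕜 := ℝ) y).sub_const p)
        simpa using! this
      exact (((h3.const_add 1).const_mul (2 / s)).sub_const 1)
    exact ((Real.smoothTransition.contDiff (n := 1)).differentiable
      one_ne_zero _).hasDerivAt.comp_hasFDerivAt y h2
  have h2 := HasFDerivAt.finsetProd (u := Finset.univ) fun i _ => h1 i
  have h3 : fderiv ℝ (polytopeCutoff a p s) y = _ := h2.fderiv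
  rw [h3, sum_apply, Finset.sum_div]
  refine (Finset.abs_sum_le_sum_abs _ _).trans (Finset.sum_le_sum fun i _ => ?_)
  simp only [smul_apply, innerSL_apply_apply, smul_eq_mul, abs_mul]
  have hp : |∏ j ∈ Finset.univ.erase i,
      Real.smoothTransition (2 / s * (1 + inner ℝ (a j) (y - p)) - 1)| ≤ 1 := by
    rw [abs_of_nonneg (Finset.prod_nonneg fun _ _ => Real.smoothTransition.nonneg _)]
    exact Finset.prod_le_one (fun _ _ => Real.smoothTransition.nonneg _)
      fun _ _ => Real.smoothTransition.le_one _
  have hin : |inner ℝ (a i) v| ≤ ‖a i‖ := (abs_real_inner_le_norm _ _).trans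
    (mul_le_of_le_one_right (norm_nonneg _) hv)
  calc _ ≤ 1 * (K * (|2 / s| * ‖a i‖)) := by
        gcongr
        exact hK _
    _ = K * 2 * ‖a i‖ / s := by rw [abs_of_pos (by positivity)]; ring

/-- On a bounded open polytope, a bound for `∫ u div φ` over test fields with compact support in
the polytope yields a bound over all test fields: the contribution of the boundary is controlled
by the mass of `|u|` in thin boundary layers. -/
lemma exists_bound_of_polytope (hb : Bornology.IsBounded (openPolytope a p))
    (hu : IntegrableOn u (openPolytope a p)) (hV0 : 0 ≤ V)
    (hV : ∀ φ : Euc d → Euc d, IsTest (openPolytope a p) φ → (∀ x, ‖φ x‖ ≤ 1) →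
      ∫ x in openPolytope a p, u x * divergence φ x ≤ V) :
    ∃ M : ℝ, ∀ φ : Euc d → Euc d, IsTest univ φ → (∀ x, ‖φ x‖ ≤ 1) →
      ∫ x in openPolytope a p, u x * divergence φ x ≤ M := by
  obtain ⟨M, hM0, hM⟩ := exists_layer_bound hb hu hV0 hV
  obtain ⟨K, hK0, hK⟩ := exists_bound_fderiv_polytopeCutoff a p
  refine ⟨V + K * M, fun φ hφ hφ1 => ?_⟩
  set C := openPolytope a p with hC
  have hCm : MeasurableSet C := isOpen_openPolytope.measurableSet
  have hdc := continuous_divergence hφ.contDiff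
  have hdi := IntegrableOn.mul_continuous hu hdc (hasCompactSupport_divergence hφ.compact)
  have key : ∀ s ∈ Ioc (0 : ℝ) (1 / 2),
      ∫ x in C, u x * (polytopeCutoff a p s x * divergence φ x) ≤ V + K * M := by
    intro s hs
    have hχ := contDiff_polytopeCutoff (a := a) (p := p) s
    have hsub : tsupport (fun x => polytopeCutoff a p s x • φ x) ⊆ C :=
      (tsupport_smul_subset_left _ _).trans (tsupport_polytopeCutoff_subset hs.1)
    have ht : IsTest C fun x => polytopeCutoff a p s x • φ x := ⟨hχ.smul hφ.contDiff,
      Metric.isCompact_of_isClosed_isBounded (isClosed_tsupport _) (hb.subset hsub), hsub⟩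
    have h1 := hV _ ht fun x => by
      rw [norm_smul, Real.norm_of_nonneg (polytopeCutoff_mem_Icc s x).1]
      exact mul_le_one₀ (polytopeCutoff_mem_Icc s x).2 (norm_nonneg _) (hφ1 x)
    have hd : ∀ x, divergence (fun x => polytopeCutoff a p s x • φ x) x =
        polytopeCutoff a p s x * divergence φ x + fderiv ℝ (polytopeCutoff a p s) x (φ x) :=
      fun x => divergence_smul (hχ.differentiable (by simp) x)
        (hφ.contDiff.differentiable (by simp) x)
    set D : Set (Euc d) := {y | ∀ i, s < 1 + inner ℝ (a i) (y - p)} with hD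
    have hDo : IsOpen D := by
      simp only [hD, ofPred_forall]
      exact isOpen_iInter_of_finite fun i => isOpen_lt continuous_const (by fun_prop)
    have hf0 : ∀ x ∈ D, fderiv ℝ (polytopeCutoff a p s) x = 0 := fun x hx => by
      have : polytopeCutoff a p s =ᶠ[𝓝 x] fun _ => 1 := by
        filter_upwards [hDo.mem_nhds hx] with y hy using polytopeCutoff_eq_one hs.1 hy
      rw [this.fderiv_eq, fderiv_fun_const]; rfl
    have hfm : Continuous fun x => fderiv ℝ (polytopeCutoff a p s) x (φ x) :=
      (hχ.continuous_fderiv (by simp)).clm_apply hφ.continuous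
    have hi2 : IntegrableOn (fun x => u x * fderiv ℝ (polytopeCutoff a p s) x (φ x)) C :=
      hu.mul_bdd hfm.aestronglyMeasurable (ae_of_all _ fun x => hK s hs.1 x _ (hφ1 x))
    have hi1 : IntegrableOn (fun x => u x * (polytopeCutoff a p s x * divergence φ x)) C := by
      have : (fun x => u x * (polytopeCutoff a p s x * divergence φ x)) =
          fun x => (u x * divergence φ x) * polytopeCutoff a p s x := by ext x; ring
      rw [this]
      exact hdi.mul_bdd hχ.continuous.aestronglyMeasurable (ae_of_all _ fun x => by
        rw [Real.norm_of_nonneg (polytopeCutoff_mem_Icc s x).1]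
        exact (polytopeCutoff_mem_Icc s x).2)
    have h2 : -∫ x in C, u x * fderiv ℝ (polytopeCutoff a p s) x (φ x) ≤ K * M := by
      refine (neg_le_abs _).trans ?_
      have e : ∫ x in C, u x * fderiv ℝ (polytopeCutoff a p s) x (φ x) =
          ∫ x in C \ D, u x * fderiv ℝ (polytopeCutoff a p s) x (φ x) := by
        apply setIntegral_eq_of_subset_of_forall_sdiff_eq_zero hCm sdiff_subset
        intro x hx
        have : x ∈ D := by_contra fun h => hx.2 ⟨hx.1, h⟩
        rw [hf0 x this]
        simp
      have hua : IntegrableOn (fun x => |u x|) C := hu.abs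
      rw [e, ← Real.norm_eq_abs]
      calc ‖∫ x in C \ D, u x * fderiv ℝ (polytopeCutoff a p s) x (φ x)‖
          ≤ ∫ x in C \ D, ‖u x * fderiv ℝ (polytopeCutoff a p s) x (φ x)‖ :=
            norm_integral_le_integral_norm _
        _ ≤ ∫ x in C \ D, |u x| * (K / s) := by
            refine integral_mono_of_nonneg (ae_of_all _ fun _ => norm_nonneg _)
              ((hua.mono_set sdiff_subset).mul_const _) (ae_of_all _ fun x => ?_)
            simp only [norm_mul]
            exact mul_le_mul_of_nonneg_left (hK s hs.1 x _ (hφ1 x)) (norm_nonneg _)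
        _ = (∫ x in C \ D, |u x|) * (K / s) := integral_mul_const _ _
        _ ≤ M * s * (K / s) :=
            mul_le_mul_of_nonneg_right (hM s hs) (div_nonneg hK0 hs.1.le)
        _ = K * M := by
            have := hs.1.ne'
            field_simp
    have h3 : ∫ x in C, u x * divergence (fun x => polytopeCutoff a p s x • φ x) x =
        (∫ x in C, u x * (polytopeCutoff a p s x * divergence φ x)) +
          ∫ x in C, u x * fderiv ℝ (polytopeCutoff a p s) x (φ x) := by
      rw [← integral_add hi1 hi2]
      exact integral_congr_ae (ae_of_all _ fun x => by simp only [hd]; ring)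
    linarith
  -- let the width of the boundary layer tend to zero
  let s : ℕ → ℝ := fun n => 1 / ((n : ℝ) + 1) / 2
  have hs : ∀ n, s n ∈ Ioc (0 : ℝ) (1 / 2) := fun n => by
    have h1 : 1 / ((n : ℝ) + 1) ≤ 1 :=
      (div_le_one (by positivity)).2 (by linarith [n.cast_nonneg (α := ℝ)])
    exact ⟨by positivity, by simp only [s]; linarith⟩
  have hs0 : Tendsto s atTop (𝓝 0) := by
    have := (tendsto_one_div_add_atTop_nhds_zero_nat (𝕜 := ℝ)).div_const 2
    rwa [zero_div] at this
  have hlim : Tendsto (fun n => ∫ x in C, u x * (polytopeCutoff a p (s n) x * divergence φ x)) atTop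
      (𝓝 (∫ x in C, u x * divergence φ x)) := by
    refine tendsto_integral_of_dominated_convergence (fun x => ‖u x * divergence φ x‖)
      (fun n => hu.1.mul ((contDiff_polytopeCutoff (s n)).continuous.mul hdc).aestronglyMeasurable)
      hdi.norm (fun n => ae_of_all _ fun x => ?_) ?_
    · have := polytopeCutoff_mem_Icc (a := a) (p := p) (s n) x
      rw [norm_mul, norm_mul, norm_mul, Real.norm_of_nonneg this.1]
      exact mul_le_mul_of_nonneg_left (mul_le_of_le_one_left (norm_nonneg _) this.2) (norm_nonneg _)
    · filter_upwards [ae_restrict_mem hCm] with x hx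
      refine tendsto_const_nhds.congr' ?_
      have : ∀ᶠ n in atTop, ∀ i, s n < 1 + inner ℝ (a i) (x - p) :=
        eventually_all.2 fun i => hs0.eventually_lt_const (hx i)
      filter_upwards [this] with n hn
      rw [polytopeCutoff_eq_one (hs n).1 hn, one_mul]
  exact le_of_tendsto' hlim fun n => key _ (hs n)

end Polytope

end TVFlow

/-! ### The gradient on hyperplanes, and Fubini's theorem in a layer -/

namespace TVFlow

/-- Hyperplanes are Lebesgue null sets. -/
lemma volume_hyperplane {E : Type*} [NormedAddCommGroup E] [InnerProductSpace ℝ E]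
    [FiniteDimensional ℝ E] [MeasurableSpace E] [BorelSpace E] {v : E} (hv : v ≠ 0) (c : ℝ) :
    volume {x : E | inner ℝ v x = c} = 0 := by
  have hv2 : inner ℝ v v ≠ (0 : ℝ) := inner_self_ne_zero.2 hv
  set s := AffineSubspace.mk' ((c / inner ℝ v v) • v) (ℝ ∙ v)ᗮ with hs
  have hmem : ∀ x, x ∈ s ↔ inner ℝ v x = c := fun x => by
    rw [hs, AffineSubspace.mem_mk', Submodule.mem_orthogonal_singleton_iff_inner_right,
      vsub_eq_sub, inner_sub_right, inner_smul_right, div_mul_cancel₀ _ hv2, sub_eq_zero]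
  have : {x : E | inner ℝ v x = c} = s := by ext x; exact (hmem x).symm
  rw [this]
  refine Measure.addHaar_affineSubspace _ _ fun h => ?_
  have h1 := (hmem 0).1 (h ▸ AffineSubspace.mem_top ℝ E 0)
  have h2 := (hmem v).1 (h ▸ AffineSubspace.mem_top ℝ E v)
  rw [inner_zero_right] at h1
  exact hv2 (h2.trans h1.symm)

section Invariant

variable {d : ℕ} {O : Set (Euc d)} {u : Euc d → ℝ} {ν : Measure (Euc d)} {h : Euc d → Euc d}

/-- The component in the direction `e` of the gradient does not charge Lebesgue null sets that
are invariant under translation by multiples of `e`: the indicator function of such a set can be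
approximated by smooth functions that are constant in the direction `e`. -/
lemma HasExtGradient.ae_inner_eq_zero (H : HasExtGradient O u ν h)
    (hu : IntegrableOn u O) {N : Set (Euc d)} (hN : MeasurableSet N) (hN0 : volume N = 0)
    {e : Euc d} (hNe : ∀ x (t : ℝ), x + t • e ∈ N ↔ x ∈ N) :
    ∀ᵐ x ∂ν, x ∈ N → inner ℝ e (h x) = 0 := by
  rcases eq_or_ne e 0 with rfl | he
  · exact ae_of_all _ fun x _ => inner_zero_left _
  have := H.finite
  have hei : Integrable (fun x => inner ℝ e (h x)) ν := H.integrable.const_inner e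
  -- the orthogonal projection along `e`
  let P : Euc d → Euc d := fun x => x - (inner ℝ e x / inner ℝ e e) • e
  have hPc : ContDiff ℝ ∞ P :=
    contDiff_id.sub ((((contDiff_const.inner ℝ contDiff_id)).div_const _).smul contDiff_const)
  have hPm : Measurable P := hPc.continuous.measurable
  have hPe : ∀ x (t : ℝ), P (x + t • e) = P x := fun x t => by
    have : inner ℝ e e ≠ (0 : ℝ) := inner_self_ne_zero.2 he
    simp only [P, inner_add_right, inner_smul_right, add_div, add_smul,
      mul_div_cancel_right₀ t this]
    abel
  have hPN : ∀ x, P x ∈ N ↔ x ∈ N := fun x => by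
    simp only [P, sub_eq_add_neg, ← neg_smul, hNe]
  set κ₁ : Measure (Euc d) := ν.withDensity fun x => ‖inner ℝ e (h x)‖ₑ with hκ₁
  set κ₂ : Measure (Euc d) := (volume.restrict O).withDensity fun x => ‖u x‖ₑ with hκ₂
  have : IsFiniteMeasure κ₁ := isFiniteMeasure_withDensity hei.2.ne
  have : IsFiniteMeasure κ₂ := isFiniteMeasure_withDensity hu.2.ne
  set f : Euc d → ℝ := N.indicator fun _ => 1 with hf
  have hfm : Measurable f := measurable_const.indicator hN
  have hf1 : ∀ x, ‖f x‖ ≤ 1 := fun x => by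
    by_cases hx : x ∈ N <;> simp [hf, hx]
  have hfP : ∀ x, f (P x) = f x := fun x => by
    by_cases hx : x ∈ N <;> simp [hf, hx, hPN]
  have hfi : Integrable (fun x => f x * inner ℝ e (h x)) ν :=
    hei.bdd_mul hfm.aestronglyMeasurable (ae_of_all _ hf1)
  have key : ∀ ψ : Euc d → ℝ, IsTest univ ψ → ∫ x, ψ x * (f x * inner ℝ e (h x)) ∂ν = 0 := by
    intro ψ hψ
    have hψd := hψ.fderiv_apply e
    obtain ⟨C₁, hC₁⟩ := hψ.compact.exists_bound_of_continuous hψ.continuous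
    obtain ⟨C₂, hC₂⟩ := hψd.compact.exists_bound_of_continuous hψd.continuous
    have hC₁0 : 0 ≤ C₁ := (norm_nonneg _).trans (hC₁ 0)
    have hC₂0 : 0 ≤ C₂ := (norm_nonneg _).trans (hC₂ 0)
    have main : ∀ ε > 0, |∫ x, ψ x * (f x * inner ℝ e (h x)) ∂ν| ≤ (C₁ + C₂) * ε := by
      intro ε hε
      obtain ⟨φ, hφ, hφ1, hφε⟩ := exists_isTest_approx ((κ₁ + κ₂).map P) isOpen_univ
        hfm.aestronglyMeasurable hf1 (fun x hx => absurd (mem_univ x) hx) hε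
      have hφm := hφ.continuous.measurable
      -- a smooth function, constant in the direction `e`, close to the indicator function of `N`
      set χ : Euc d → ℝ := fun x => φ (P x) with hχ
      have hχc : ContDiff ℝ ∞ χ := hφ.contDiff.comp hPc
      have hχm : Measurable χ := hφm.comp hPm
      have hχ1 : ∀ x, ‖χ x‖ ≤ 1 := fun x => hφ1 _
      have hfχ : ∀ x, ‖f x - χ x‖ ≤ 2 := fun x =>
        (norm_sub_le _ _).trans (by linarith [hf1 x, hχ1 x])
      have hfχm : Measurable fun x => f x - χ x := hfm.sub hχm
      have hfφ : Measurable fun x => ‖f x - φ x‖ := (hfm.sub hφm).norm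
      rw [integral_map hPm.aemeasurable hfφ.aestronglyMeasurable] at hφε
      simp only [hfP] at hφε
      have hin : ∀ κ : Measure (Euc d), IsFiniteMeasure κ →
          Integrable (fun x => ‖f x - φ (P x)‖) κ :=
        fun κ _ => (Integrable.of_bound hfχm.aestronglyMeasurable 2 (ae_of_all _ hfχ)).norm
      rw [integral_add_measure (hin _ inferInstance) (hin _ inferInstance)] at hφε
      have i1 : ∫ x, ‖f x - χ x‖ ∂κ₁ = ∫ x, ‖inner ℝ e (h x)‖ * ‖f x - χ x‖ ∂ν := by
        rw [hκ₁, integral_withDensity_eq_integral_toReal_smul₀ hei.1.enorm (by simp)]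
        simp only [toReal_enorm, smul_eq_mul]
      have i2 : ∫ x, ‖f x - χ x‖ ∂κ₂ = ∫ x in O, ‖u x‖ * ‖f x - χ x‖ := by
        rw [hκ₂, integral_withDensity_eq_integral_toReal_smul₀ hu.1.enorm (by simp)]
        simp only [toReal_enorm, smul_eq_mul]
      have hn1 : 0 ≤ ∫ x, ‖f x - χ x‖ ∂κ₁ := integral_nonneg fun _ => norm_nonneg _
      have hn2 : 0 ≤ ∫ x, ‖f x - χ x‖ ∂κ₂ := integral_nonneg fun _ => norm_nonneg _
      have ht : IsTest univ fun x => χ x * ψ x :=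
        ⟨hχc.mul hψ.contDiff, hψ.compact.mul_left, subset_univ _⟩
      have hχd : ∀ x, fderiv ℝ χ x e = 0 := fun x => by
        have h1 := (hχc.differentiable (by simp) (x + (0 : ℝ) • e)).hasFDerivAt
        have h2 : HasDerivAt (fun s : ℝ => x + s • e) e 0 := by
          simpa using ((hasDerivAt_id (0 : ℝ)).smul_const e).const_add x
        have h3 := h1.comp_hasDerivAt (0 : ℝ) h2
        have h4 : χ ∘ (fun s : ℝ => x + s • e) = fun _ => χ x := by
          ext s; simp [hχ, hPe]
        rw [h4] at h3
        simpa using h3.unique (hasDerivAt_const _ _)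
      have hd : ∀ x, fderiv ℝ (fun x => χ x * ψ x) x e = χ x * fderiv ℝ ψ x e := fun x => by
        rw [fderiv_fun_mul (hχc.differentiable (by simp) x)
          (hψ.contDiff.differentiable (by simp) x)]
        simp [hχd]
      have heq := H.integral_eq _ ht e
      simp only [hd] at heq
      have hψi := integrable_mul_inner H.integrable hψ.continuous hψ.compact e
      have j1 : Integrable (fun x => χ x * ψ x * inner ℝ e (h x)) ν :=
        integrable_mul_inner H.integrable ht.continuous ht.compact e
      have j2 : Integrable (fun x => ψ x * (f x * inner ℝ e (h x))) ν :=
        hfi.bdd_mul hψ.continuous.aestronglyMeasurable (ae_of_all _ hC₁)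
      have huχ : ∫ x in O, u x * (χ x * fderiv ℝ ψ x e) =
          ∫ x in O, u x * ((χ x - f x) * fderiv ℝ ψ x e) := by
        refine integral_congr_ae (ae_restrict_of_ae ?_)
        filter_upwards [compl_mem_ae_iff.2 hN0] with x hx
        simp [hf, indicator_of_notMem hx]
      have e1 : ∫ x, ψ x * (f x * inner ℝ e (h x)) ∂ν =
          ∫ x, ψ x * (f x - χ x) * inner ℝ e (h x) ∂ν
            - ∫ x in O, u x * ((χ x - f x) * fderiv ℝ ψ x e) := by
        rw [← huχ, heq, sub_neg_eq_add, ← integral_add _ j1]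
        · exact integral_congr_ae (ae_of_all _ fun x => by simp only; ring)
        · exact (j2.sub j1).congr (ae_of_all _ fun x => by simp only [Pi.sub_apply]; ring)
      have b1 : |∫ x, ψ x * (f x - χ x) * inner ℝ e (h x) ∂ν| ≤ C₁ * ∫ x, ‖f x - χ x‖ ∂κ₁ := by
        rw [i1, ← integral_const_mul, ← Real.norm_eq_abs]
        refine norm_integral_le_of_norm_le ((hei.norm.mul_bdd hfχm.norm.aestronglyMeasurable
          (c := 2) (ae_of_all _ fun x => by simpa using hfχ x)).const_mul C₁)
          (ae_of_all _ fun x => ?_)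
        rw [norm_mul, norm_mul, mul_assoc, mul_comm ‖f x - χ x‖]
        exact mul_le_mul_of_nonneg_right (hC₁ x) (by positivity)
      have b2 : |∫ x in O, u x * ((χ x - f x) * fderiv ℝ ψ x e)| ≤ C₂ * ∫ x, ‖f x - χ x‖ ∂κ₂ := by
        rw [i2, ← integral_const_mul, ← Real.norm_eq_abs]
        refine norm_integral_le_of_norm_le ((hu.norm.mul_bdd hfχm.norm.aestronglyMeasurable
          (c := 2) (ae_of_all _ fun x => by simpa using hfχ x)).const_mul C₂)
          (ae_of_all _ fun x => ?_)
        rw [norm_mul, norm_mul, norm_sub_rev, ← mul_assoc, mul_comm C₂]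
        exact mul_le_mul_of_nonneg_left (hC₂ x) (by positivity)
      rw [e1]
      refine (abs_sub _ _).trans ((add_le_add b1 b2).trans ?_)
      nlinarith
    have hz : |∫ x, ψ x * (f x * inner ℝ e (h x)) ∂ν| ≤ 0 := by
      refine le_of_forall_pos_le_add fun ε hε => ?_
      refine (main (ε / (C₁ + C₂ + 1)) (by positivity)).trans ?_
      rw [zero_add, mul_div_assoc', div_le_iff₀ (by positivity)]
      nlinarith
    exact abs_nonpos_iff.1 hz
  filter_upwards [ae_eq_zero_of_forall_isTest isOpen_univ hfi fun φ hφ => by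
    simpa [mul_comm] using! key φ hφ] with x hx hxN
  simpa [hf, hxN] using hx (mem_univ x)

variable {n n' : Euc d} {c c' : ℝ}

/-- On a hyperplane, the gradient is normal to the hyperplane. -/
lemma HasExtGradient.ae_eq_inner_smul (H : HasExtGradient O u ν h) (hu : IntegrableOn u O)
    (hn : ‖n‖ = 1) (c : ℝ) :
    ∀ᵐ x ∂ν, inner ℝ n x = c → h x = inner ℝ n (h x) • n := by
  have hn0 : n ≠ 0 := norm_ne_zero_iff.1 (by simp [hn])
  have hmeas : MeasurableSet {x : Euc d | inner ℝ n x = c} :=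
    (isClosed_eq (by fun_prop) continuous_const).measurableSet
  have h1 : ∀ᵐ x ∂ν, ∀ i : Fin d, inner ℝ n x = c →
      inner ℝ (EuclideanSpace.single i (1 : ℝ) - n i • n) (h x) = 0 := by
    rw [ae_all_iff]
    intro i
    refine H.ae_inner_eq_zero hu hmeas (volume_hyperplane hn0 c) fun x t => ?_
    have : inner ℝ n (EuclideanSpace.single i (1 : ℝ) - n i • n) = 0 := by
      rw [inner_sub_right, inner_smul_right, real_inner_self_eq_norm_sq, hn,
        EuclideanSpace.inner_single_right]
      simp
    simp only [mem_ofPred_eq, inner_add_right, inner_smul_right, this, mul_zero, add_zero]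
  filter_upwards [h1] with x hx hxc
  ext i
  have := hx i hxc
  rw [inner_sub_left, inner_smul_left, EuclideanSpace.inner_single_left] at this
  simp only [map_one, one_mul, conj_trivial, sub_eq_zero] at this
  simp [this, mul_comm]

/-- The gradient does not charge the intersection of two transversal hyperplanes. -/
lemma HasExtGradient.ae_eq_zero_of_inter (H : HasExtGradient O u ν h)
    (hu : IntegrableOn u O) (hn : ‖n‖ = 1) (hn' : ‖n'‖ = 1) (h1 : n ≠ n') (h2 : n ≠ -n')
    (c c' : ℝ) :
    ∀ᵐ x ∂ν, inner ℝ n x = c → inner ℝ n' x = c' → h x = 0 := by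
  filter_upwards [H.ae_eq_inner_smul hu hn c, H.ae_eq_inner_smul hu hn' c'] with x hx hx' hc hc'
  have e : inner ℝ n (h x) • n = inner ℝ n' (h x) • n' := (hx hc).symm.trans (hx' hc')
  have e' : |inner ℝ n (h x)| = |inner ℝ n' (h x)| := by
    simpa [norm_smul, hn, hn'] using congrArg norm e
  by_contra h0
  have hne : inner ℝ n (h x) ≠ (0 : ℝ) := fun h3 => h0 (by rw [hx hc, h3, zero_smul])
  rcases abs_eq_abs.1 e' with h3 | h3
  · rw [← h3] at e
    exact h1 (smul_right_injective _ hne e)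
  · rw [← neg_eq_iff_eq_neg.2 h3, neg_smul, ← smul_neg] at e
    exact h2 (smul_right_injective _ hne e)

end Invariant

section Slab

open Module

variable {d : ℕ} {n : Euc d} {c : ℝ}

/-- The `(d-1)`-dimensional surface measure on the hyperplane `⟪n, x⟫ = c`. -/
noncomputable def faceMeasure (n : Euc d) (c : ℝ) : Measure (Euc d) :=
  (Measure.euclideanHausdorffMeasure (d - 1)).restrict {x | inner ℝ n x = c}

/-- The isometric parametrization of the hyperplane `⟪n, x⟫ = c` by the orthogonal complement of
the unit vector `n`. -/
noncomputable def faceMap (n : Euc d) (c : ℝ) (w : (ℝ ∙ n)ᗮ) : Euc d := w + c • n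

/-- The orthogonal projection onto the hyperplane `⟪n, x⟫ = c`, for a unit vector `n`. -/
noncomputable def faceProj (n : Euc d) (c : ℝ) (y : Euc d) : Euc d := y - (inner ℝ n y - c) • n

lemma inner_orthogonal (w : (ℝ ∙ n)ᗮ) : inner ℝ n (w : Euc d) = 0 :=
  Submodule.mem_orthogonal_singleton_iff_inner_right.1 w.2

lemma inner_faceMap (hn : ‖n‖ = 1) (w : (ℝ ∙ n)ᗮ) : inner ℝ n (faceMap n c w) = c := by
  rw [faceMap, inner_add_right, inner_orthogonal, inner_smul_right, real_inner_self_eq_norm_sq, hn]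
  simp

lemma isometry_faceMap (n : Euc d) (c : ℝ) : Isometry (faceMap n c) :=
  Isometry.of_dist_eq fun w w' => by simp [faceMap, Subtype.dist_eq]

lemma range_faceMap (hn : ‖n‖ = 1) : range (faceMap n c) = {x | inner ℝ n x = c} := by
  ext x
  refine ⟨?_, fun hx => ⟨⟨x - c • n, ?_⟩, by simp [faceMap]⟩⟩
  · rintro ⟨w, rfl⟩
    exact inner_faceMap hn w
  · rw [Submodule.mem_orthogonal_singleton_iff_inner_right, inner_sub_right, inner_smul_right,
      real_inner_self_eq_norm_sq, hn, hx]
    simp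

lemma finrank_orthogonal_unit (hn : ‖n‖ = 1) : finrank ℝ (ℝ ∙ n)ᗮ = d - 1 := by
  have hn0 : n ≠ 0 := norm_ne_zero_iff.1 (by simp [hn])
  have h1 := (ℝ ∙ n).finrank_add_finrank_orthogonal
  rw [finrank_span_singleton hn0, finrank_euclideanSpace_fin] at h1
  omega

lemma faceMeasure_eq_map (hn : ‖n‖ = 1) : faceMeasure n c = volume.map (faceMap n c) := by
  rw [faceMeasure, ← range_faceMap hn, ← (isometry_faceMap n c).map_euclideanHausdorffMeasure,
    ← finrank_orthogonal_unit hn, InnerProductSpace.euclideanHausdorffMeasure_eq_volume]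

lemma measurable_faceMap : Measurable (faceMap n c) :=
  (isometry_faceMap n c).continuous.measurable

lemma continuous_faceProj : Continuous (faceProj n c) := by
  unfold faceProj; fun_prop

/-- The decomposition of Euclidean space into hyperplanes orthogonal to the unit vector `n`, with
the height measured from the hyperplane `⟪n, x⟫ = c`. -/
noncomputable def slabEquiv (n : Euc d) (hn : ‖n‖ = 1) (c : ℝ) : ℝ × (ℝ ∙ n)ᗮ ≃ᵐ Euc d :=
  ((LinearIsometryEquiv.toSpanUnitSingleton n hn).toHomeomorph.toMeasurableEquiv.prodCongr
    (MeasurableEquiv.refl _)).trans ((ℝ ∙ n).measurableEquivProd (c • n)).symm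

lemma slabEquiv_apply (hn : ‖n‖ = 1) (q : ℝ × (ℝ ∙ n)ᗮ) :
    slabEquiv n hn c q = faceMap n c q.2 + q.1 • n := by
  simp only [slabEquiv, MeasurableEquiv.trans_apply, Submodule.measurableEquivProd_symm_apply,
    faceMap, vadd_eq_add]
  have : (((LinearIsometryEquiv.toSpanUnitSingleton (𝕜 := ℝ) n
      hn).toHomeomorph.toMeasurableEquiv.prodCongr (MeasurableEquiv.refl (ℝ ∙ n)ᗮ)) q) =
      (⟨q.1 • n, by simp [Submodule.mem_span_singleton]⟩, q.2) := rfl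
  rw [this]
  simp only
  abel

lemma faceProj_slabEquiv (hn : ‖n‖ = 1) (q : ℝ × (ℝ ∙ n)ᗮ) :
    faceProj n c (slabEquiv n hn c q) = faceMap n c q.2 := by
  rw [slabEquiv_apply, faceProj, inner_add_right, inner_faceMap hn, inner_smul_right,
    real_inner_self_eq_norm_sq, hn]
  simp

lemma inner_slabEquiv (hn : ‖n‖ = 1) (q : ℝ × (ℝ ∙ n)ᗮ) :
    inner ℝ n (slabEquiv n hn c q) = c + q.1 := by
  rw [slabEquiv_apply, inner_add_right, inner_faceMap hn, inner_smul_right,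
    real_inner_self_eq_norm_sq, hn]
  simp

lemma measurePreserving_slabEquiv (hn : ‖n‖ = 1) :
    MeasurePreserving (slabEquiv n hn c) volume volume := by
  have h1 := ((ℝ ∙ n).measurePreserving_measurableEquivProd (c • n)).symm
  have h2 : (Measure.euclideanHausdorffMeasure (finrank ℝ (Euc d)) : Measure (Euc d)) = volume :=
    InnerProductSpace.euclideanHausdorffMeasure_eq_volume
  rw [h2] at h1
  exact h1.comp ((LinearIsometryEquiv.toSpanUnitSingleton (𝕜 := ℝ) n hn).measurePreserving.prod
    (MeasurePreserving.id volume))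

/-- The cylinder over a null set of a hyperplane is a Lebesgue null set. -/
lemma volume_preimage_faceProj (hn : ‖n‖ = 1) {E : Set (Euc d)} (hE : MeasurableSet E)
    (hE0 : faceMeasure n c E = 0) : volume (faceProj n c ⁻¹' E) = 0 := by
  rw [← (measurePreserving_slabEquiv hn (c := c)).measure_preimage_equiv]
  have : slabEquiv n hn c ⁻¹' (faceProj n c ⁻¹' E) = univ ×ˢ (faceMap n c ⁻¹' E) := by
    ext q
    simp [faceProj_slabEquiv]
  rw [faceMeasure_eq_map hn, Measure.map_apply measurable_faceMap hE] at hE0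
  rw [this, Measure.volume_eq_prod, Measure.prod_prod, hE0, mul_zero]

/-- The intersection with a transversal hyperplane is a null set for the surface measure. -/
lemma faceMeasure_hyperplane (hn : ‖n‖ = 1) {n' : Euc d} (hn' : ‖n'‖ = 1) (h1 : n' ≠ n)
    (h2 : n' ≠ -n) (c' : ℝ) : faceMeasure n c {x | inner ℝ n' x = c'} = 0 := by
  have hcl : MeasurableSet {x : Euc d | inner ℝ n' x = c'} :=
    (isClosed_eq (by fun_prop) continuous_const).measurableSet
  rw [faceMeasure_eq_map hn, Measure.map_apply measurable_faceMap hcl]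
  have hv0 : inner ℝ n (n' - inner ℝ n n' • n) = (0 : ℝ) := by
    rw [inner_sub_right, inner_smul_right, real_inner_self_eq_norm_sq, hn]; simp
  -- inside the hyperplane, the other hyperplane is cut out by the projection `v` of its normal
  set v : (ℝ ∙ n)ᗮ := ⟨n' - inner ℝ n n' • n,
    Submodule.mem_orthogonal_singleton_iff_inner_right.2 hv0⟩ with hv
  have hvn : v ≠ 0 := fun h0 => by
    have h3 : n' = inner ℝ n n' • n := sub_eq_zero.1 (congrArg Subtype.val h0)
    have h4 : |inner ℝ n n'| = 1 := by
      have := congrArg norm h3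
      rw [norm_smul, hn, hn', mul_one] at this
      exact this.symm
    rcases (abs_eq zero_le_one).1 h4 with h5 | h5
    · exact h1 (by rw [h3, h5, one_smul])
    · exact h2 (by rw [h3, h5, neg_one_smul])
  have : faceMap n c ⁻¹' {x | inner ℝ n' x = c'} =
      {w | inner ℝ v w = c' - c * inner ℝ n' n} := by
    ext w
    simp only [mem_preimage, mem_ofPred_eq, faceMap, inner_add_right, inner_smul_right,
      Submodule.coe_inner, hv, inner_sub_left, inner_smul_left, inner_orthogonal, mul_zero,
      sub_zero]
    rw [eq_sub_iff_add_eq]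
  rw [this]
  exact volume_hyperplane hvn _

/-- Fubini's theorem in the layer of height `r` above a hyperplane, for the product of a bounded
function and a function that is constant in the normal direction. -/
lemma integral_mul_comp_faceProj (hn : ‖n‖ = 1) {r C : ℝ} (hr : 0 ≤ r) {k g : Euc d → ℝ}
    (hk : Measurable k) (hkC : ∀ y, ‖k y‖ ≤ C) (hg : Integrable g (faceMeasure n c))
    (hgm : Measurable g)
    (hks : ∀ y, k y ≠ 0 → inner ℝ n y - c ∈ Ioc 0 r) :
    Integrable (fun y => k y * g (faceProj n c y)) ∧
    IntervalIntegrable (fun t => ∫ y, k (y + t • n) * g y ∂faceMeasure n c) volume 0 r ∧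
    ∫ y, k y * g (faceProj n c y) =
      ∫ t in (0 : ℝ)..r, ∫ y, k (y + t • n) * g y ∂faceMeasure n c := by
  have hm := measurePreserving_slabEquiv hn (c := c)
  rw [faceMeasure_eq_map hn] at hg ⊢
  have hg' : Integrable (fun w => g (faceMap n c w)) volume :=
    (integrable_map_measure hgm.aestronglyMeasurable measurable_faceMap.aemeasurable).1 hg
  set F : ℝ × (ℝ ∙ n)ᗮ → ℝ := fun q => k (slabEquiv n hn c q) * g (faceMap n c q.2) with hF
  have hFm : Measurable F := (hk.comp (slabEquiv n hn c).measurable).mul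
    (hgm.comp (measurable_faceMap.comp measurable_snd))
  have hFi : Integrable F (volume.prod volume) := by
    have h1 : Integrable ((Ioc 0 r).indicator fun _ : ℝ => C) volume :=
      (integrableOn_const (by simp)).integrable_indicator measurableSet_Ioc
    refine (h1.mul_prod hg'.norm).mono' hFm.aestronglyMeasurable (ae_of_all _ fun q => ?_)
    rw [hF, norm_mul]
    refine mul_le_mul_of_nonneg_right ?_ (norm_nonneg _)
    by_cases hq : q.1 ∈ Ioc 0 r
    · rw [indicator_of_mem hq]; exact hkC _
    · rw [indicator_of_notMem hq, norm_le_zero_iff]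
      by_contra h0
      have := hks _ h0
      rw [inner_slabEquiv, add_sub_cancel_left] at this
      exact hq this
  have hF0 : ∀ t ∉ Ioc 0 r, ∫ w, F (t, w) = 0 := fun t ht => by
    refine integral_eq_zero_of_ae (ae_of_all _ fun w => ?_)
    have : k (slabEquiv n hn c (t, w)) = 0 := by
      by_contra h0
      have := hks _ h0
      rw [inner_slabEquiv, add_sub_cancel_left] at this
      exact ht this
    simp [hF, this]
  have hmap : ∀ t : ℝ, ∫ y, k (y + t • n) * g y ∂(volume.map (faceMap n c)) = ∫ w, F (t, w) :=
    fun t => by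
      have h1 : Measurable fun y => k (y + t • n) * g y :=
        (hk.comp (measurable_id.add_const _)).mul hgm
      rw [integral_map measurable_faceMap.aemeasurable h1.aestronglyMeasurable]
      simp only [hF, slabEquiv_apply]
  have hcomp : ∀ q, k (slabEquiv n hn c q) * g (faceProj n c (slabEquiv n hn c q)) = F q :=
    fun q => by rw [faceProj_slabEquiv]
  simp only [hmap]
  refine ⟨?_, ?_, ?_⟩
  · rw [← hm.integrable_comp_emb (slabEquiv n hn c).measurableEmbedding]
    exact hFi.congr (ae_of_all _ fun q => (hcomp q).symm)
  · exact hFi.integral_prod_left.intervalIntegrable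
  · rw [← hm.integral_comp', intervalIntegral.integral_of_le hr]
    simp only [hcomp]
    rw [Measure.volume_eq_prod, integral_prod _ hFi,
      setIntegral_eq_integral_of_forall_compl_eq_zero hF0]

end Slab

end TVFlow

/-! ### Traces at flat boundary points -/

namespace TVFlow

section FaceMeasure

open Module

variable {d : ℕ} {n : Euc d} {c : ℝ}

lemma faceProj_eq_self {x : Euc d} (hx : inner ℝ n x = c) : faceProj n c x = x := by
  simp [faceProj, hx]

lemma faceProj_add_smul (hn : ‖n‖ = 1) (x : Euc d) (t : ℝ) :
    faceProj n c (x + t • n) = faceProj n c x := by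
  simp only [faceProj, inner_add_right, inner_smul_right, real_inner_self_eq_norm_sq, hn]
  module

lemma dist_faceProj_le (hn : ‖n‖ = 1) {x : Euc d} (hx : inner ℝ n x = c) (y : Euc d) :
    dist (faceProj n c y) x ≤ dist y x := by
  rw [dist_eq_norm, dist_eq_norm]
  have h1 : faceProj n c y - x = (y - x) - inner ℝ n (y - x) • n := by
    rw [faceProj, inner_sub_right, hx]; abel
  have h2 : ‖(y - x) - inner ℝ n (y - x) • n‖ ^ 2 = ‖y - x‖ ^ 2 - inner ℝ n (y - x) ^ 2 := by
    rw [norm_sub_sq_real, inner_smul_right, norm_smul, hn, real_inner_comm n (y - x), mul_one,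
      Real.norm_eq_abs, sq_abs, ← sq]
    ring
  rw [h1]
  refine le_of_sq_le_sq ?_ (norm_nonneg _)
  rw [h2]
  linarith [sq_nonneg (inner ℝ n (y - x))]

lemma faceMeasure_closedBall (hn : ‖n‖ = 1) {x : Euc d} (hx : inner ℝ n x = c) {r : ℝ}
    (hr : 0 < r) : faceMeasure n c (Metric.closedBall x r) =
      ENNReal.ofReal (r ^ (d - 1)) * volume (Metric.ball (0 : (ℝ ∙ n)ᗮ) 1) := by
  rw [faceMeasure_eq_map hn, Measure.map_apply measurable_faceMap measurableSet_closedBall]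
  obtain ⟨w, rfl⟩ : x ∈ range (faceMap n c) := by rwa [range_faceMap hn]
  rw [(isometry_faceMap n c).preimage_closedBall, Measure.addHaar_closedBall _ _ hr.le,
    finrank_orthogonal_unit hn]

lemma isLocallyFiniteMeasure_faceMeasure (hn : ‖n‖ = 1) :
    IsLocallyFiniteMeasure (faceMeasure n c) := by
  refine ⟨fun x => ⟨Metric.ball x 1, Metric.ball_mem_nhds _ one_pos, ?_⟩⟩
  rw [faceMeasure_eq_map hn, Measure.map_apply measurable_faceMap measurableSet_ball]
  refine Bornology.IsBounded.measure_lt_top ?_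
  exact (isometry_faceMap n c).antilipschitz.isBounded_preimage Metric.isBounded_ball

lemma measurableSet_hyperplane : MeasurableSet {x : Euc d | inner ℝ n x = c} :=
  (isClosed_eq (by fun_prop) continuous_const).measurableSet

/-- Integrals over a layer of height `r` of functions that are constant in the normal direction. -/
lemma integrableOn_comp_faceProj (hn : ‖n‖ = 1) {r : ℝ} (hr : 0 ≤ r) {U : Set (Euc d)}
    (hU : MeasurableSet U) (hUr : ∀ y ∈ U, inner ℝ n y - c ∈ Ioc 0 r) {g : Euc d → ℝ}
    (hg : Integrable g (faceMeasure n c)) (hgm : Measurable g) :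
    IntegrableOn (fun y => g (faceProj n c y)) U ∧
      ((∀ y, 0 ≤ g y) → ∫ y in U, g (faceProj n c y) ≤ r * ∫ y, g y ∂faceMeasure n c) := by
  have hk1 : ∀ y, ‖U.indicator (fun _ => (1 : ℝ)) y‖ ≤ 1 := fun y => by
    by_cases hy : y ∈ U <;> simp [hy]
  have hk : Measurable (U.indicator fun _ => (1 : ℝ)) := measurable_const.indicator hU
  obtain ⟨h1, h2, h3⟩ := integral_mul_comp_faceProj hn hr hk hk1 hg hgm fun y hy =>
    hUr y (by_contra fun h => hy (indicator_of_notMem h _))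
  have e : (fun y => U.indicator (fun _ => (1 : ℝ)) y * g (faceProj n c y)) =
      U.indicator fun y => g (faceProj n c y) := by
    ext y
    by_cases hy : y ∈ U <;> simp [hy]
  rw [e] at h1 h3
  rw [integrable_indicator_iff hU] at h1
  refine ⟨h1, fun hg0 => ?_⟩
  rw [← integral_indicator hU, h3]
  calc _ ≤ ∫ _t in (0 : ℝ)..r, ∫ y, g y ∂faceMeasure n c := by
        refine intervalIntegral.integral_mono_on hr h2 (by simp) fun t _ => ?_
        refine integral_mono_of_nonneg (ae_of_all _ fun y => mul_nonneg
          (indicator_nonneg (fun _ _ => zero_le_one) _) (hg0 y)) hg (ae_of_all _ fun y => ?_)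
        exact mul_le_of_le_one_left (hg0 y) ((le_abs_self _).trans (hk1 _))
    _ = _ := by simp

end FaceMeasure

section Trace

variable {d : ℕ} {O : Set (Euc d)} {u : Euc d → ℝ} {ν : Measure (Euc d)} {h : Euc d → Euc d}
  {n : Euc d} {c : ℝ} {T : Euc d → ℝ}

/-- `T` is the density, with respect to the surface measure on the hyperplane `⟪n, x⟫ = c`, of the
normal component of the gradient measure `h ν` restricted to that hyperplane. -/
structure IsJumpDensity (ν : Measure (Euc d)) (h : Euc d → Euc d) (n : Euc d) (c : ℝ)
    (T : Euc d → ℝ) : Prop where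
  measurable : Measurable T
  integrable : Integrable T (faceMeasure n c)
  integral_eq : ∀ F : Euc d → ℝ, ∫ x in {x | inner ℝ n x = c}, F x * inner ℝ n (h x) ∂ν =
    ∫ x, F x * T x ∂faceMeasure n c
  withDensity_eq : (faceMeasure n c).withDensity (fun x => ‖T x‖ₑ) =
    (ν.withDensity fun x => ‖h x‖ₑ).restrict {x | inner ℝ n x = c}

/-- The part of the gradient on a hyperplane has a density with respect to the surface measure. -/
lemma HasExtGradient.exists_isJumpDensity (H : HasExtGradient O u ν h) (hu : IntegrableOn u O)
    (hh : StronglyMeasurable h) (hn : ‖n‖ = 1) (c : ℝ) : ∃ T, IsJumpDensity ν h n c T := by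
  have := H.finite
  have := isLocallyFiniteMeasure_faceMeasure hn (c := c)
  set S : Set (Euc d) := {x | inner ℝ n x = c} with hS
  have hSm : MeasurableSet S := measurableSet_hyperplane
  have hqm : Measurable fun x => inner ℝ n (h x) := measurable_const.inner hh.measurable
  have hqi : Integrable (fun x => inner ℝ n (h x)) (ν.restrict S) :=
    (H.integrable.const_inner n).restrict
  set μ₁ : Measure (Euc d) := (ν.restrict S).withDensity fun x => ‖inner ℝ n (h x)‖ₑ with hμ₁
  have : IsFiniteMeasure μ₁ := isFiniteMeasure_withDensity hqi.2.ne
  have hac : μ₁ ≪ faceMeasure n c := by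
    refine Measure.AbsolutelyContinuous.mk fun E hE hE0 => ?_
    have h1 := H.ae_inner_eq_zero hu (continuous_faceProj.measurable hE)
      (volume_preimage_faceProj hn hE hE0) (e := n)
      fun x t => by simp only [mem_preimage, faceProj_add_smul hn]
    rw [hμ₁, withDensity_apply _ hE, lintegral_eq_zero_iff hqm.enorm, EventuallyEq,
      ae_restrict_iff' hE, ae_restrict_iff' hSm]
    filter_upwards [h1] with x hx hxS hxE
    simp [hx (by rwa [mem_preimage, faceProj_eq_self hxS])]
  set g : Euc d → ℝ := fun x => (μ₁.rnDeriv (faceMeasure n c) x).toReal with hg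
  have hgm : Measurable g := (Measure.measurable_rnDeriv _ _).ennreal_toReal
  have hgi : Integrable g (faceMeasure n c) := Measure.integrable_toReal_rnDeriv
  have hg0 : ∀ x, 0 ≤ g x := fun x => ENNReal.toReal_nonneg
  -- the sign of the normal component
  let s : Euc d → ℝ := fun x => if 0 ≤ inner ℝ n (h x) then 1 else -1
  have hsm : Measurable s :=
    Measurable.ite (measurableSet_le measurable_const hqm) measurable_const measurable_const
  have hs1 : ∀ x, |s x| = 1 := fun x => by
    by_cases hx : 0 ≤ inner ℝ n (h x) <;> simp [s, hx]
  have hsq : ∀ x, |inner ℝ n (h x)| * s x = inner ℝ n (h x) := fun x => by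
    by_cases hx : 0 ≤ inner ℝ n (h x)
    · simp [s, hx, abs_of_nonneg hx]
    · simp [s, hx, abs_of_neg (not_le.1 hx)]
  refine ⟨fun x => s x * g x, hsm.mul hgm, ?_, fun F => ?_, ?_⟩
  · exact hgi.bdd_mul hsm.aestronglyMeasurable (c := 1) (ae_of_all _ fun x => (hs1 x).le)
  · have h1 : ∫ x in S, F x * inner ℝ n (h x) ∂ν = ∫ x, F x * s x ∂μ₁ := by
      rw [hμ₁, integral_withDensity_eq_integral_toReal_smul₀ hqm.enorm.aemeasurable (by simp)]
      refine integral_congr_ae (ae_of_all _ fun x => ?_)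
      simp only [toReal_enorm, smul_eq_mul, Real.norm_eq_abs]
      conv_lhs => rw [← hsq x]
      ring
    rw [h1, ← integral_rnDeriv_smul hac]
    refine integral_congr_ae (ae_of_all _ fun x => ?_)
    simp only [smul_eq_mul, hg]
    ring
  · have h1 : (faceMeasure n c).withDensity (fun x => ‖s x * g x‖ₑ) = μ₁ := by
      conv_rhs => rw [← Measure.withDensity_rnDeriv_eq _ _ hac]
      refine withDensity_congr_ae ?_
      filter_upwards [Measure.rnDeriv_lt_top μ₁ (faceMeasure n c)] with x hx
      rw [← ofReal_norm, norm_mul, Real.norm_eq_abs, hs1, one_mul,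
        Real.norm_of_nonneg (hg0 x), hg, ENNReal.ofReal_toReal hx.ne]
    rw [h1, hμ₁, restrict_withDensity hSm]
    refine withDensity_congr_ae ?_
    rw [EventuallyEq, ae_restrict_iff' hSm]
    filter_upwards [H.ae_eq_inner_smul hu hn c] with x hx hxS
    conv_rhs => rw [hx hxS]
    rw [enorm_smul, ← ofReal_norm n, hn]
    simp

/-- Near the point `x` of the hyperplane `⟪n, x⟫ = c`, the set `O` is the half space
`c < ⟪n, y⟫`. -/
def IsFlatAt (O : Set (Euc d)) (n : Euc d) (c : ℝ) (x : Euc d) : Prop :=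
  inner ℝ n x = c ∧ ∃ r > 0, ∀ y ∈ Metric.ball x r, (y ∈ O ↔ c < inner ℝ n y)

/-- Near a flat boundary point, the distance in `L¹` between `u` and the jump density, extended
constantly in the normal direction, is controlled by the mass of the gradient in the interior: the
increments of `u` in the normal direction are integrals of the normal derivative. -/
lemma HasExtGradient.integral_norm_sub_le (H : HasExtGradient O u ν h) (hu : IntegrableOn u O)
    (hO : MeasurableSet O) (hn : ‖n‖ = 1) (hT : IsJumpDensity ν h n c T)
    {x : Euc d} (hx : inner ℝ n x = c) {r : ℝ} (hr : 0 < r)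
    (hball : ∀ y ∈ Metric.ball x (2 * r), (y ∈ O ↔ c < inner ℝ n y)) :
    ∫ y in Metric.ball x r ∩ {y | c < inner ℝ n y}, ‖u y - T (faceProj n c y)‖ ≤
      r * ∫ y in Metric.ball x (2 * r) ∩ {y | c < inner ℝ n y}, ‖h y‖ ∂ν := by
  have := H.finite
  set A : Set (Euc d) := {y | c < inner ℝ n y} with hA
  have hAo : IsOpen A := isOpen_lt continuous_const (by fun_prop)
  set U : Set (Euc d) := Metric.ball x r ∩ A with hU
  have hUo : IsOpen U := Metric.isOpen_ball.inter hAo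
  set S : Set (Euc d) := Metric.ball x (2 * r) ∩ A with hS
  have hSm : MeasurableSet S := (Metric.isOpen_ball.inter hAo).measurableSet
  set M : ℝ := ∫ y in S, ‖h y‖ ∂ν with hM
  have hin : ∀ y ∈ Metric.ball x r, inner ℝ n y - c < r := fun y hy => by
    rw [← hx, ← inner_sub_right]
    calc inner ℝ n (y - x) ≤ ‖n‖ * ‖y - x‖ := real_inner_le_norm _ _
      _ < r := by rw [hn, one_mul, ← dist_eq_norm]; exact hy
  have hUr : ∀ y ∈ U, inner ℝ n y - c ∈ Ioc 0 r := fun y hy =>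
    ⟨sub_pos.2 hy.2, (hin y hy.1).le⟩
  have hUO : U ⊆ O := fun y hy =>
    (hball y (Metric.ball_subset_ball (by linarith) hy.1)).2 hy.2
  obtain ⟨hTi, -⟩ := integrableOn_comp_faceProj hn hr.le hUo.measurableSet hUr hT.integrable
    hT.measurable
  have hui : IntegrableOn u U := hu.mono_set hUO
  set k : Euc d → ℝ := U.indicator fun y => u y - T (faceProj n c y) with hk
  have hki : Integrable k := (integrable_indicator_iff hUo.measurableSet).2 (hui.sub hTi)
  have hkU : ∫ y in U, ‖u y - T (faceProj n c y)‖ = ∫ y in U, ‖k y‖ :=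
    setIntegral_congr_fun hUo.measurableSet fun y hy => by simp only [hk, indicator_of_mem hy]
  rw [hkU]
  refine setIntegral_norm_le_of_forall_isTest hUo hki fun φ hφ hφ1 => ?_
  have hφ0 : ∀ y, φ y ≠ 0 → y ∈ U := fun y hy => hφ.subset (subset_tsupport _ hy)
  have hφT := hφ.mono (subset_univ _)
  obtain ⟨i1, i2, i3⟩ := integral_mul_comp_faceProj hn hr.le hφ.continuous.measurable hφ1
    hT.integrable hT.measurable fun y hy => hUr y (hφ0 y hy)
  set w : Euc d → ℝ := O.indicator u with hw
  have hwi : Integrable w := hu.integrable_indicator hO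
  have hwφ : Integrable fun y => w y * φ y :=
    hwi.mul_bdd hφ.continuous.aestronglyMeasurable (ae_of_all _ hφ1)
  have e1 : ∫ y, inner ℝ (φ y) (k y) =
      (∫ y, w y * φ y) - ∫ y, φ y * T (faceProj n c y) := by
    rw [← integral_sub hwφ i1]
    refine integral_congr_ae (ae_of_all _ fun y => ?_)
    by_cases hy : y ∈ U
    · simp only [hk, indicator_of_mem hy, hw, indicator_of_mem (hUO hy), RCLike.inner_apply,
        conj_trivial]
      ring
    · have : φ y = 0 := by_contra fun h0 => hy (hφ0 y h0)
      simp [this]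
  rw [e1]
  -- the derivative of `t ↦ ∫ w φ(· + t n)` is `-G`
  set G : ℝ → ℝ := fun t => ∫ y, φ (y + t • n) * inner ℝ n (h y) ∂ν with hG
  have hder : ∀ t : ℝ, HasDerivAt (fun t : ℝ => ∫ y, w y * φ (y + t • n)) (-G t) t := fun t => by
    have h1 := hasDerivAt_integral_translate hwi hφT n t
    have h2 := H.integral_eq _ (hφT.comp_add_const (t • n)) n
    have h3 : ∫ y, w y * fderiv ℝ φ (y + t • n) n =
        ∫ y in O, u y * fderiv ℝ (fun y => φ (y + t • n)) y n := by
      rw [← integral_indicator hO]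
      refine integral_congr_ae (ae_of_all _ fun y => ?_)
      simp only [fderiv_comp_add_right]
      by_cases hy : y ∈ O <;> simp [hw, hy]
    rwa [h3, h2] at h1
  have hqi : Integrable (fun y => inner ℝ n (h y)) ν := H.integrable.const_inner n
  have hφt : ∀ t : ℝ, Continuous fun y => φ (y + t • n) := fun t =>
    hφ.continuous.comp (by fun_prop)
  have hGi : ∀ t : ℝ, Integrable (fun y => φ (y + t • n) * inner ℝ n (h y)) ν := fun t =>
    hqi.bdd_mul (hφt t).aestronglyMeasurable (ae_of_all _ fun y => hφ1 _)
  have hGc : Continuous G := by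
    refine continuous_of_dominated (bound := fun y => ‖inner ℝ n (h y)‖) (fun t => (hGi t).1)
      (fun t => ae_of_all _ fun y => ?_) hqi.norm (ae_of_all _ fun y => ?_)
    · rw [norm_mul]
      exact mul_le_of_le_one_left (norm_nonneg _) (hφ1 _)
    · exact (hφ.continuous.comp (by fun_prop)).mul continuous_const
  have hnear : ∀ t ∈ Icc 0 r, ∀ y, φ (y + t • n) ≠ 0 → y ∈ Metric.ball x (2 * r) :=
    fun t ht y hy => by
      have h1 := (hφ0 _ hy).1
      rw [Metric.mem_ball, dist_eq_norm] at h1 ⊢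
      calc ‖y - x‖ = ‖(y + t • n - x) - t • n‖ := by congr 1; abel
        _ ≤ ‖y + t • n - x‖ + ‖t • n‖ := norm_sub_le _ _
        _ < 2 * r := by
          rw [norm_smul, hn, Real.norm_of_nonneg ht.1]
          linarith [ht.2]
  -- the translate by `r` pushes the support of `φ` out of `O`
  have hF : ∫ t in (0 : ℝ)..r, G t = ∫ y, w y * φ y := by
    have h1 := intervalIntegral.integral_eq_sub_of_hasDerivAt (a := 0) (b := r)
      (fun t _ => hder t) (hGc.neg.intervalIntegrable _ _)
    have h2 : ∫ y, w y * φ (y + r • n) = 0 := by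
      refine integral_eq_zero_of_ae (ae_of_all _ fun y => ?_)
      by_cases hy : φ (y + r • n) = 0
      · simp [hy]
      · have h3 : y ∉ O := fun hyO => by
          have h4 := (hball y (hnear r ⟨hr.le, le_rfl⟩ y hy)).1 hyO
          have h5 := hin _ (hφ0 _ hy).1
          rw [inner_add_right, inner_smul_right, real_inner_self_eq_norm_sq, hn] at h5
          linarith
        simp [hw, h3]
    rw [intervalIntegral.integral_neg, h2] at h1
    simpa using h1
  -- `G` splits into the parts on the hyperplane and in `O`; there is no part on the other side
  have hle : ∀ t ∈ Icc 0 r, G t ≤ (∫ y, φ (y + t • n) * T y ∂faceMeasure n c) + M := by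
    intro t ht
    rw [← hT.integral_eq, hM, ← integral_indicator measurableSet_hyperplane,
      ← integral_indicator hSm, ← integral_add ((hGi t).indicator measurableSet_hyperplane)
        (H.integrable.norm.indicator hSm)]
    refine integral_mono_ae (hGi t) (((hGi t).indicator measurableSet_hyperplane).add
        (H.integrable.norm.indicator hSm)) ?_
    filter_upwards [H.ae_eq_zero hu] with y hy
    have hS0 : 0 ≤ S.indicator (fun y => ‖h y‖) y := indicator_nonneg (fun _ _ => norm_nonneg _) _
    by_cases hφy : φ (y + t • n) = 0
    · simpa [hφy, indicator] using hS0
    have hyb := hnear t ht y hφy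
    rcases lt_trichotomy (inner ℝ n y) c with h1 | h1 | h1
    · have h2 : y ∉ closure O := by
        refine fun hc => ?_
        obtain ⟨z, ⟨hz1, hz2⟩, hzO⟩ := mem_closure_iff.1 hc
          (Metric.ball x (2 * r) ∩ {z | inner ℝ n z < c})
          (Metric.isOpen_ball.inter (isOpen_lt (by fun_prop) continuous_const)) ⟨hyb, h1⟩
        exact lt_asymm ((hball z hz1).1 hzO) hz2
      simp [hy h2, indicator]
    · have : y ∈ {y : Euc d | inner ℝ n y = c} := h1
      simp only [indicator_of_mem this]
      linarith
    · have h2 : y ∈ S := ⟨hyb, h1⟩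
      have h3 : y ∉ {y : Euc d | inner ℝ n y = c} := fun h4 => h1.ne' h4
      simp only [indicator_of_mem h2, indicator_of_notMem h3, zero_add]
      calc φ (y + t • n) * inner ℝ n (h y) ≤ ‖φ (y + t • n) * inner ℝ n (h y)‖ := le_abs_self _
        _ ≤ 1 * (‖n‖ * ‖h y‖) := by
          rw [norm_mul]
          exact mul_le_mul (hφ1 _) (norm_inner_le_norm _ _) (norm_nonneg _) zero_le_one
        _ = ‖h y‖ := by rw [hn]; ring
  have hfin : ∫ t in (0 : ℝ)..r, G t ≤
      ∫ t in (0 : ℝ)..r, (∫ y, φ (y + t • n) * T y ∂faceMeasure n c + M) :=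
    intervalIntegral.integral_mono_on hr.le (hGc.intervalIntegrable _ _)
      (i2.add (by simp)) hle
  rw [intervalIntegral.integral_add i2 (by simp), ← i3, hF] at hfin
  simp only [intervalIntegral.integral_const, sub_zero, smul_eq_mul] at hfin
  linarith

/-- Almost every flat boundary point has a trace, given by the jump density. This combines the
previous estimate with the differentiation of measures along balls: the gradient in the interior is
singular to the surface measure, and almost every point is a Lebesgue point of the density. -/
lemma HasExtGradient.ae_hasTraceAt (H : HasExtGradient O u ν h) (hu : IntegrableOn u O)
    (hO : MeasurableSet O) (hn : ‖n‖ = 1) (hT : IsJumpDensity ν h n c T) :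
    ∀ᵐ x ∂faceMeasure n c, IsFlatAt O n c x → HasTraceAt O u x (T x) := by
  have := H.finite
  have := isLocallyFiniteMeasure_faceMeasure hn (c := c)
  have hd : d ≠ 0 := by
    rintro rfl
    rw [Subsingleton.elim n 0, norm_zero] at hn
    exact zero_ne_one hn
  set A : Set (Euc d) := {y | c < inner ℝ n y} with hA
  have hAm : MeasurableSet A := (isOpen_lt continuous_const (by fun_prop)).measurableSet
  set ρ : Measure (Euc d) := (ν.withDensity fun x => ‖h x‖ₑ).restrict A with hρ
  have : IsFiniteMeasure (ν.withDensity fun x => ‖h x‖ₑ) :=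
    isFiniteMeasure_withDensity H.integrable.2.ne
  have hsing : ρ ⟂ₘ faceMeasure n c := by
    refine ⟨{x | inner ℝ n x = c}, measurableSet_hyperplane, ?_, ?_⟩
    · rw [hρ, Measure.restrict_apply measurableSet_hyperplane]
      have : {x : Euc d | inner ℝ n x = c} ∩ A = ∅ := by
        ext y
        simp only [hA, mem_inter_iff, mem_ofPred_eq, mem_empty_iff_false, iff_false, not_and]
        intro h1 h2
        exact h2.ne' h1
      rw [this, measure_empty]
    · rw [faceMeasure, Measure.restrict_apply measurableSet_hyperplane.compl, compl_inter_self,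
        measure_empty]
  have hκ0 : 0 < volume (Metric.ball (0 : (ℝ ∙ n)ᗮ) 1) := Metric.measure_ball_pos _ _ one_pos
  have hκt : volume (Metric.ball (0 : (ℝ ∙ n)ᗮ) 1) ≠ ⊤ := Metric.isBounded_ball.measure_lt_top.ne
  set κ : ℝ := (volume (Metric.ball (0 : (ℝ ∙ n)ᗮ) 1)).toReal with hκ
  have hκp : 0 < κ := ENNReal.toReal_pos hκ0.ne' hκt
  filter_upwards [Besicovitch.ae_tendsto_rnDeriv ρ (faceMeasure n c), hsing.rnDeriv_ae_eq_zero,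
    (Besicovitch.vitaliFamily (faceMeasure n c)).ae_tendsto_average_norm_sub
      hT.integrable.locallyIntegrable] with x h1 h2 h3 hflat
  obtain ⟨hx, r₀, hr₀, hball⟩ := hflat
  have hreal : ∀ r, 0 < r → (faceMeasure n c (Metric.closedBall x r)).toReal = κ * r ^ (d - 1) :=
    fun r hr => by
      rw [faceMeasure_closedBall hn hx hr, ENNReal.toReal_mul,
        ENNReal.toReal_ofReal (by positivity), mul_comm]
  rw [h2] at h1
  have ha : Tendsto (fun r => (ρ (Metric.closedBall x r) /
      faceMeasure n c (Metric.closedBall x r)).toReal) (𝓝[>] 0) (𝓝 0) :=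
    (ENNReal.tendsto_toReal ENNReal.zero_ne_top).comp h1
  have hb := h3.comp (Besicovitch.tendsto_filterAt (faceMeasure n c) x)
  have h2r : Tendsto (fun r : ℝ => 2 * r) (𝓝[>] 0) (𝓝[>] 0) := by
    refine tendsto_nhdsWithin_iff.2 ⟨?_, ?_⟩
    · refine tendsto_nhdsWithin_of_tendsto_nhds ?_
      simpa using (continuous_const_mul (2 : ℝ)).tendsto 0
    · filter_upwards [self_mem_nhdsWithin] with r hr
      exact mul_pos two_pos (mem_Ioi.1 hr)
  have hlim := ((ha.comp h2r).const_mul (κ * 2 ^ (d - 1))).add (hb.const_mul κ)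
  rw [mul_zero, mul_zero, add_zero] at hlim
  refine squeeze_zero' ?_ ?_ hlim
  · filter_upwards [self_mem_nhdsWithin] with r hr
    exact mul_nonneg (inv_nonneg.2 (pow_nonneg (mem_Ioi.1 hr).le _))
      (integral_nonneg fun _ => abs_nonneg _)
  filter_upwards [Ioo_mem_nhdsGT (show 0 < r₀ / 2 by positivity)] with r hr
  have hr0 : 0 < r := hr.1
  have hr2 : 2 * r < r₀ := by linarith [hr.2]
  have hball' : ∀ y ∈ Metric.ball x (2 * r), (y ∈ O ↔ c < inner ℝ n y) := fun y hy =>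
    hball y (Metric.ball_subset_ball hr2.le hy)
  have hset : O ∩ Metric.ball x r = Metric.ball x r ∩ A := by
    ext y
    constructor
    · rintro ⟨hyO, hyb⟩
      exact ⟨hyb, (hball' y (Metric.ball_subset_ball (by linarith) hyb)).1 hyO⟩
    · rintro ⟨hyb, hyA⟩
      exact ⟨(hball' y (Metric.ball_subset_ball (by linarith) hyb)).2 hyA, hyb⟩
  have hest := H.integral_norm_sub_le hu hO hn hT hx hr0 hball'
  set U : Set (Euc d) := Metric.ball x r ∩ A with hU
  have hUm : MeasurableSet U := measurableSet_ball.inter hAm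
  have hUr : ∀ y ∈ U, inner ℝ n y - c ∈ Ioc 0 r := fun y hy => by
    refine ⟨sub_pos.2 hy.2, ?_⟩
    rw [← hx, ← inner_sub_right]
    calc inner ℝ n (y - x) ≤ ‖n‖ * ‖y - x‖ := real_inner_le_norm _ _
      _ ≤ r := by rw [hn, one_mul, ← dist_eq_norm]; exact (Metric.mem_ball.1 hy.1).le
  have hUO : U ⊆ O := hset ▸ inter_subset_left
  set B := Metric.closedBall x r with hB
  set g : Euc d → ℝ := B.indicator fun y => ‖T y - T x‖ with hg
  have hgm : Measurable g := (hT.measurable.sub_const _).norm.indicator measurableSet_closedBall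
  have hgi : Integrable g (faceMeasure n c) := by
    refine (integrable_indicator_iff measurableSet_closedBall).2 ?_
    exact (hT.integrable.integrableOn.sub (integrableOn_const
      (isCompact_closedBall x r).measure_lt_top.ne)).norm
  have hgU : ∀ y ∈ U, g (faceProj n c y) = ‖T (faceProj n c y) - T x‖ := fun y hy => by
    rw [hg, indicator_of_mem]
    exact (dist_faceProj_le hn hx y).trans (Metric.mem_ball.1 hy.1).le
  obtain ⟨hTi, -⟩ := integrableOn_comp_faceProj hn hr0.le hUm hUr hT.integrable hT.measurable
  obtain ⟨hgi', hgle⟩ := integrableOn_comp_faceProj hn hr0.le hUm hUr hgi hgm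
  have hgle := hgle fun y => indicator_nonneg (fun _ _ => norm_nonneg _) y
  have hui : IntegrableOn u U := hu.mono_set hUO
  have e1 : ∫ y in U, |u y - T x| ≤
      (∫ y in U, ‖u y - T (faceProj n c y)‖) + ∫ y in U, g (faceProj n c y) := by
    have i1 : IntegrableOn (fun y => ‖u y - T (faceProj n c y)‖) U := (hui.sub hTi).norm
    have i2 : IntegrableOn (fun y => |u y - T x|) U := (hui.sub (integrableOn_const
      ((measure_mono inter_subset_left).trans_lt measure_ball_lt_top).ne)).abs
    rw [← integral_add i1 hgi']
    refine setIntegral_mono_on i2 (i1.add hgi') hUm fun y hy => ?_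
    simp only [hgU y hy]
    exact abs_sub_le (u y) (T (faceProj n c y)) (T x)
  have e2 : ∫ y, g y ∂faceMeasure n c = κ * r ^ (d - 1) *
      ⨍ y in B, ‖T y - T x‖ ∂faceMeasure n c := by
    rw [hg, integral_indicator measurableSet_closedBall, setAverage_eq, smul_eq_mul, Measure.real,
      hreal r hr0, ← mul_assoc, mul_inv_cancel₀ (by positivity), one_mul]
  have e3 : ∫ y in Metric.ball x (2 * r) ∩ A, ‖h y‖ ∂ν ≤ κ * (2 * r) ^ (d - 1) *
      (ρ (Metric.closedBall x (2 * r)) / faceMeasure n c (Metric.closedBall x (2 * r))).toReal := by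
    rw [ENNReal.toReal_div, hreal _ (by positivity), mul_div_cancel₀ _ (by positivity)]
    rw [integral_norm_eq_lintegral_enorm H.integrable.1.restrict]
    refine ENNReal.toReal_mono (measure_ne_top _ _) ?_
    rw [hρ, Measure.restrict_apply measurableSet_closedBall, withDensity_apply _
      (measurableSet_closedBall.inter hAm)]
    exact lintegral_mono_set (inter_subset_inter_left _ Metric.ball_subset_closedBall)
  rw [hset]
  have hrd : r ^ d = r * r ^ (d - 1) := by rw [← pow_succ', Nat.sub_add_cancel (by omega)]
  calc (r ^ d)⁻¹ * ∫ y in U, |u y - T x|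
      ≤ (r ^ d)⁻¹ * (r * (κ * (2 * r) ^ (d - 1) *
      (ρ (Metric.closedBall x (2 * r)) / faceMeasure n c (Metric.closedBall x (2 * r))).toReal) +
        r * (κ * r ^ (d - 1) * ⨍ y in B, ‖T y - T x‖ ∂faceMeasure n c)) := by
        rw [← e2]
        gcongr
        exact e1.trans (add_le_add (hest.trans (mul_le_mul_of_nonneg_left e3 hr0.le)) hgle)
    _ = _ := by
        simp only [Function.comp_apply]
        rw [hrd, mul_pow]
        field_simp
        rfl

/-- The trace at a flat boundary point is unique, since the domain has positive density there. -/
lemma IsFlatAt.hasTraceAt_unique {x : Euc d} (hx : IsFlatAt O n c x) (hn : ‖n‖ = 1)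
    (hu : IntegrableOn u O) (hO : MeasurableSet O) {z z' : ℝ} (hz : HasTraceAt O u x z)
    (hz' : HasTraceAt O u x z') : z = z' := by
  obtain ⟨hxc, r₀, hr₀, hball⟩ := hx
  have hsum := hz.add hz'
  rw [add_zero] at hsum
  set ϑ : ℝ := volume.real (Metric.ball (0 : Euc d) 1) with hϑ
  have hϑp : 0 < ϑ := ENNReal.toReal_pos (Metric.measure_ball_pos _ _ one_pos).ne'
    measure_ball_lt_top.ne
  have hle : |z - z'| * (ϑ / 2 ^ d) ≤ 0 := by
    refine ge_of_tendsto hsum ?_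
    filter_upwards [Ioo_mem_nhdsGT hr₀] with r hr
    have hr0 : 0 < r := hr.1
    set D := O ∩ Metric.ball x r with hD
    have hDm : MeasurableSet D := hO.inter measurableSet_ball
    have hDf : volume D ≠ ⊤ := ((measure_mono inter_subset_right).trans_lt measure_ball_lt_top).ne
    -- the domain contains a ball of half the radius
    have hsub : Metric.ball (x + (r / 2) • n) (r / 2) ⊆ D := by
      intro y hy
      rw [Metric.mem_ball, dist_eq_norm] at hy
      have h1 : y ∈ Metric.ball x r := by
        rw [Metric.mem_ball, dist_eq_norm]
        calc ‖y - x‖ = ‖(y - (x + (r / 2) • n)) + (r / 2) • n‖ := by congr 1; abel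
          _ ≤ ‖y - (x + (r / 2) • n)‖ + ‖(r / 2) • n‖ := norm_add_le _ _
          _ < r := by
            rw [norm_smul, hn, Real.norm_of_nonneg (by positivity)]
            linarith
      refine ⟨(hball y (Metric.ball_subset_ball hr.2.le h1)).2 ?_, h1⟩
      have h2 := neg_le_of_abs_le (abs_real_inner_le_norm n (y - (x + (r / 2) • n)))
      rw [hn, one_mul, inner_sub_right, inner_add_right, inner_smul_right, hxc,
        real_inner_self_eq_norm_sq, hn] at h2
      linarith
    have hvol : ϑ * (r / 2) ^ d ≤ volume.real D := by
      refine le_trans (le_of_eq ?_) (measureReal_mono hsub hDf)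
      rw [Measure.real, Measure.addHaar_ball_of_pos _ _ (by positivity), ENNReal.toReal_mul,
        ENNReal.toReal_ofReal (by positivity), finrank_euclideanSpace_fin, mul_comm]
      rfl
    have huD : IntegrableOn u D := hu.mono_set inter_subset_left
    have hi : ∀ a : ℝ, IntegrableOn (fun y => |u y - a|) D := fun a =>
      (huD.sub (integrableOn_const hDf)).abs
    have h3 : |z - z'| * volume.real D ≤ (∫ y in D, |u y - z|) + ∫ y in D, |u y - z'| := by
      rw [← integral_add (hi z) (hi z'), mul_comm, ← smul_eq_mul, ← setIntegral_const]
      refine setIntegral_mono_on (integrableOn_const hDf) ((hi z).add (hi z')) hDm fun y _ => ?_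
      rw [abs_sub_comm (u y) z]
      exact abs_sub_le _ _ _
    calc |z - z'| * (ϑ / 2 ^ d) = (r ^ d)⁻¹ * (|z - z'| * (ϑ * (r / 2) ^ d)) := by
          rw [div_pow]
          field_simp
      _ ≤ (r ^ d)⁻¹ * (|z - z'| * volume.real D) := by gcongr
      _ ≤ (r ^ d)⁻¹ * ((∫ y in D, |u y - z|) + ∫ y in D, |u y - z'|) := by gcongr
      _ = _ := mul_add _ _ _
  have h0 : |z - z'| ≤ 0 := nonpos_of_mul_nonpos_left hle (by positivity)
  exact sub_eq_zero.1 (abs_nonpos_iff.1 h0)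

lemma measurableSet_isFlatAt (O : Set (Euc d)) (n : Euc d) (c : ℝ) :
    MeasurableSet {x | IsFlatAt O n c x} := by
  have : {x | IsFlatAt O n c x} = {x | inner ℝ n x = c} ∩
      {x | ∃ r > 0, ∀ y ∈ Metric.ball x r, (y ∈ O ↔ c < inner ℝ n y)} := rfl
  rw [this]
  refine measurableSet_hyperplane.inter (IsOpen.measurableSet ?_)
  rw [Metric.isOpen_iff]
  rintro x ⟨r, hr, hx⟩
  refine ⟨r / 2, by positivity, fun y hy => ⟨r / 2, by positivity, fun z hz => hx z ?_⟩⟩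
  rw [Metric.mem_ball] at *
  linarith [dist_triangle z y x]

lemma restrict_isFlatAt (O : Set (Euc d)) (n : Euc d) (c : ℝ) :
    (Measure.euclideanHausdorffMeasure (d - 1)).restrict {x | IsFlatAt O n c x} =
      (faceMeasure n c).restrict {x | IsFlatAt O n c x} := by
  rw [faceMeasure, Measure.restrict_restrict (measurableSet_isFlatAt O n c),
    inter_eq_self_of_subset_left fun x hx => hx.1]

/-- Traces exist almost everywhere on the flat part of the boundary in a given hyperplane, and
the surface integral of the absolute value of the trace is the mass of the gradient there. -/
lemma HasExtGradient.trace_isFlatAt (H : HasExtGradient O u ν h) (hu : IntegrableOn u O)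
    (hO : MeasurableSet O) (hh : StronglyMeasurable h) (hn : ‖n‖ = 1) (c : ℝ) :
    (∀ᵐ x ∂(Measure.euclideanHausdorffMeasure (d - 1)).restrict {x | IsFlatAt O n c x},
      ∃ z, HasTraceAt O u x z) ∧
    AEStronglyMeasurable (trace O u)
      ((Measure.euclideanHausdorffMeasure (d - 1)).restrict {x | IsFlatAt O n c x}) ∧
    ((Measure.euclideanHausdorffMeasure (d - 1)).withDensity
      fun x => ENNReal.ofReal |trace O u x|).restrict {x | IsFlatAt O n c x} =
      (ν.withDensity fun x => ‖h x‖ₑ).restrict {x | IsFlatAt O n c x} := by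
  obtain ⟨T, hT⟩ := H.exists_isJumpDensity hu hh hn c
  have hGm := measurableSet_isFlatAt O n c
  have hae := H.ae_hasTraceAt hu hO hn hT
  have h1 : ∀ᵐ x ∂(faceMeasure n c).restrict {x | IsFlatAt O n c x},
      HasTraceAt O u x (T x) ∧ trace O u x = T x := by
    rw [ae_restrict_iff' hGm]
    filter_upwards [hae] with x hx hxG
    have h2 : ∃ z, HasTraceAt O u x z := ⟨_, hx hxG⟩
    refine ⟨hx hxG, ?_⟩
    rw [trace, dif_pos h2]
    exact hxG.hasTraceAt_unique hn hu hO h2.choose_spec (hx hxG)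
  rw [restrict_withDensity hGm, restrict_isFlatAt]
  refine ⟨h1.mono fun x hx => ⟨_, hx.1⟩,
    hT.measurable.aestronglyMeasurable.congr (h1.mono fun x hx => hx.2.symm), ?_⟩
  rw [withDensity_congr_ae (g := fun x => ‖T x‖ₑ) (h1.mono fun x hx => by
    simp only [hx.2, ← Real.enorm_eq_ofReal_abs]), ← restrict_withDensity hGm, hT.withDensity_eq,
    Measure.restrict_restrict hGm, inter_eq_self_of_subset_left fun x hx => hx.1]

end Trace

end TVFlow

/-! ### Polyhedral domains as finite unions of polytopes -/

namespace TVFlow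

section HalfSpaces

variable {d : ℕ}

/-- The intersection of the closed half spaces `p.2 ≤ ⟪p.1, y⟫`. -/
def closedCell (A : Finset (Euc d × ℝ)) : Set (Euc d) := {y | ∀ p ∈ A, p.2 ≤ inner ℝ p.1 y}

/-- The intersection of the open half spaces `p.2 < ⟪p.1, y⟫`. -/
def openCell (A : Finset (Euc d × ℝ)) : Set (Euc d) := {y | ∀ p ∈ A, p.2 < inner ℝ p.1 y}

lemma isClosed_closedCell (A : Finset (Euc d × ℝ)) : IsClosed (closedCell A) := by
  have : closedCell A = ⋂ p ∈ A, {y | p.2 ≤ inner ℝ p.1 y} := by ext y; simp [closedCell]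
  rw [this]
  exact isClosed_biInter fun p _ => isClosed_le continuous_const (by fun_prop)

lemma isOpen_openCell (A : Finset (Euc d × ℝ)) : IsOpen (openCell A) := by
  have : openCell A = ⋂ p ∈ A, {y | p.2 < inner ℝ p.1 y} := by ext y; simp [openCell]
  rw [this]
  exact isOpen_biInter_finset fun p _ => isOpen_lt continuous_const (by fun_prop)

lemma openCell_subset_closedCell (A : Finset (Euc d × ℝ)) : openCell A ⊆ closedCell A :=
  fun _ hy p hp => (hy p hp).le

/-- `O` is the interior of a finite union of polytopes with disjoint interiors. Each polytope is
given by the unit normal vectors of its facets. -/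
structure IsCellUnion (O : Set (Euc d)) (𝓐 : Finset (Finset (Euc d × ℝ))) : Prop where
  unit : ∀ A ∈ 𝓐, ∀ p ∈ A, ‖p.1‖ = 1
  eq_interior : O = interior (⋃ A ∈ 𝓐, closedCell A)
  bounded : ∀ A ∈ 𝓐, Bornology.IsBounded (closedCell A)
  nonempty : ∀ A ∈ 𝓐, (openCell A).Nonempty
  disjoint : ∀ A ∈ 𝓐, ∀ B ∈ 𝓐, A ≠ B → Disjoint (openCell A) (openCell B)

/-- A connected set that avoids the hyperplanes of the facets of a polytope lies inside the
polytope or in its complement. -/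
lemma subset_or_disjoint_closedCell {A : Finset (Euc d × ℝ)} {B : Set (Euc d)}
    (hB : IsPreconnected B) (hA : ∀ p ∈ A, ∀ y ∈ B, inner ℝ p.1 y ≠ p.2) :
    B ⊆ closedCell A ∨ Disjoint B (closedCell A) := by
  rw [or_iff_not_imp_right, not_disjoint_iff]
  rintro ⟨y, hyB, hyA⟩ z hz p hp
  by_contra! hlt
  obtain ⟨w, hw, hwe⟩ := hB.intermediate_value hz hyB
    (f := fun y => inner ℝ p.1 y) (by fun_prop) ⟨hlt.le, hyA p hp⟩
  exact hA p hp w hw hwe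

variable {O : Set (Euc d)} {𝓐 : Finset (Finset (Euc d × ℝ))}

/-- If near `x` a set contains one side of a hyperplane through `x` and misses the other side, then
`x` is a flat boundary point of its interior. -/
lemma isFlatAt_of_half {F : Set (Euc d)} {n : Euc d} (hn : ‖n‖ = 1) {c : ℝ}
    {x : Euc d} (hx : inner ℝ n x = c) {r : ℝ} (hr : 0 < r)
    (h1 : Metric.ball x r ∩ {y | c < inner ℝ n y} ⊆ F)
    (h2 : Disjoint (Metric.ball x r ∩ {y | inner ℝ n y < c}) F) : IsFlatAt (interior F) n c x := by
  refine ⟨hx, r, hr, fun y hy => ⟨fun hyF => ?_, fun hyc => ?_⟩⟩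
  · by_contra! hle
    -- points slightly below `y` would belong to both sets
    obtain ⟨ε, hε, hεs⟩ :=
      Metric.isOpen_iff.1 (isOpen_interior.inter Metric.isOpen_ball) y ⟨hyF, hy⟩
    have h3 : y - (ε / 2) • n ∈ interior F ∩ Metric.ball x r := hεs (by
      rw [Metric.mem_ball, dist_eq_norm, sub_sub_cancel_left, norm_neg, norm_smul, hn,
        Real.norm_of_nonneg (by positivity)]
      linarith)
    refine disjoint_left.1 h2 ⟨h3.2, ?_⟩ (interior_subset h3.1)
    rw [mem_ofPred_eq, inner_sub_right, inner_smul_right, real_inner_self_eq_norm_sq, hn]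
    linarith
  · exact interior_maximal h1 (Metric.isOpen_ball.inter
      (isOpen_lt continuous_const (by fun_prop))) ⟨hy, hyc⟩

/-- Every boundary point is either flat or lies on two transversal facet hyperplanes. -/
lemma IsCellUnion.frontier_cases (h : IsCellUnion O 𝓐) {x : Euc d} (hx : x ∈ frontier O) :
    (∃ A ∈ 𝓐, ∃ p ∈ A, IsFlatAt O p.1 p.2 x ∨ IsFlatAt O (-p.1) (-p.2) x) ∨
    ∃ A ∈ 𝓐, ∃ p ∈ A, ∃ B ∈ 𝓐, ∃ q ∈ B, inner ℝ p.1 x = p.2 ∧ inner ℝ q.1 x = q.2 ∧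
      p.1 ≠ q.1 ∧ p.1 ≠ -q.1 := by
  classical
  set F := ⋃ A ∈ 𝓐, closedCell A with hF
  have hFc : IsClosed F := 𝓐.finite_toSet.isClosed_biUnion fun A _ => isClosed_closedCell A
  have hO := h.eq_interior
  have hOo : IsOpen O := hO ▸ isOpen_interior
  have hxO : x ∉ O := by rw [← hOo.interior_eq]; exact hx.2
  have hxcl : x ∈ closure O := hx.1
  have hxF : x ∈ F := closure_minimal (hO ▸ interior_subset) hFc hxcl
  -- the point lies on some facet hyperplane
  obtain ⟨A, hA, p, hp, hpx⟩ : ∃ A ∈ 𝓐, ∃ p ∈ A, inner ℝ p.1 x = p.2 := by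
    by_contra! hno
    obtain ⟨A, hA, hxA⟩ := mem_iUnion₂.1 hxF
    have h1 : x ∈ openCell A := fun p hp => lt_of_le_of_ne (hxA p hp) (hno A hA p hp).symm
    refine hxO (hO ▸ interior_maximal ?_ (isOpen_openCell A) h1)
    exact (openCell_subset_closedCell A).trans (subset_biUnion_of_mem (u := closedCell) hA)
  by_cases hq : ∃ B ∈ 𝓐, ∃ q ∈ B, inner ℝ q.1 x = q.2 ∧ p.1 ≠ q.1 ∧ p.1 ≠ -q.1
  · obtain ⟨B, hB, q, hq, h1, h2⟩ := hq
    exact Or.inr ⟨A, hA, p, hp, B, hB, q, hq, hpx, h1, h2⟩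
  left
  push Not at hq
  refine ⟨A, hA, p, hp, ?_⟩
  have hn := h.unit A hA p hp
  -- a ball that avoids the facet hyperplanes not passing through the point
  obtain ⟨r, hr, hball⟩ : ∃ r > 0, ∀ y ∈ Metric.ball x r, ∀ B ∈ 𝓐, ∀ q ∈ B,
      inner ℝ q.1 x ≠ q.2 → inner ℝ q.1 y ≠ q.2 := by
    refine Metric.eventually_nhds_iff_ball.1 ?_
    rw [eventually_all_finset]
    intro B _
    rw [eventually_all_finset]
    intro q _
    by_cases hqx : inner ℝ q.1 x = q.2
    · exact Eventually.of_forall fun y h => absurd hqx h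
    · have : Continuous fun y => inner ℝ q.1 y := by fun_prop
      filter_upwards [(this.tendsto x).eventually_ne hqx] with y hy _ using hy
  have hmiss : ∀ y ∈ Metric.ball x r, inner ℝ p.1 y ≠ p.2 → ∀ B ∈ 𝓐, ∀ q ∈ B,
      inner ℝ q.1 y ≠ q.2 := by
    intro y hy hyp B hB q hqB
    by_cases hqx : inner ℝ q.1 x = q.2
    · by_cases hpq : p.1 = q.1
      · rwa [← hqx, ← hpq, hpx]
      · have h3 := hq B hB q hqB hqx hpq
        have h4 : q.1 = -p.1 := by rw [h3, neg_neg]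
        rw [← hqx, h4, inner_neg_left, inner_neg_left, hpx]
        exact fun h5 => hyp (neg_injective h5)
    · exact hball y hy B hB q hqB hqx
  have hside : ∀ S : Set (Euc d), Convex ℝ S → (∀ y ∈ S, inner ℝ p.1 y ≠ p.2) →
      Metric.ball x r ∩ S ⊆ F ∨ Disjoint (Metric.ball x r ∩ S) F := by
    intro S hS hSp
    by_cases hex : ∃ B ∈ 𝓐, Metric.ball x r ∩ S ⊆ closedCell B
    · obtain ⟨B, hB, h1⟩ := hex
      exact Or.inl (h1.trans (subset_biUnion_of_mem (u := closedCell) hB))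
    · push Not at hex
      refine Or.inr ?_
      rw [hF, disjoint_iUnion₂_right]
      exact fun B hB => (subset_or_disjoint_closedCell ((convex_ball x r).inter hS).isPreconnected
        fun q hq' y hy => hmiss y hy.1 (hSp y hy.2) B hB q hq').resolve_left (hex B hB)
  have hlin : IsLinearMap ℝ fun y => inner ℝ p.1 y :=
    ⟨fun y z => inner_add_right _ _ _, fun t y => inner_smul_right _ _ _⟩
  have hup := hside {y | p.2 < inner ℝ p.1 y} (convex_halfSpace_gt hlin _) fun y hy => hy.ne'
  have hdn := hside {y | inner ℝ p.1 y < p.2} (convex_halfSpace_lt hlin _) fun y hy => hy.ne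
  have hnull : volume {y | inner ℝ p.1 y = p.2} = 0 :=
    volume_hyperplane (norm_ne_zero_iff.1 (by simp [hn])) _
  rw [hO]
  rcases hup with hup | hup <;> rcases hdn with hdn | hdn
  · -- both sides filled: the point is interior
    refine absurd ?_ hxO
    rw [hO]
    refine interior_maximal (fun y hy => ?_) Metric.isOpen_ball (Metric.mem_ball_self hr)
    by_contra hyF
    have hsub : Metric.ball x r \ F ⊆ {y | inner ℝ p.1 y = p.2} := fun z hz => by
      by_contra hne
      rcases lt_or_gt_of_ne hne with h1 | h1
      · exact hz.2 (hdn ⟨hz.1, h1⟩)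
      · exact hz.2 (hup ⟨hz.1, h1⟩)
    have h0 := (Metric.isOpen_ball.sdiff hFc).measure_eq_zero_iff volume |>.1
      (measure_mono_null hsub hnull)
    exact (h0 ▸ (⟨hy, hyF⟩ : y ∈ Metric.ball x r \ F) : y ∈ (∅ : Set (Euc d)))
  · exact Or.inl (isFlatAt_of_half hn hpx hr hup hdn)
  · refine Or.inr (isFlatAt_of_half (by rwa [norm_neg]) (by rw [inner_neg_left, hpx]) hr ?_ ?_)
    · simpa only [inner_neg_left, neg_lt_neg_iff] using hdn
    · simpa only [inner_neg_left, neg_lt_neg_iff] using hup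
  · -- both sides empty: the point is exterior
    exfalso
    have hsub : Metric.ball x r ∩ O ⊆ {y | inner ℝ p.1 y = p.2} := fun z hz => by
      have hzF : z ∈ F := interior_subset (hO ▸ hz.2)
      by_contra hne
      rcases lt_or_gt_of_ne hne with h1 | h1
      · exact disjoint_left.1 hdn ⟨hz.1, h1⟩ hzF
      · exact disjoint_left.1 hup ⟨hz.1, h1⟩ hzF
    have h0 := (Metric.isOpen_ball.inter hOo).measure_eq_zero_iff volume |>.1
      (measure_mono_null hsub hnull)
    obtain ⟨y, hy⟩ := mem_closure_iff.1 hxcl _ Metric.isOpen_ball (Metric.mem_ball_self hr)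
    exact (h0 ▸ hy : y ∈ (∅ : Set (Euc d)))

lemma IsCellUnion.isOpen (h : IsCellUnion O 𝓐) : IsOpen O := h.eq_interior ▸ isOpen_interior

lemma IsCellUnion.isBounded (h : IsCellUnion O 𝓐) : Bornology.IsBounded O := by
  rw [h.eq_interior]
  exact ((Bornology.isBounded_biUnion 𝓐.finite_toSet).2 h.bounded).subset interior_subset

lemma IsCellUnion.openCell_subset (h : IsCellUnion O 𝓐) {A : Finset (Euc d × ℝ)} (hA : A ∈ 𝓐) :
    openCell A ⊆ O := by
  rw [h.eq_interior]
  exact interior_maximal ((openCell_subset_closedCell A).trans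
    (subset_biUnion_of_mem (u := closedCell) hA)) (isOpen_openCell A)

/-- The integral over `O` is the sum of the integrals over the open cells. -/
lemma IsCellUnion.integral_eq_sum (h : IsCellUnion O 𝓐) {f : Euc d → ℝ} (hf : IntegrableOn f O) :
    ∫ x in O, f x = ∑ A ∈ 𝓐, ∫ x in openCell A, f x := by
  rw [← integral_biUnion_finset 𝓐 (fun A _ => (isOpen_openCell A).measurableSet)
    (fun A hA B hB hAB => h.disjoint A hA B hB hAB) fun A hA => hf.mono_set (h.openCell_subset hA)]
  refine setIntegral_congr_set ?_
  have hnull : volume (⋃ A ∈ 𝓐, ⋃ p ∈ A, {y | inner ℝ p.1 y = p.2}) = 0 := by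
    refine (measure_biUnion_null_iff 𝓐.countable_toSet).2 fun A hA =>
      (measure_biUnion_null_iff A.countable_toSet).2 fun p hp => volume_hyperplane ?_ _
    exact norm_ne_zero_iff.1 (by simp [h.unit A hA p hp])
  filter_upwards [compl_mem_ae_iff.2 hnull] with x hx
  refine propext ⟨fun hxO => ?_, fun hxC => ?_⟩
  · have hxO' : x ∈ O := hxO
    rw [h.eq_interior] at hxO'
    obtain ⟨A, hA, hxA⟩ := mem_iUnion₂.1 (interior_subset hxO')
    refine mem_iUnion₂.2 ⟨A, hA, fun p hp => lt_of_le_of_ne (hxA p hp) fun he => hx ?_⟩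
    exact mem_iUnion₂.2 ⟨A, hA, mem_iUnion₂.2 ⟨p, hp, he.symm⟩⟩
  · obtain ⟨A, hA, hxA⟩ := mem_iUnion₂.1 hxC
    exact h.openCell_subset hA hxA

/-- The functional is finite on functions of bounded variation. -/
lemma IsCellUnion.functionalI_ne_top (h : IsCellUnion O 𝓐) {u : Euc d → ℝ} (hu : MemBV O u) :
    functionalI O u ≠ ⊤ := by
  obtain ⟨hui, μ, hμ⟩ := hu
  obtain ⟨V, hV0, hV⟩ := hμ.exists_bound hui
  have hM : ∀ A : Finset (Euc d × ℝ), ∃ M : ℝ, A ∈ 𝓐 → ∀ φ : Euc d → Euc d, IsTest univ φ →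
      (∀ x, ‖φ x‖ ≤ 1) → ∫ x in openCell A, u x * divergence φ x ≤ M := by
    intro A
    by_cases hA : A ∈ 𝓐
    swap
    · exact ⟨0, fun h' => absurd h' hA⟩
    obtain ⟨q, hq⟩ := h.nonempty A hA
    -- normalize the affine functions of the facets to have the value `1` at the interior point `q`
    have hcell : openCell A =
        openPolytope (fun p : A => (inner ℝ p.1.1 q - p.1.2)⁻¹ • p.1.1) q := by
      ext y
      simp only [openCell, openPolytope, mem_ofPred_eq, Subtype.forall]
      refine forall₂_congr fun p hp => ?_
      have h1 : 0 < inner ℝ p.1 q - p.2 := sub_pos.2 (hq p hp)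
      rw [inner_smul_left, inner_sub_right, conj_trivial, ← mul_lt_mul_iff_right₀ h1]
      field_simp
      constructor <;> intro h2 <;> linarith
    have hb := (h.bounded A hA).subset (openCell_subset_closedCell A)
    have hiA := hui.mono_set (h.openCell_subset hA)
    have hVA : ∀ φ : Euc d → Euc d, IsTest (openCell A) φ → (∀ x, ‖φ x‖ ≤ 1) →
        ∫ x in openCell A, u x * divergence φ x ≤ V := fun φ hφ hφ1 => by
      rw [← setIntegral_eq_of_subset_of_forall_sdiff_eq_zero h.isOpen.measurableSet
        (h.openCell_subset hA) (f := fun x => u x * divergence φ x)]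
      · exact hV φ (hφ.mono (h.openCell_subset hA)) hφ1
      · intro x hx
        rw [divergence_congr (φ' := fun _ => 0), divergence]
        · simp
        · exact notMem_tsupport_iff_eventuallyEq.1 fun h' => hx.2 (hφ.subset h')
    rw [hcell] at hb hiA hVA ⊢
    obtain ⟨M, hM⟩ := exists_bound_of_polytope hb hiA hV0 hVA
    exact ⟨M, fun _ => hM⟩
  choose M hM using hM
  refine ne_top_of_le_ne_top (ENNReal.ofReal_ne_top (r := ∑ A ∈ 𝓐, M A))
    (functionalI_le h.isOpen h.isBounded fun φ hφ hφ1 => ENNReal.ofReal_le_ofReal ?_)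
  rw [h.integral_eq_sum (IntegrableOn.mul_continuous hui (continuous_divergence hφ.contDiff)
    (hasCompactSupport_divergence hφ.compact))]
  exact Finset.sum_le_sum fun A hA => hM A hA φ hφ hφ1

end HalfSpaces

section Simplicial

variable {d : ℕ}

lemma volume_convexHull_eq_zero {s : Set (Euc d)} (hs : affineSpan ℝ s ≠ ⊤) :
    volume (convexHull ℝ s) = 0 :=
  measure_mono_null (convexHull_subset_affineSpan s) (Measure.addHaar_affineSubspace _ _ hs)

/-- A full-dimensional simplex is the intersection of the half spaces given by its barycentric
coordinates. -/
lemma exists_closedCell_eq_convexHull (hd : 1 ≤ d) {s : Finset (Euc d)}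
    (hs : AffineIndependent ℝ ((↑) : s → Euc d)) (hs' : affineSpan ℝ (s : Set (Euc d)) = ⊤) :
    ∃ A : Finset (Euc d × ℝ), (∀ p ∈ A, ‖p.1‖ = 1) ∧ closedCell A = convexHull ℝ s ∧
      openCell A = interior (convexHull ℝ s) := by
  classical
  have hr : range ((↑) : s → Euc d) = s := Subtype.range_coe
  let b : AffineBasis s ℝ (Euc d) := ⟨(↑), hs, by rw [hr, hs']⟩
  have hb : range b = (s : Set (Euc d)) := hr
  have hcard : Fintype.card s = d + 1 := by
    have := hs.affineSpan_eq_top_iff_card_eq_finrank_add_one.1 (by rw [hr, hs'])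
    rwa [finrank_euclideanSpace_fin] at this
  have hnt : Nontrivial s := Fintype.one_lt_card_iff_nontrivial.1 (by omega)
  -- Riesz vectors of the linear parts of the barycentric coordinates
  let a : s → Euc d := fun i =>
    (InnerProductSpace.toDual ℝ (Euc d)).symm (LinearMap.toContinuousLinearMap (b.coord i).linear)
  have ha : ∀ i y, inner ℝ (a i) y = (b.coord i).linear y := fun i y => by
    simp [a]
  have hcoord : ∀ i y, b.coord i y = inner ℝ (a i) y + b.coord i 0 := fun i y => by
    rw [ha]
    simpa using (b.coord i).map_vadd 0 y
  have ha0 : ∀ i, a i ≠ 0 := fun i h0 => by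
    obtain ⟨j, hj⟩ := exists_ne i
    have h1 := hcoord i (b i)
    have h2 := hcoord i (b j)
    rw [b.coord_apply_eq, h0, inner_zero_left] at h1
    rw [b.coord_apply_ne hj.symm, h0, inner_zero_left] at h2
    exact one_ne_zero (h1.trans h2.symm)
  have hap : ∀ i, 0 < ‖a i‖ := fun i => norm_pos_iff.2 (ha0 i)
  let f : s → Euc d × ℝ := fun i => (‖a i‖⁻¹ • a i, -(‖a i‖⁻¹ * b.coord i 0))
  refine ⟨Finset.univ.image f, ?_, ?_, ?_⟩
  · simp only [Finset.mem_image, Finset.mem_univ, true_and, forall_exists_index]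
    rintro _ i rfl
    simp only [f, norm_smul, norm_inv, norm_norm]
    exact inv_mul_cancel₀ (hap i).ne'
  · rw [← hb, b.convexHull_eq_nonneg_coord]
    ext y
    simp only [closedCell, Finset.mem_image, Finset.mem_univ, true_and, forall_exists_index,
      forall_apply_eq_imp_iff, mem_ofPred_eq]
    refine forall_congr' fun i => ?_
    simp only [f, inner_smul_left, conj_trivial]
    rw [hcoord i y, neg_le_iff_add_nonneg, ← mul_add,
      mul_nonneg_iff_of_pos_left (inv_pos.2 (hap i))]
  · rw [← hb, b.interior_convexHull]
    ext y
    simp only [openCell, Finset.mem_image, Finset.mem_univ, true_and, forall_exists_index,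
      forall_apply_eq_imp_iff, mem_ofPred_eq]
    refine forall_congr' fun i => ?_
    simp only [f, inner_smul_left, conj_trivial]
    rw [hcoord i y, neg_lt_iff_pos_add, ← mul_add, mul_pos_iff_of_pos_left (inv_pos.2 (hap i))]

/-- A polyhedral domain is the interior of the union of the full-dimensional simplices: the
lower-dimensional ones form a closed null set. -/
lemma IsPolyhedralDomain.exists_isCellUnion (hd : 1 ≤ d) {O : Set (Euc d)}
    (hO : IsPolyhedralDomain O) : ∃ 𝓐, IsCellUnion O 𝓐 := by
  classical
  obtain ⟨K, hK, hOK⟩ := hO.exists_complex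
  set 𝓕 : Finset (Finset (Euc d)) :=
    hK.toFinset.filter fun s => affineSpan ℝ (s : Set (Euc d)) = ⊤ with h𝓕
  have hmem : ∀ s, s ∈ 𝓕 ↔ s ∈ K.faces ∧ affineSpan ℝ (s : Set (Euc d)) = ⊤ := fun s => by
    simp [h𝓕]
  have hA : ∀ s : Finset (Euc d), ∃ A : Finset (Euc d × ℝ), s ∈ 𝓕 → (∀ p ∈ A, ‖p.1‖ = 1) ∧
      closedCell A = convexHull ℝ s ∧ openCell A = interior (convexHull ℝ s) := fun s => by
    by_cases hs : s ∈ 𝓕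
    · obtain ⟨A, hA⟩ := exists_closedCell_eq_convexHull hd (K.indep ((hmem s).1 hs).1)
        ((hmem s).1 hs).2
      exact ⟨A, fun _ => hA⟩
    · exact ⟨∅, fun h => absurd h hs⟩
  choose A hA using hA
  have hunion : ⋃ B ∈ 𝓕.image A, closedCell B = ⋃ s ∈ 𝓕, convexHull ℝ (s : Set (Euc d)) := by
    rw [Finset.set_biUnion_finset_image]
    exact iUnion₂_congr fun s hs => (hA s hs).2.1
  have hcpt : ∀ s : Finset (Euc d), IsCompact (convexHull ℝ (s : Set (Euc d))) := fun s =>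
    s.finite_toSet.isCompact_convexHull (𝕜 := ℝ)
  refine ⟨𝓕.image A, ?_, ?_, ?_, ?_, ?_⟩
  · simp only [Finset.mem_image, forall_exists_index, and_imp]
    rintro _ s hs rfl
    exact (hA s hs).1
  · rw [hunion]
    set F := ⋃ s ∈ 𝓕, convexHull ℝ (s : Set (Euc d)) with hF
    have hFc : IsClosed F := 𝓕.finite_toSet.isClosed_biUnion fun s _ => (hcpt s).isClosed
    have hFK : F ⊆ K.space := iUnion₂_subset fun s hs => K.convexHull_subset_space ((hmem s).1 hs).1
    have hOo : IsOpen O := hOK ▸ isOpen_interior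
    refine Subset.antisymm (interior_maximal ?_ hOo) (hOK ▸ interior_mono hFK)
    rw [← sdiff_eq_empty, ← (hOo.sdiff hFc).measure_eq_zero_iff volume]
    have hsub : O \ F ⊆ ⋃ s ∈ {s ∈ K.faces | affineSpan ℝ (s : Set (Euc d)) ≠ ⊤},
        convexHull ℝ (s : Set (Euc d)) := by
      rintro x ⟨hxO, hxF⟩
      rw [hOK] at hxO
      obtain ⟨s, hs, hxs⟩ := K.mem_space_iff.1 (interior_subset hxO)
      refine mem_iUnion₂.2 ⟨s, ⟨hs, fun htop => hxF ?_⟩, hxs⟩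
      exact mem_iUnion₂.2 ⟨s, (hmem s).2 ⟨hs, htop⟩, hxs⟩
    refine measure_mono_null hsub ((measure_biUnion_null_iff
      (hK.subset (sep_subset _ _)).countable).2 fun s hs => volume_convexHull_eq_zero hs.2)
  · simp only [Finset.mem_image, forall_exists_index, and_imp]
    rintro _ s hs rfl
    rw [(hA s hs).2.1]
    exact (hcpt s).isBounded
  · simp only [Finset.mem_image, forall_exists_index, and_imp]
    rintro _ s hs rfl
    rw [(hA s hs).2.2]
    exact interior_convexHull_nonempty_iff_affineSpan_eq_top.2 ((hmem s).1 hs).2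
  · simp only [Finset.mem_image, forall_exists_index, and_imp]
    rintro _ s hs rfl _ t ht rfl hne
    have hst : s ≠ t := fun h => hne (by rw [h])
    obtain ⟨hsK, hs'⟩ := (hmem s).1 hs
    obtain ⟨htK, ht'⟩ := (hmem t).1 ht
    have hcard : ∀ s : Finset (Euc d), AffineIndependent ℝ ((↑) : s → Euc d) →
        affineSpan ℝ (s : Set (Euc d)) = ⊤ → s.card = d + 1 := fun s h1 h2 => by
      have := h1.affineSpan_eq_top_iff_card_eq_finrank_add_one.1
        (by rw [Subtype.range_coe]; exact h2)
      rwa [finrank_euclideanSpace_fin, Fintype.card_coe] at this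
    have hnull : affineSpan ℝ ((s ∩ t : Finset (Euc d)) : Set (Euc d)) ≠ ⊤ := fun htop => by
      have hi : AffineIndependent ℝ ((↑) : (s ∩ t : Finset (Euc d)) → Euc d) :=
        (K.indep hsK).mono (by simp)
      have h1 := hcard _ hi htop
      have h2 : s ∩ t = s := Finset.eq_of_subset_of_card_le Finset.inter_subset_left
        (by rw [h1, hcard s (K.indep hsK) hs'])
      have h3 : s ∩ t = t := Finset.eq_of_subset_of_card_le Finset.inter_subset_right
        (by rw [h1, hcard t (K.indep htK) ht'])
      exact hst (h2.symm.trans h3)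
    rw [(hA s hs).2.2, (hA t ht).2.2, disjoint_iff_inter_eq_empty,
      ← (isOpen_interior.inter isOpen_interior).measure_eq_zero_iff volume]
    refine measure_mono_null ?_ (volume_convexHull_eq_zero hnull)
    rw [Finset.coe_inter]
    exact (inter_subset_inter interior_subset interior_subset).trans
      (K.inter_subset_convexHull hsK htK)

end Simplicial

end TVFlow

/-! ### The trace formula, semicontinuity and convexity -/

namespace TVFlow

section BoundaryIntegral

variable {d : ℕ} {O : Set (Euc d)} {u : Euc d → ℝ} {ν : Measure (Euc d)} {h : Euc d → Euc d}
  {𝓐 : Finset (Finset (Euc d × ℝ))}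

lemma HasExtGradient.congr {h' : Euc d → Euc d} (H : HasExtGradient O u ν h) (he : h =ᵐ[ν] h') :
    HasExtGradient O u ν h' :=
  ⟨H.finite, H.integrable.congr he, fun ψ hψ e => by
    rw [H.integral_eq ψ hψ e, integral_congr_ae (g := fun x => ψ x * inner ℝ e (h' x))
      (he.mono fun x hx => by simp only [hx])]⟩

/-- The normal vectors and heights of the facets, with both orientations. -/
def facetData (𝓐 : Finset (Finset (Euc d × ℝ))) : Set (Euc d × ℝ) :=
  {q | ∃ A ∈ 𝓐, ∃ p ∈ A, q = p ∨ q = -p}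

lemma finite_facetData (𝓐 : Finset (Finset (Euc d × ℝ))) : (facetData 𝓐).Finite := by
  classical
  refine ((𝓐.biUnion id) ∪ (𝓐.biUnion id).image Neg.neg).finite_toSet.subset ?_
  rintro q ⟨A, hA, p, hp, rfl | rfl⟩
  · exact Finset.mem_coe.2 (Finset.mem_union_left _ (Finset.mem_biUnion.2 ⟨A, hA, hp⟩))
  · exact Finset.mem_coe.2 (Finset.mem_union_right _ (Finset.mem_image.2
      ⟨p, Finset.mem_biUnion.2 ⟨A, hA, hp⟩, rfl⟩))

lemma IsCellUnion.norm_facetData (hO : IsCellUnion O 𝓐) {q : Euc d × ℝ} (hq : q ∈ facetData 𝓐) :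
    ‖q.1‖ = 1 := by
  obtain ⟨A, hA, p, hp, rfl | rfl⟩ := hq
  · exact hO.unit A hA _ hp
  · rw [Prod.fst_neg, norm_neg]
    exact hO.unit A hA _ hp

/-- A measure that does not charge the transversal intersections of facet hyperplanes is
concentrated, on the boundary, in the flat part. -/
lemma IsCellUnion.measure_frontier_sdiff (hO : IsCellUnion O 𝓐) {μ : Measure (Euc d)}
    (hμ : ∀ p ∈ facetData 𝓐, ∀ q ∈ facetData 𝓐, p.1 ≠ q.1 → p.1 ≠ -q.1 →
      μ {x | inner ℝ p.1 x = p.2 ∧ inner ℝ q.1 x = q.2} = 0) :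
    μ (frontier O \ ⋃ q ∈ facetData 𝓐, {x | IsFlatAt O q.1 q.2 x}) = 0 := by
  have hfin := finite_facetData 𝓐
  have h0 : μ (⋃ p ∈ facetData 𝓐, ⋃ q ∈ {q ∈ facetData 𝓐 | p.1 ≠ q.1 ∧ p.1 ≠ -q.1},
      {x | inner ℝ p.1 x = p.2 ∧ inner ℝ q.1 x = q.2}) = 0 :=
    (measure_biUnion_null_iff hfin.countable).2 fun p hp =>
      (measure_biUnion_null_iff (hfin.subset (sep_subset _ _)).countable).2 fun q hq =>
        hμ p hp q hq.1 hq.2.1 hq.2.2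
  refine measure_mono_null (fun x hx => ?_) h0
  rcases hO.frontier_cases hx.1 with ⟨A, hA, p, hp, hflat | hflat⟩ |
    ⟨A, hA, p, hp, B, hB, q, hq, h1, h2, h3, h4⟩
  · exact absurd (mem_iUnion₂.2 ⟨p, ⟨A, hA, p, hp, Or.inl rfl⟩, hflat⟩) hx.2
  · exact absurd (mem_iUnion₂.2 ⟨-p, ⟨A, hA, p, hp, Or.inr rfl⟩, hflat⟩) hx.2
  · exact mem_iUnion₂.2 ⟨p, ⟨A, hA, p, hp, Or.inl rfl⟩, mem_iUnion₂.2
      ⟨q, ⟨⟨B, hB, q, hq, Or.inl rfl⟩, h3, h4⟩, h1, h2⟩⟩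

/-- The trace of a function of bounded variation exists almost everywhere on the boundary and is
integrable, and the functional is the total variation in the domain plus the boundary integral of
the trace. -/
lemma IsCellUnion.trace_and_functionalI_eq (hO : IsCellUnion O 𝓐) (hu : MemBV O u) :
    (∀ᵐ x ∂surfaceMeasure O, ∃ z, HasTraceAt O u x z) ∧
    Integrable (trace O u) (surfaceMeasure O) ∧
    functionalI O u = gradientTV O u + boundaryIntegral O u := by
  obtain ⟨ν, h₀, H₀⟩ := exists_hasExtGradient hO.isOpen hu.1 (hO.functionalI_ne_top hu)
  -- a measurable representative of the density
  obtain ⟨h, hh, hhe⟩ := H₀.integrable.1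
  have H := H₀.congr hhe
  have hui := hu.1
  have hOm := hO.isOpen.measurableSet
  have hFm : MeasurableSet (frontier O) := isClosed_frontier.measurableSet
  have := H.finite
  set S : Measure (Euc d) := Measure.euclideanHausdorffMeasure (d - 1) with hS
  set W : Measure (Euc d) := S.withDensity fun x => ENNReal.ofReal |trace O u x| with hW
  set m : Measure (Euc d) := ν.withDensity fun x => ‖h x‖ₑ with hm
  have : IsFiniteMeasure m := isFiniteMeasure_withDensity H.integrable.2.ne
  set G := ⋃ q ∈ facetData 𝓐, {x | IsFlatAt O q.1 q.2 x} with hG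
  have hcount := (finite_facetData 𝓐).countable
  have : Countable (facetData 𝓐) := hcount.to_subtype
  have hSR : S (frontier O \ G) = 0 := by
    refine hO.measure_frontier_sdiff fun p hp q hq h1 h2 => ?_
    have h3 := faceMeasure_hyperplane (hO.norm_facetData hq) (hO.norm_facetData hp) h1 h2
      (c := q.2) p.2
    rwa [faceMeasure, Measure.restrict_apply measurableSet_hyperplane] at h3
  have hmR : m (frontier O \ G) = 0 := by
    refine hO.measure_frontier_sdiff fun p hp q hq h1 h2 => ?_
    have hms : MeasurableSet {x : Euc d | inner ℝ p.1 x = p.2 ∧ inner ℝ q.1 x = q.2} :=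
      measurableSet_hyperplane.inter measurableSet_hyperplane
    rw [hm, withDensity_apply _ hms, lintegral_eq_zero_iff hh.measurable.enorm, EventuallyEq,
      ae_restrict_iff' hms]
    filter_upwards [H.ae_eq_zero_of_inter hui (hO.norm_facetData hp) (hO.norm_facetData hq) h1 h2
      p.2 q.2] with x hx hxx
    simp [hx hxx.1 hxx.2]
  have hflat := fun (q : Euc d × ℝ) (hq : q ∈ facetData 𝓐) =>
    H.trace_isFlatAt hui hOm hh (hO.norm_facetData hq) q.2
  have hWm : W.restrict G = m.restrict G :=
    (Measure.restrict_biUnion_congr hcount).2 fun q hq => (hflat q hq).2.2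
  -- the surface measure is carried by the flat part
  have hSle : surfaceMeasure O ≤ S.restrict G := by
    have h1 : surfaceMeasure O = S.restrict (frontier O ∩ G) := by
      rw [surfaceMeasure, ← Measure.restrict_congr_set]
      refine (ae_eq_set.2 ⟨?_, ?_⟩)
      · rw [sdiff_eq_empty.2 inter_subset_left, measure_empty]
      · rwa [sdiff_self_inter]
    rw [h1]
    exact Measure.restrict_mono inter_subset_right le_rfl
  have hbd : boundaryIntegral O u = m (frontier O) := by
    have hWR : W (frontier O \ G) = 0 := withDensity_absolutelyContinuous _ _ hSR
    have h1 : boundaryIntegral O u = W (frontier O) := by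
      rw [hW, withDensity_apply _ hFm]
      rfl
    rw [h1, ← measure_inter_conull' hWR, ← measure_inter_conull' hmR,
      ← Measure.restrict_apply hFm, hWm, Measure.restrict_apply hFm]
  have hext : m (closure O)ᶜ = 0 := by
    rw [hm, withDensity_apply _ isClosed_closure.measurableSet.compl,
      lintegral_eq_zero_iff hh.measurable.enorm, EventuallyEq,
      ae_restrict_iff' isClosed_closure.measurableSet.compl]
    filter_upwards [H.ae_eq_zero hui] with x hx hxc
    simp [hx hxc]
  refine ⟨?_, ⟨?_, ?_⟩, ?_⟩
  · have h1 : ∀ᵐ x ∂S.restrict G, ∃ z, HasTraceAt O u x z := by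
      rw [hG, biUnion_eq_iUnion, ae_restrict_iUnion_iff]
      exact fun q => (hflat q.1 q.2).1
    exact ae_mono hSle h1
  · refine AEStronglyMeasurable.mono_measure ?_ hSle
    rw [hG, biUnion_eq_iUnion, aestronglyMeasurable_iUnion_iff]
    exact fun q => (hflat q.1 q.2).2.1
  · have h1 : ∫⁻ x, ‖trace O u x‖ₑ ∂surfaceMeasure O = boundaryIntegral O u :=
      lintegral_congr fun x => Real.enorm_eq_ofReal_abs _
    rw [HasFiniteIntegral, h1, hbd]
    exact measure_lt_top _ _
  · rw [H.functionalI_eq hO.isOpen hO.isBounded hui, H.gradientTV_eq hO.isOpen hui, hbd,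
      ← withDensity_apply _ hOm, ← hm, ← setLIntegral_univ,
      ← withDensity_apply _ MeasurableSet.univ, ← hm, ← measure_union
        (by simpa [hO.isOpen.interior_eq] using disjoint_interior_frontier (s := O)) hFm,
      ← closure_eq_self_union_frontier, ← measure_inter_conull' (s := univ) (t := closure O)
        (by rwa [← compl_eq_univ_sdiff]), univ_inter]

/-- The functional is infinite outside the functions of bounded variation. -/
lemma IsCellUnion.functionalI_eq_top (hO : IsCellUnion O 𝓐) (hui : IntegrableOn u O)
    (hu : ¬ MemBV O u) : functionalI O u = ⊤ := by
  by_contra hI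
  obtain ⟨ν, h, H⟩ := exists_hasExtGradient hO.isOpen hui hI
  exact hu (H.memBV hO.isOpen hui)

lemma IsCellUnion.memBV_iff (hO : IsCellUnion O 𝓐) (hui : IntegrableOn u O) :
    MemBV O u ↔ functionalI O u ≠ ⊤ :=
  ⟨hO.functionalI_ne_top, fun h => by_contra fun hu => h (hO.functionalI_eq_top hui hu)⟩

end BoundaryIntegral

section Semicontinuity

variable {d : ℕ} {O : Set (Euc d)} {p : ℝ≥0∞} [Fact (1 ≤ p)]

/-- Integration over a bounded set against a continuous function is a continuous linear functional
on `L^p`. -/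
lemma exists_clm_integral (hb : Bornology.IsBounded O) (hO : MeasurableSet O) {g : Euc d → ℝ}
    (hg : Continuous g) : ∃ L : Lp ℝ p (volume.restrict O) →L[ℝ] ℝ,
      ∀ u : Lp ℝ p (volume.restrict O), L u = ∫ x in O, u x * g x := by
  have : IsFiniteMeasure (volume.restrict O) := ⟨by simpa using hb.measure_lt_top⟩
  obtain ⟨C, hC⟩ := hb.isCompact_closure.exists_bound_of_continuousOn hg.continuousOn
  have hgb : ∀ᵐ x ∂volume.restrict O, ‖g x‖ ≤ C :=
    (ae_restrict_iff' hO).2 (ae_of_all _ fun x hx => hC x (subset_closure hx))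
  have hp : (1 : ℝ≥0∞) ≤ p := Fact.out
  have hi : ∀ u : Lp ℝ p (volume.restrict O), Integrable u (volume.restrict O) := fun u =>
    (Lp.memLp u).integrable hp
  have hig : ∀ u : Lp ℝ p (volume.restrict O), Integrable (fun x => u x * g x)
      (volume.restrict O) := fun u => (hi u).mul_bdd hg.aestronglyMeasurable hgb
  set κ : ℝ≥0∞ := volume.restrict O univ ^ (1 / (1 : ℝ≥0∞).toReal - 1 / p.toReal) with hκ
  have hκt : κ ≠ ⊤ := by
    refine ENNReal.rpow_ne_top_of_nonneg ?_ (measure_ne_top _ _)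
    rcases eq_or_ne p ⊤ with rfl | hpt
    · simp
    · have : 1 ≤ p.toReal := by simpa using ENNReal.toReal_mono hpt hp
      rw [ENNReal.toReal_one, sub_nonneg]
      exact one_div_le_one_div_of_le one_pos this
  let L : Lp ℝ p (volume.restrict O) →ₗ[ℝ] ℝ :=
    { toFun := fun u => ∫ x in O, u x * g x
      map_add' := fun u v => by
        rw [← integral_add (hig u) (hig v)]
        refine integral_congr_ae ?_
        filter_upwards [Lp.coeFn_add u v] with x hx
        rw [hx, Pi.add_apply, add_mul]
      map_smul' := fun a u => by
        rw [RingHom.id_apply, smul_eq_mul, ← integral_const_mul]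
        refine integral_congr_ae ?_
        filter_upwards [Lp.coeFn_smul a u] with x hx
        rw [hx, Pi.smul_apply, smul_eq_mul, mul_assoc] }
  refine ⟨L.mkContinuous (κ.toReal * |C|) fun u => ?_, fun u => rfl⟩
  calc ‖∫ x in O, u x * g x‖ ≤ ∫ x in O, ‖u x‖ * |C| := by
        refine norm_integral_le_of_norm_le ((hi u).norm.mul_const _) ?_
        filter_upwards [hgb] with x hx
        rw [norm_mul]
        exact mul_le_mul_of_nonneg_left (hx.trans (le_abs_self C)) (norm_nonneg _)
    _ = (∫ x in O, ‖u x‖) * |C| := integral_mul_const _ _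
    _ ≤ (κ.toReal * ‖u‖) * |C| := by
        gcongr
        rw [integral_norm_eq_lintegral_enorm (hi u).1, ← eLpNorm_one_eq_lintegral_enorm,
          Lp.norm_def, mul_comm, ← ENNReal.toReal_mul]
        exact ENNReal.toReal_mono (ENNReal.mul_ne_top (Lp.eLpNorm_ne_top u) hκt)
          (eLpNorm_le_eLpNorm_mul_rpow_measure_univ hp (hi u).1)
    _ = _ := by ring

variable {E : Type*} [NormedAddCommGroup E] [NormedSpace ℝ E]

lemma continuous_weakSpace (L : E →L[ℝ] ℝ) :
    Continuous fun u : WeakSpace ℝ E => L ((toWeakSpace ℝ E).symm u) :=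
  WeakBilin.eval_continuous _ L

/-- A supremum of truncated continuous affine functionals is convex. -/
lemma convexOn_iSup_ofReal {ι : Sort*} (L : ι → E →L[ℝ] ℝ) (b : ι → ℝ) :
    ConvexOn ℝ≥0 univ fun u => ⨆ i, ENNReal.ofReal (L i u + b i) := by
  refine ⟨convex_univ, fun x _ y _ s t _ _ hst => iSup_le fun i => ?_⟩
  have hst' : (s : ℝ) + t = 1 := by exact_mod_cast hst
  have e : L i (s • x + t • y) + b i = s * (L i x + b i) + t * (L i y + b i) := by
    simp only [map_add, NNReal.smul_def, map_smul, smul_eq_mul]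
    linear_combination (-b i) * hst'
  rw [e]
  refine ENNReal.ofReal_add_le.trans (add_le_add ?_ ?_)
  · rw [ENNReal.ofReal_mul s.coe_nonneg, ENNReal.ofReal_coe_nnreal, ENNReal.smul_def, smul_eq_mul]
    gcongr
    exact le_iSup (fun i => ENNReal.ofReal (L i x + b i)) i
  · rw [ENNReal.ofReal_mul t.coe_nonneg, ENNReal.ofReal_coe_nnreal, ENNReal.smul_def, smul_eq_mul]
    gcongr
    exact le_iSup (fun i => ENNReal.ofReal (L i y + b i)) i

/-- A supremum of truncated continuous affine functionals is weakly lower semicontinuous. -/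
lemma lowerSemicontinuous_iSup_ofReal {ι : Sort*} (L : ι → E →L[ℝ] ℝ) (b : ι → ℝ) :
    LowerSemicontinuous fun u : WeakSpace ℝ E =>
      ⨆ i, ENNReal.ofReal (L i ((toWeakSpace ℝ E).symm u) + b i) :=
  lowerSemicontinuous_iSup fun i => (ENNReal.continuous_ofReal.comp
    ((continuous_weakSpace (L i)).add continuous_const)).lowerSemicontinuous

/-- The functional is a supremum of truncated continuous linear functionals on `L^p`. -/
lemma exists_functionalI_eq_iSup (hb : Bornology.IsBounded O) (hO : MeasurableSet O) :
    ∃ (ι : Type) (L : ι → Lp ℝ p (volume.restrict O) →L[ℝ] ℝ),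
      ∀ u : Lp ℝ p (volume.restrict O), functionalI O u = ⨆ i, ENNReal.ofReal (L i u + 0) := by
  have hL := fun φ : {φ : Euc d → Euc d // ContDiff ℝ ∞ φ ∧ ∀ x, ‖φ x‖ ≤ 1} =>
    exists_clm_integral (p := p) hb hO (continuous_divergence φ.2.1)
  choose L hL using hL
  refine ⟨_, L, fun u => ?_⟩
  simp only [hL, add_zero, functionalI, iSup_subtype, iSup_and]

/-- The scaled squared distance in a Hilbert space is a supremum of truncated continuous affine
functionals, since `‖u - g‖² ≥ 2 ⟪w, u - g⟫ - ‖w‖²` with equality for `w = u - g`. -/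
lemma ofReal_mul_norm_sub_sq_eq_iSup {F : Type*} [NormedAddCommGroup F] [InnerProductSpace ℝ F]
    {a : ℝ} (ha : 0 ≤ a) (g u : F) :
    ENNReal.ofReal (a * ‖u - g‖ ^ 2) = ⨆ w : F, ENNReal.ofReal
      (((2 * a) • innerSL ℝ w) u + -(a * (2 * inner ℝ w g + ‖w‖ ^ 2))) := by
  have e : ∀ w, ((2 * a) • innerSL ℝ w) u + -(a * (2 * inner ℝ w g + ‖w‖ ^ 2)) =
      a * (‖u - g‖ ^ 2 - ‖u - g - w‖ ^ 2) := fun w => by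
    rw [norm_sub_sq_real (u - g) w, real_inner_comm w (u - g), inner_sub_right]
    simp only [smul_apply, innerSL_apply_apply, smul_eq_mul]
    ring
  simp only [e]
  refine le_antisymm (le_iSup_of_le (u - g) (by simp)) (iSup_le fun w => ?_)
  exact ENNReal.ofReal_le_ofReal (mul_le_mul_of_nonneg_left
    (sub_le_self _ (sq_nonneg _)) ha)

/-- A convex `[0, ∞]`-valued function is convex on its effective domain. -/
lemma convex_ne_top {f : E → ℝ≥0∞} (hf : ConvexOn ℝ≥0 univ f) : Convex ℝ≥0 {u | f u ≠ ⊤} := by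
  intro x hx y hy s t hs ht hst
  refine ne_top_of_le_ne_top ?_ (hf.2 (mem_univ x) (mem_univ y) hs ht hst)
  simp only [ENNReal.smul_def, smul_eq_mul]
  exact ENNReal.add_ne_top.2 ⟨ENNReal.mul_ne_top ENNReal.coe_ne_top hx,
    ENNReal.mul_ne_top ENNReal.coe_ne_top hy⟩

/-- The energy is the sum of the functional and the fidelity term, on the whole of `L²`. -/
lemma IsCellUnion.energyJ_eq {𝓐 : Finset (Finset (Euc d × ℝ))} (hO : IsCellUnion O 𝓐) (lam : ℝ)
    (g u : Lp ℝ 2 (volume.restrict O)) :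
    energyJ O lam g u = functionalI O u + ENNReal.ofReal (lam / 2 * ‖u - g‖ ^ 2) := by
  have : IsFiniteMeasure (volume.restrict O) := ⟨by simpa using hO.isBounded.measure_lt_top⟩
  have hui : IntegrableOn u O := (Lp.memLp u).integrable one_le_two
  have hsq : ∫ x in O, |u x - g x| ^ 2 = ‖u - g‖ ^ 2 := by
    rw [← real_inner_self_eq_norm_sq, L2.inner_def]
    refine integral_congr_ae ?_
    filter_upwards [Lp.coeFn_sub u g] with x hx
    rw [hx, Pi.sub_apply, real_inner_self_eq_norm_sq, Real.norm_eq_abs]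
  rw [energyJ, hsq]
  split_ifs with h
  · rw [(hO.trace_and_functionalI_eq h).2.2]
  · rw [hO.functionalI_eq_top hui h, top_add]

end Semicontinuity

end TVFlow

theorem mainTheorem8 {d : ℕ} (hd : 1 ≤ d) (O : Set (TVFlow.Euc d))
    (hO : TVFlow.IsPolyhedralDomain O)
    (lam : ℝ) (hlam : 0 ≤ lam) (g : Lp ℝ 2 (volume.restrict O)) :
    -- the boundary trace of a BV function exists almost everywhere and is integrable
    (∀ u : Lp ℝ 1 (volume.restrict O), TVFlow.MemBV O u →
      (∀ᵐ x ∂(TVFlow.surfaceMeasure O), ∃ z, TVFlow.HasTraceAt O u x z) ∧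
      Integrable (TVFlow.trace O u) (TVFlow.surfaceMeasure O)) ∧
    -- the formula for the functional on BV, and its value elsewhere
    (∀ u : Lp ℝ 1 (volume.restrict O), TVFlow.MemBV O u →
      TVFlow.functionalI O u = TVFlow.gradientTV O u + TVFlow.boundaryIntegral O u) ∧
    (∀ u : Lp ℝ 1 (volume.restrict O), ¬ TVFlow.MemBV O u → TVFlow.functionalI O u = ⊤) ∧
    -- weak lower semicontinuity and convexity of the functional on L¹ and on BV
    LowerSemicontinuous (fun u : WeakSpace ℝ (Lp ℝ 1 (volume.restrict O)) =>
      TVFlow.functionalI O ((toWeakSpace ℝ (Lp ℝ 1 (volume.restrict O))).symm u)) ∧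
    ConvexOn ℝ≥0 Set.univ
      (fun u : Lp ℝ 1 (volume.restrict O) => TVFlow.functionalI O u) ∧
    ConvexOn ℝ≥0 {u : Lp ℝ 1 (volume.restrict O) | TVFlow.MemBV O u}
      (fun u : Lp ℝ 1 (volume.restrict O) => TVFlow.functionalI O u) ∧
    -- weak lower semicontinuity and convexity of the energy on L² and on L² ∩ BV
    LowerSemicontinuous (fun u : WeakSpace ℝ (Lp ℝ 2 (volume.restrict O)) =>
      TVFlow.energyJ O lam g ((toWeakSpace ℝ (Lp ℝ 2 (volume.restrict O))).symm u)) ∧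
    ConvexOn ℝ≥0 Set.univ
      (fun u : Lp ℝ 2 (volume.restrict O) => TVFlow.energyJ O lam g u) ∧
    ConvexOn ℝ≥0 {u : Lp ℝ 2 (volume.restrict O) | TVFlow.MemBV O u}
      (fun u : Lp ℝ 2 (volume.restrict O) => TVFlow.energyJ O lam g u) := by

  obtain ⟨𝓐, hA⟩ := hO.exists_isCellUnion hd
  have hb := hA.isBounded
  have hOm := hA.isOpen.measurableSet
  have : IsFiniteMeasure (volume.restrict O) := ⟨by simpa using hb.measure_lt_top⟩
  have hi1 : ∀ u : Lp ℝ 1 (volume.restrict O), IntegrableOn u O := fun u =>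
    (Lp.memLp u).integrable le_rfl
  have hi2 : ∀ u : Lp ℝ 2 (volume.restrict O), IntegrableOn u O := fun u =>
    (Lp.memLp u).integrable one_le_two
  obtain ⟨ι₁, L₁, hL₁⟩ := TVFlow.exists_functionalI_eq_iSup (p := 1) hb hOm
  obtain ⟨ι₂, L₂, hL₂⟩ := TVFlow.exists_functionalI_eq_iSup (p := 2) hb hOm
  have hc₁ : ConvexOn ℝ≥0 univ
      fun u : Lp ℝ 1 (volume.restrict O) => TVFlow.functionalI O u := by
    simpa only [hL₁] using TVFlow.convexOn_iSup_ofReal L₁ fun _ => 0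
  have hc₂ : ConvexOn ℝ≥0 univ
      fun u : Lp ℝ 2 (volume.restrict O) => TVFlow.functionalI O u := by
    simpa only [hL₂] using TVFlow.convexOn_iSup_ofReal L₂ fun _ => 0
  have hlam2 : 0 ≤ lam / 2 := by positivity
  have hcJ : ConvexOn ℝ≥0 univ
      fun u : Lp ℝ 2 (volume.restrict O) => TVFlow.energyJ O lam g u := by
    simp only [hA.energyJ_eq, TVFlow.ofReal_mul_norm_sub_sq_eq_iSup hlam2]
    exact hc₂.add (TVFlow.convexOn_iSup_ofReal _ _)
  have hset₁ : {u : Lp ℝ 1 (volume.restrict O) | TVFlow.MemBV O u} =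
      {u : Lp ℝ 1 (volume.restrict O) | TVFlow.functionalI O u ≠ ⊤} := by
    ext u
    exact hA.memBV_iff (hi1 u)
  have hset₂ : {u : Lp ℝ 2 (volume.restrict O) | TVFlow.MemBV O u} =
      {u : Lp ℝ 2 (volume.restrict O) | TVFlow.functionalI O u ≠ ⊤} := by
    ext u
    exact hA.memBV_iff (hi2 u)
  refine ⟨fun u hu => ?_, fun u hu => (hA.trace_and_functionalI_eq hu).2.2,
    fun u hu => hA.functionalI_eq_top (hi1 u) hu, ?_, hc₁, ?_, ?_, hcJ, ?_⟩
  · exact ⟨(hA.trace_and_functionalI_eq hu).1, (hA.trace_and_functionalI_eq hu).2.1⟩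
  · simp only [hL₁]
    exact TVFlow.lowerSemicontinuous_iSup_ofReal L₁ fun _ => 0
  · exact hc₁.subset (subset_univ _) (hset₁ ▸ TVFlow.convex_ne_top hc₁)
  · simp only [hA.energyJ_eq, hL₂, TVFlow.ofReal_mul_norm_sub_sq_eq_iSup hlam2]
    exact (TVFlow.lowerSemicontinuous_iSup_ofReal L₂ fun _ => 0).add
      (TVFlow.lowerSemicontinuous_iSup_ofReal _ _)
  · exact hcJ.subset (subset_univ _) (hset₂ ▸ TVFlow.convex_ne_top hc₂)
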